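/- **Setting.** Let $I$, $A$, $T$ be finite index sets and let $\Lambda$ be the complex Grassmann algebra on a set $P$ of odd parameters. For $0\le k\le n$ let $u_{n,k},v_{n,k}$ be $I\times I$ matrices over $\Lambda$ whose entries have parity $k$ and $n-k$, respectively; for $\alpha\in T$ let $t^\alpha\in\mathbb C^{A\times A}$ with $(t^\alpha)^{T}=(-1)^{|t^\alpha|}t^\alpha$, $|t^\alpha|\in\mathbb N$. Upper signs refer to bosonic fields $\phi_x,\bar\phi_x$ and lower signs to fermionic fields, $x\in I\times A$. Put $(C_n)_i^{jl}=\sum_{k=0}^n(\pm1)^{n-k}(u_{n,k})_i^j(v_{n,k})_i^l$, the coefficients of $\sum_k(u_{n,k}f)_i(v_{n,k}g)_i=\sum_{j,l}(C_n)_i^{jl}f_jg_l$ for fields $f,g$ of the given statistics, and assume $(C_n)_i^{jl}=(-1)^{\lfloor (n+1)/2\rfloor}(C_n)_i^{lj}$. For fields $f,g$ let $$\big((C_n\otimes t^\alpha)\cdot fg\big)_i=\sum_{k=0}^n\sum_{a,b}t^\alpha_{ab}\Big(\sum_j(u_{n,k})_i^jf_{ja}\Big)\Big(\sum_l(v_{n,k})_i^lg_{lb}\Big).$$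 For $n<N$ ($N\in\mathbb N$ arbitrary) define $O_n^\alpha=(C_{2n}\otimes t^\alpha)\cdot\bar\phi\phi$, $S_n^\alpha=(C_{2n+1}\otimes t^\alpha)\cdot\phi\phi$, $\bar S_n^\alpha=(C_{2n+1}\otimes t^\alpha)\cdot\bar\phi\bar\phi$, the latter two only for admissible $(n,\alpha)$, i.e. $(-1)^{n+1+|t^\alpha|}=1$ for bosons and $(-1)^{n+|t^\alpha|}=1$ for fermions. The kernel $\Delta$ is an $(I\times A)\times(I\times A)$ matrix with even entries in $\Lambda$ and $\Delta^{T}=\pm\Delta$. For bosons its numerical part $B$ satisfies $\mathrm{Re}\,\bar zBz>0$ for all complex $z\ne0$; for fermions $\Delta$ is invertible. Let $J_O$ be even and $J_S,\bar J_S$ odd independent sources ($J_S=\bar J_S=0$ for non-admissible $(n,\alpha)$), $\lambda$ a formal variable counting sources, $$Z[\lambda J]=\int[d\bar\phi][d\phi]\exp\Big(-\bar\phi\Delta\phi+\lambda\sum_{n<N,\alpha,i}\big((O_n^\alpha)_i(J_{O_n^\alpha})^i+(S_n^\alpha)_i(J_{S_n^\alpha})^i+(\bar S_n^\alpha)_i(\bar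 J_{S_n^\alpha})^i\big)\Big),\qquad W[\lambda J]=\log\frac{Z[\lambda J]}{Z[0]},$$ as formal power series in $\lambda$. The integral is the Gaussian integral over $\mathbb C^{I\times A}$ with weight $e^{-\bar\phi B\phi}$ (the exponential of the nilpotent remainder and of the source term being expanded) for bosons, and the Berezin integral for fermions. **Notation.** Put $$(\Delta^{-1}_{nk,n'k'})_{ia,jb}=\sum_{i',j'}(v_{n,k})_i^{i'}(u_{n',k'})_j^{j'}\Delta^{-1}_{i'a,j'b}.$$ For $n,n'<2N$, $0\le k\le n$, $0\le k'\le n'$ let $$\mathbf\Delta^{-1}_{nk,n'k'}=\begin{pmatrix}0&\Delta^{-1}_{nk,n'k'}\\ \Delta^{-1}_{nk,n'k'}&0\end{pmatrix},\qquad J_{2n}^\alpha=\begin{pmatrix}0&\tfrac12(-1)^{|t^\alpha|}J_{O_n^\alpha}\\ \tfrac12J_{O_n^\alpha}&0\end{pmatrix},\qquad J_{2n+1}^\alpha=\begin{pmatrix}J_{S_n^\alpha}&0\\0&\bar J_{S_n^\alpha}\end{pmatrix}.$$ Let $M^\pm$ be diagonal in $(n,k)$, with $M^+_{nk,nk}=\mathrm{diag}((-1)^{n/2},1)$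 for even $n$ and $(-1)^{k+1}\mathbf 1_2$ for odd $n$; $M^-_{nk,nk}=\mathrm{diag}((-1)^{n/2+k+1},(-1)^k)$ for even $n$ and $\mathbf 1_2$ for odd $n$. Let $t^\alpha$ act on the index in $A$ and as $\mathbf 1_2$ on the $2\times2$ index. Sources are evaluated at the column index $j$. On matrices with indices $(n,k),i,a$ and a $2\times2$ index, let $\mathrm{str}\,X=\sum_{n,k,i,a}(-1)^{n-k}\,\mathrm{tr}_{2\times2}X_{nkia,nkia}$, and let $\log(1-\lambda K)=-\sum_{r\ge1}\lambda^rK^r/r$. **Claims.** 1. $\Delta$ and $Z[0]$ are invertible, and $\frac1{Z[0]}\int[d\bar\phi][d\phi]\,\phi_x\bar\phi_y\,e^{-\bar\phi\Delta\phi}=\Delta^{-1}_{xy}$. 2. The generating functional of connected correlators is $$W[\lambda J]=\mp\tfrac12\,\mathrm{str}\log\Big(1-2\lambda\sum_{n',k',\alpha}\mathbf\Delta^{-1}_{n_1k_1,n'k'}M^\pm_{n'k',n_2k_2}t^\alpha J^\alpha_{n_2}\Big).$$ 3. Explicitly, $W[\lambda J]=\mp\frac12\,\mathrm{str}\log(1-\lambda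 K^\pm)$. The column with index $(n_2,k_2)$ of $K^\pm$ is as follows (summed over $\alpha$). If $n_2=2n$ is even, $$K^+=\begin{pmatrix}\Delta^{-1}_{n_1k_1,n_2k_2}t^\alpha J_{O_n^\alpha}&0\\0&(-1)^{n+|t^\alpha|}\Delta^{-1}_{n_1k_1,n_2k_2}t^\alpha J_{O_n^\alpha}\end{pmatrix},$$ $$K^-=\begin{pmatrix}(-1)^{k_2}\Delta^{-1}_{n_1k_1,n_2k_2}t^\alpha J_{O_n^\alpha}&0\\0&(-1)^{n+1+k_2+|t^\alpha|}\Delta^{-1}_{n_1k_1,n_2k_2}t^\alpha J_{O_n^\alpha}\end{pmatrix};$$ if $n_2=2n+1$ is odd, $$K^\pm=c^\pm\begin{pmatrix}0&\Delta^{-1}_{n_1k_1,n_2k_2}t^\alpha\bar J_{S_n^\alpha}\\ \Delta^{-1}_{n_1k_1,n_2k_2}t^\alpha J_{S_n^\alpha}&0\end{pmatrix},\qquad c^+=-2(-1)^{k_2},\quad c^-=2.$$ 4. For $M\ge1$ and any $(n_m,\alpha_m,i_m)$, $m=1,\dots,M$, the connected correlator of the $O$'s, i.e. $\prod_m\partial/\partial(J_{O_{n_m}^{\alpha_m}})^{i_m}W[\lambda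 J]$ at $J=0$, is $\lambda^M$ times $$\pm\frac1M\,\frac{1+(\pm1)^M(-1)^{\sum_m(n_m+|t^{\alpha_m}|)}}2\sum_{k_1=0}^{2n_1}\!\cdots\!\sum_{k_M=0}^{2n_M}\sum_{\sigma\in S_M}(-1)^{k_{\sigma(1)}}\prod_m(\pm1)^{k_{\sigma(m)}}\;\mathrm{tr}\prod_{m=1}^M\Big[\big(\Delta^{-1}_{2n_{\sigma(m)}k_{\sigma(m)},\,2n_{\sigma(m+1)}k_{\sigma(m+1)}}\big)_{i_{\sigma(m)}i_{\sigma(m+1)}}t^{\alpha_{\sigma(m+1)}}\Big].$$ Here and below matrix products are ordered from left to right, $\mathrm{tr}$ is the trace over $A$, and positions are cyclic, $M+1\equiv1$. 5. For $M\ge1$ and admissible $(n_m,\alpha_m)$, $(n'_m,\alpha'_m)$, and any $i_m,i'_m\in I$, the connected correlator of $S_1\bar S_1\cdots S_M\bar S_M$, where $S_m=(S_{n_m}^{\alpha_m})_{i_m}$ and $\bar S_m=(\bar S_{n'_m}^{\alpha'_m})_{i'_m}$, is obtained by applying to $W[\lambda J]$ at $J=0$ the ordered product of the operators $\big(-\partial/\partial(J_{S_{n_m}^{\alpha_m}})^{i_m}\big)\big(-\partial/\partial(\bar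 J_{S_{n'_m}^{\alpha'_m}})^{i'_m}\big)$ (left derivatives). It is $\lambda^{2M}$ times $$\pm\frac{2^{2M-1}}M\sum_{k_1=0}^{2n_1+1}\!\cdots\!\sum_{k_M=0}^{2n_M+1}\ \sum_{k'_1=0}^{2n'_1+1}\!\cdots\!\sum_{k'_M=0}^{2n'_M+1}\ \sum_{\rho,\sigma\in S_M}\mathrm{sgn}(\sigma)\,\mathrm{sgn}(\rho)\,(-1)^{k_{\sigma(1)}}\prod_m(\pm1)^{k_{\sigma(m)}+k'_{\rho(m)}}\;\mathrm{tr}\prod_{m=1}^M X_m,$$ $$X_m=\big(\Delta^{-1}_{2n_{\sigma(m)}+1\,k_{\sigma(m)},\,2n'_{\rho(m)}+1\,k'_{\rho(m)}}\big)_{i_{\sigma(m)}i'_{\rho(m)}}\,t^{\alpha'_{\rho(m)}}\,\big(\Delta^{-1}_{2n'_{\rho(m)}+1\,k'_{\rho(m)},\,2n_{\sigma(m+1)}+1\,k_{\sigma(m+1)}}\big)_{i'_{\rho(m)}i_{\sigma(m+1)}}\,t^{\alpha_{\sigma(m+1)}}.$$ 6. The connected correlators of different numbers of $S$'s and $\bar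 S$'s (and no $O$'s) vanish. -/

import Mathlib

open scoped TensorProduct

noncomputable section

namespace SuperGauss

/-! ### Superpolynomial algebras -/

/-- The complex Grassmann algebra freely generated by anticommuting generators `θ o`, `o : σ`. -/
abbrev Gr (σ : Type*) := ExteriorAlgebra ℂ (σ →₀ ℂ)

/-- The free supercommutative algebra on even generators `E` and odd generators `O`. -/
abbrev SPoly (E O : Type*) := MvPolynomial E ℂ ⊗[ℂ] Gr O

/-- The even (`i = 0`) and odd (`i = 1`) parts of a Grassmann algebra. -/
abbrev Gr.part (σ : Type*) (i : ZMod 2) : Submodule ℂ (Gr σ) :=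
  CliffordAlgebra.evenOdd (0 : QuadraticForm ℂ (σ →₀ ℂ)) i

/-- The odd generators. -/
def Gr.gen {σ : Type*} (o : σ) : Gr σ := ExteriorAlgebra.ι ℂ (Finsupp.single o 1)

/-- The left derivative `∂/∂θ_o`: the antiderivation with `∂ θ_o' / ∂ θ_o = δ_{o o'}`. -/
def Gr.deriv {σ : Type*} (o : σ) : Module.End ℂ (Gr σ) :=
  CliffordAlgebra.contractLeft (Q := (0 : QuadraticForm ℂ (σ →₀ ℂ))) (Finsupp.lapply o)

/-- The inclusion `Gr σ → Gr (σ ⊕ τ)`. -/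
def Gr.inl (σ τ : Type*) : Gr σ →ₐ[ℂ] Gr (σ ⊕ τ) :=
  ExteriorAlgebra.map (Finsupp.lmapDomain ℂ ℂ Sum.inl)

/-- The map `Gr (σ ⊕ τ) → Gr σ` that sets the generators indexed by `τ` to zero. -/
def Gr.restrict (σ τ : Type*) : Gr (σ ⊕ τ) →ₐ[ℂ] Gr σ :=
  ExteriorAlgebra.map (Finsupp.lcomapDomain Sum.inl Sum.inl_injective)

/-- Even generators of a superpolynomial algebra. -/
def evenVar {E O : Type*} (e : E) : SPoly E O := MvPolynomial.X e ⊗ₜ 1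

/-- Grassmann elements, seen in a superpolynomial algebra. -/
def ofGr {E O : Type*} : Gr O →ₐ[ℂ] SPoly E O := Algebra.TensorProduct.includeRight

/-- Odd generators of a superpolynomial algebra. -/
def oddVar {E O : Type*} (o : O) : SPoly E O := ofGr (Gr.gen o)

/-! ### The two statistics -/

/-- Bosonic or fermionic fields. -/
inductive Statistics
  | bose
  | fermi

/-- `+1` for bosonic fields, `-1` for fermionic fields. -/
def Statistics.sign : Statistics → ℂ
  | .bose => 1
  | .fermi => -1

/-! ### Functional integrals over finitely many field variables -/

/-- The moment `∫ ∏ₓ φₓ ^ mₓ φ̄ₓ ^ m̄ₓ exp (- ∑ φ̄ₓ Bₓᵧ φᵧ) [dφ̄][dφ]`, an integral over the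
complex variables `φₓ`, for the exponents `m (inl x) = mₓ`, `m (inr x) = m̄ₓ`. -/
def gaussMoment {X : Type*} [Fintype X] (B : Matrix X X ℂ) (m : X ⊕ X →₀ ℕ) : ℂ :=
  ∫ φ : X → ℂ,
    (∏ x, φ x ^ m (.inl x) * (starRingEnd ℂ (φ x)) ^ m (.inr x)) *
      Complex.exp (-∑ x, ∑ y, starRingEnd ℂ (φ x) * B x y * φ y)

/-- The integral `f ↦ ∫ f exp (- φ̄ B φ) [dφ̄][dφ]` over the bosonic fields `φₓ` (generators
`inr (inl x)`) and `φ̄ₓ` (generators `inr (inr x)`), linear in all other variables. -/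
def bosonIntegral {E O X : Type*} [Fintype X] (B : Matrix X X ℂ) :
    SPoly (E ⊕ (X ⊕ X)) O →ₗ[ℂ] SPoly E O :=
  LinearMap.rTensor (Gr O)
    ((MvPolynomial.basisMonomials (E ⊕ (X ⊕ X)) ℂ).constr ℂ fun m =>
      gaussMoment B (Finsupp.sumFinsuppEquivProdFinsupp m).2 •
        MvPolynomial.monomial (Finsupp.sumFinsuppEquivProdFinsupp m).1 1)

/-- The Berezin integral `∫ ∏ₓ dψ̄ₓ dψₓ` over the generators `ψₓ = inr (inl x)` and
`ψ̄ₓ = inr (inr x)`.  The pairs `∂/∂ψ̄ₓ ∂/∂ψₓ` commute, so the order of the product over `x`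
does not matter. -/
def berezin {O X : Type*} [Fintype X] : Gr (O ⊕ (X ⊕ X)) →ₗ[ℂ] Gr O :=
  (Gr.restrict O (X ⊕ X)).toLinearMap ∘ₗ
    ((Finset.univ : Finset X).toList.map fun x =>
      Gr.deriv (σ := O ⊕ (X ⊕ X)) (.inr (.inr x)) * Gr.deriv (.inr (.inl x))).prod

/-- The Berezin integral, linear in all other variables. -/
def fermionIntegral {E O X : Type*} [Fintype X] : SPoly E (O ⊕ (X ⊕ X)) →ₗ[ℂ] SPoly E O :=
  LinearMap.lTensor (MvPolynomial E ℂ) berezin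

/-! ### Operators and kernels -/

/-- The matrices `(u_{n,k})_i^j`, `(v_{n,k})_i^j` (`0 ≤ k ≤ n`) that make up the `C_n`, with entries
in the Grassmann algebra of odd parameters `P`; the matrices `t^α`; the numbers `|t^α|`. -/
structure OperatorData (P I A T : Type*) where
  u : ℕ → ℕ → Matrix I I (Gr P)
  v : ℕ → ℕ → Matrix I I (Gr P)
  t : T → Matrix A A ℂ
  τ : T → ℕ

variable {P I A T : Type*}

/-- The coefficients `(C_n)_i^{jl}`, defined by
`∑_k (∑_j (u_{n,k})_i^j f_j) (∑_l (v_{n,k})_i^l g_l) = ∑_{j,l} (C_n)_i^{jl} f_j g_l`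
for fields `f`, `g` of the given statistics: `v_{n,k}`, of parity `n - k`, is moved to the left
of `f_j`. -/
def OperatorData.C (D : OperatorData P I A T) (st : Statistics) (n : ℕ) (i j l : I) : Gr P :=
  ∑ k ∈ Finset.range (n + 1), st.sign ^ (n - k) • (D.u n k i j * D.v n k i l)

/-- The gradings and symmetries of the operator data.  The symmetry of `C_n` reads
`∑ C_i^{jl} φ_j φ'_l = (-1)^{⌊(n+1)/2⌋} ∑ C_i^{lj} φ'_l φ_j` for bosonic fields and
`∑ C_i^{jl} ψ_j ψ'_l = (-1)^{⌊(n+1)/2⌋+1} ∑ C_i^{lj} ψ'_l ψ_j` for fermionic fields; in both cases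
this is the relation `symm` between coefficients. -/
structure OperatorData.IsGraded (D : OperatorData P I A T) (st : Statistics) : Prop where
  u_mem : ∀ n k : ℕ, k ≤ n → ∀ i j, D.u n k i j ∈ Gr.part P (k : ZMod 2)
  v_mem : ∀ n k : ℕ, k ≤ n → ∀ i j, D.v n k i j ∈ Gr.part P ((n - k : ℕ) : ZMod 2)
  symm : ∀ n i j l, D.C st n i j l = (-1) ^ ((n + 1) / 2) * D.C st n i l j
  t_transpose : ∀ α, (D.t α).transpose = (-1 : ℂ) ^ D.τ α • D.t α

/-- The numerical part of a matrix with Grassmann entries. -/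
def body {X : Type*} (Δ : Matrix X X (Gr P)) : Matrix X X ℂ :=
  Δ.map ExteriorAlgebra.algebraMapInv

/-- Kernels of free kinetic terms: even entries, (anti)symmetric according to the statistics.
For bosons the Gaussian integral converges; for fermions the kernel is invertible. -/
def IsKernel {X : Type*} [Fintype X] [DecidableEq X] (st : Statistics)
    (Δ : Matrix X X (Gr P)) : Prop :=
  (∀ x y, Δ x y ∈ Gr.part P 0) ∧ Δ.transpose = st.sign • Δ ∧
    match st with
    | .bose => ∀ z : X → ℂ, z ≠ 0 →
        0 < (∑ x, ∑ y, starRingEnd ℂ (z x) * body Δ x y * z y).re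
    | .fermi => IsUnit Δ

/-- Labels `(n, α, i)` of the operators `(O_n^α)_i`, `(S_n^α)_i`, `(S̄_n^α)_i`, `n < N`. -/
abbrev Lab (N : ℕ) (T I : Type*) := Fin N × T × I

/-- The condition on `(n, α)` under which `S_n^α` and `S̄_n^α` are considered:
`(-1)^{n+1+|t^α|} = 1` for bosons, `(-1)^{n+|t^α|} = 1` for fermions. -/
def OperatorData.Admissible (D : OperatorData P I A T) (st : Statistics) (n : ℕ) (α : T) : Prop :=
  match st with
  | .bose => Even (n + 1 + D.τ α)
  | .fermi => Even (n + D.τ α)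

/-- Odd generators: the parameters, and the sources `J_S`, `J̄_S`. -/
abbrev OddGen (P : Type*) (N : ℕ) (T I : Type*) := P ⊕ (Lab N T I ⊕ Lab N T I)

/-- The algebra of sources: the even `J_O` and the odd `J_S`, `J̄_S`, over the parameters. -/
abbrev SrcAlg (P : Type*) (N : ℕ) (T I : Type*) := SPoly (Lab N T I) (OddGen P N T I)

/-- The source generators `g`, switched off for the pairs `(n, α)` that are not admissible. -/
def OperatorData.oddSource {N : ℕ} {R : Type*} [Zero R] (D : OperatorData P I A T)
    (st : Statistics) (g : Lab N T I → R) (l : Lab N T I) : R :=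
  open Classical in if D.Admissible st l.1 l.2.1 then g l else 0

section Action

variable {F : Type*} [Ring F] [Algebra ℂ F] [Fintype I] [Fintype A] [Fintype T]

/-- The operator `((C_n ⊗ t^α) · f g)_i`, in an algebra `F` that contains the fields `f`, `g` and
(through `c`) the parameters. -/
def OperatorData.op (D : OperatorData P I A T) (c : Gr P →ₐ[ℂ] F) (n : ℕ) (α : T) (i : I)
    (f g : I × A → F) : F :=
  ∑ k ∈ Finset.range (n + 1), ∑ a, ∑ b,
    D.t α a b • ((∑ j, c (D.u n k i j) * f (j, a)) * (∑ l, c (D.v n k i l) * g (l, b)))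

/-- The source term `∑ (O J_O + S J_S + S̄ J̄_S)` of the action, the sources on the right. -/
def OperatorData.sourceTerm {N : ℕ} (D : OperatorData P I A T) (c : Gr P →ₐ[ℂ] F)
    (f fbar : I × A → F) (JO JS JSbar : Lab N T I → F) : F :=
  ∑ n : Fin N, ∑ α, ∑ i,
    (D.op c (2 * (n : ℕ)) α i fbar f * JO (n, α, i) +
      D.op c (2 * (n : ℕ) + 1) α i f f * JS (n, α, i) +
      D.op c (2 * (n : ℕ) + 1) α i fbar fbar * JSbar (n, α, i))

/-- The quadratic form `∑ f̄ₓ Kₓᵧ fᵧ`. -/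
def quadratic {X : Type*} [Fintype X] (c : Gr P →ₐ[ℂ] F) (K : Matrix X X (Gr P))
    (f fbar : X → F) : F :=
  ∑ x, ∑ y, fbar x * c (K x y) * f y

end Action

/-! ### Generating functionals -/

/-- Exponential of a nilpotent element. -/
def nilExp {R : Type*} [Ring R] [Algebra ℂ R] (x : R) : R :=
  ∑ m ∈ Finset.range (nilpotencyClass x), ((m.factorial : ℂ)⁻¹) • x ^ m

/-- The logarithm of a formal power series with constant coefficient `1`:
`log F = ∑_{r ≥ 1} (-1)^{r+1} (F - 1)^r / r`. -/
def seriesLog {R : Type*} [Ring R] [Algebra ℂ R] (F : PowerSeries R) : PowerSeries R :=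
  PowerSeries.mk fun m =>
    ∑ r ∈ Finset.Icc 1 m, ((-1 : ℂ) ^ (r + 1) / r) • PowerSeries.coeff m ((F - 1) ^ r)

/-- The normalized formal series
`⟨exp (λ s)⟩ = ∑_m λ^m / m! ∫ s^m dμ / ∫ 1 dμ` for a linear functional `∫ · dμ`. -/
def normalizedExp {F R : Type*} [Ring F] [Algebra ℂ F] [Ring R] [Algebra ℂ R]
    (integral : F →ₗ[ℂ] R) (s : F) : PowerSeries R :=
  PowerSeries.mk fun m => ((m.factorial : ℂ)⁻¹) • (Ring.inverse (integral 1) * integral (s ^ m))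

/-- The algebra of parameters, sources and bosonic fields. -/
abbrev BoseAlg (P I A T : Type*) (N : ℕ) :=
  SPoly (Lab N T I ⊕ ((I × A) ⊕ (I × A))) (OddGen P N T I)

/-- The algebra of parameters, sources and fermionic fields. -/
abbrev FermiAlg (P I A T : Type*) (N : ℕ) :=
  SPoly (Lab N T I) (OddGen P N T I ⊕ ((I × A) ⊕ (I × A)))

/-- Parameters in the algebra of sources. -/
def srcParam (P I T : Type*) (N : ℕ) : Gr P →ₐ[ℂ] SrcAlg P N T I :=
  ofGr.comp (Gr.inl P _)

/-- Parameters in the algebra of bosonic fields. -/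
def boseParam (P I A T : Type*) (N : ℕ) : Gr P →ₐ[ℂ] BoseAlg P I A T N :=
  ofGr.comp (Gr.inl P _)

/-- Parameters in the algebra of fermionic fields. -/
def fermiParam (P I A T : Type*) (N : ℕ) : Gr P →ₐ[ℂ] FermiAlg P I A T N :=
  ofGr.comp ((Gr.inl (OddGen P N T I) _).comp (Gr.inl P _))

section Generating

variable [Fintype I] [Fintype A] [Fintype T]

/-- `f ↦ ∫ [dφ̄][dφ] f exp (- φ̄ Δ φ)`.  The numerical part `B` of `Δ` enters through the Gaussian
weight, the nilpotent rest `Δ - B` through its terminating exponential series. -/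
def boseIntegral (T : Type*) (N : ℕ) (Δ : Matrix (I × A) (I × A) (Gr P)) :
    BoseAlg P I A T N →ₗ[ℂ] SrcAlg P N T I :=
  bosonIntegral (body Δ) ∘ₗ LinearMap.mulRight ℂ (nilExp (-quadratic (boseParam P I A T N)
    (Δ - (body Δ).map (algebraMap ℂ (Gr P)))
    (fun x => evenVar (.inr (.inl x))) (fun x => evenVar (.inr (.inr x)))))

/-- `f ↦ ∫ [dψ̄][dψ] f exp (- ψ̄ Δ ψ)`. -/
def fermiIntegral (T : Type*) (N : ℕ) (Δ : Matrix (I × A) (I × A) (Gr P)) :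
    FermiAlg P I A T N →ₗ[ℂ] SrcAlg P N T I :=
  fermionIntegral ∘ₗ LinearMap.mulRight ℂ (nilExp (-quadratic (fermiParam P I A T N) Δ
    (fun x => oddVar (.inr (.inl x))) (fun x => oddVar (.inr (.inr x)))))

/-- The source term of the bosonic theory. -/
def boseSource (N : ℕ) (D : OperatorData P I A T) : BoseAlg P I A T N :=
  D.sourceTerm (boseParam P I A T N)
    (fun x => evenVar (.inr (.inl x))) (fun x => evenVar (.inr (.inr x)))
    (fun l => evenVar (.inl l))
    (D.oddSource .bose fun l => oddVar (.inr (.inl l)))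
    (D.oddSource .bose fun l => oddVar (.inr (.inr l)))

/-- The source term of the fermionic theory. -/
def fermiSource (N : ℕ) (D : OperatorData P I A T) : FermiAlg P I A T N :=
  D.sourceTerm (fermiParam P I A T N)
    (fun x => oddVar (.inr (.inl x))) (fun x => oddVar (.inr (.inr x)))
    (fun l => evenVar l)
    (D.oddSource .fermi fun l => oddVar (.inl (.inr (.inl l))))
    (D.oddSource .fermi fun l => oddVar (.inl (.inr (.inr l))))

/-- `Z[0]`. -/
def vacuum (T : Type*) [Fintype T] (N : ℕ) (st : Statistics)
    (Δ : Matrix (I × A) (I × A) (Gr P)) : SrcAlg P N T I :=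
  match st with
  | .bose => boseIntegral T N Δ 1
  | .fermi => fermiIntegral T N Δ 1

/-- `∫ f_x f̄_y exp (- f̄ Δ f)`, the unnormalized two-point function of the fields. -/
def twoPoint (T : Type*) [Fintype T] (N : ℕ) (st : Statistics)
    (Δ : Matrix (I × A) (I × A) (Gr P)) (x y : I × A) : SrcAlg P N T I :=
  match st with
  | .bose => boseIntegral T N Δ (evenVar (.inr (.inl x)) * evenVar (.inr (.inr y)))
  | .fermi => fermiIntegral T N Δ (oddVar (.inr (.inl x)) * oddVar (.inr (.inr y)))

/-- `Z[λJ] / Z[0]`, a formal power series in `λ`. -/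
def partitionFunction (N : ℕ) (D : OperatorData P I A T) (st : Statistics)
    (Δ : Matrix (I × A) (I × A) (Gr P)) : PowerSeries (SrcAlg P N T I) :=
  match st with
  | .bose => normalizedExp (boseIntegral T N Δ) (boseSource N D)
  | .fermi => normalizedExp (fermiIntegral T N Δ) (fermiSource N D)

/-- The generating functional of connected correlators `W[λJ] = log (Z[λJ] / Z[0])`. -/
def connectedFunctional (N : ℕ) (D : OperatorData P I A T) (st : Statistics)
    (Δ : Matrix (I × A) (I × A) (Gr P)) : PowerSeries (SrcAlg P N T I) :=
  seriesLog (partitionFunction N D st Δ)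

end Generating

/-! ### The supermatrix -/

/-- The pairs `(n, k)` with `n < 2 N` and `0 ≤ k ≤ n`. -/
abbrev NK (N : ℕ) := Σ n : Fin (2 * N), Fin ((n : ℕ) + 1)

/-- The row index `(n, k), i, a` together with the `2 × 2` index. -/
abbrev SIndex (N : ℕ) (I A : Type*) := (NK N × I × A) × Fin 2

/-- The sources in the algebra of sources. -/
def srcO (P : Type*) {N : ℕ} {T I : Type*} (l : Lab N T I) : SrcAlg P N T I := evenVar l

/-- The sources `J_S` in the algebra of sources. -/
def OperatorData.srcS {N : ℕ} (D : OperatorData P I A T) (st : Statistics) (l : Lab N T I) :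
    SrcAlg P N T I :=
  D.oddSource st (fun l => oddVar (.inr (.inl l))) l

/-- The sources `J̄_S` in the algebra of sources. -/
def OperatorData.srcSbar {N : ℕ} (D : OperatorData P I A T) (st : Statistics) (l : Lab N T I) :
    SrcAlg P N T I :=
  D.oddSource st (fun l => oddVar (.inr (.inr l))) l

/-- The matrices `J_{2m}^α` and `J_{2m+1}^α` at the point `j`. -/
def OperatorData.sourceMatrix {N : ℕ} (D : OperatorData P I A T) (st : Statistics)
    (n : Fin (2 * N)) (α : T) (j : I) : Matrix (Fin 2) (Fin 2) (SrcAlg P N T I) :=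
  let l : Lab N T I := (⟨(n : ℕ) / 2, by omega⟩, α, j)
  if Even (n : ℕ) then
    !![0, ((-1 : ℂ) ^ D.τ α / 2) • srcO P l; (1 / 2 : ℂ) • srcO P l, 0]
  else
    !![D.srcS st l, 0; 0, D.srcSbar st l]

/-- The matrices `M^±_{nk,n'k'}`. -/
def signMatrix {N : ℕ} (st : Statistics) (p q : NK N) : Matrix (Fin 2) (Fin 2) ℂ :=
  let n : ℕ := p.1
  let k : ℕ := p.2
  if p = q then
    match st with
    | .bose =>
      if Even n then !![(-1) ^ (n / 2), 0; 0, 1] else !![(-1) ^ (k + 1), 0; 0, (-1) ^ (k + 1)]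
    | .fermi =>
      if Even n then !![(-1) ^ (n / 2 + k + 1), 0; 0, (-1) ^ k] else !![1, 0; 0, 1]
  else 0

section Kernel

variable [Fintype I] [DecidableEq I] [Fintype A] [DecidableEq A]

/-- `(Δ⁻¹_{nk,n'k'})_{ia,jb} = ∑ (v_{n,k})_i^{i'} (u_{n',k'})_j^{j'} Δ⁻¹_{i'a,j'b}`, as a matrix in
`a`, `b`. -/
def OperatorData.kernel (D : OperatorData P I A T) (Δ : Matrix (I × A) (I × A) (Gr P))
    (n k : ℕ) (i : I) (n' k' : ℕ) (j : I) : Matrix A A (Gr P) :=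
  Matrix.of fun a b => ∑ i', ∑ j',
    D.v n k i i' * D.u n' k' j j' * (Ring.inverse Δ) (i', a) (j', b)

variable [Fintype T]

/-- `∑ 𝚫⁻¹_{n₁k₁,n'k'} M^±_{n'k',n₂k₂} 𝐭^α J_{n₂}^α`. -/
def superKernel (N : ℕ) (D : OperatorData P I A T) (st : Statistics)
    (Δ : Matrix (I × A) (I × A) (Gr P)) :
    Matrix (SIndex N I A) (SIndex N I A) (SrcAlg P N T I) :=
  Matrix.of fun x y =>
    let ((p, i, a), c) := x
    let ((q, j, b), d) := y
    ∑ r : NK N, ∑ a', ∑ α,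
      let κ : SrcAlg P N T I := srcParam P I T N (D.kernel Δ p.1 p.2 i r.1 r.2 j a a')
      D.t α a' b •
        ((!![0, κ; κ, 0] : Matrix (Fin 2) (Fin 2) (SrcAlg P N T I)) *
          (signMatrix st r q).map (algebraMap ℂ (SrcAlg P N T I)) *
          D.sourceMatrix st q.1 α j) c d

/-- The matrix `K` for which `1 - K` is the explicit `2 × 2` block matrix of the generating
functional of the given statistics. -/
def explicitKernel (N : ℕ) (D : OperatorData P I A T) (st : Statistics)
    (Δ : Matrix (I × A) (I × A) (Gr P)) :
    Matrix (SIndex N I A) (SIndex N I A) (SrcAlg P N T I) :=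
  Matrix.of fun x y =>
    let ((p, i, a), c) := x
    let ((q, j, b), d) := y
    let k₂ : ℕ := q.2
    let even (w : Fin N → T → ℂ) : SrcAlg P N T I :=
      ∑ n : Fin N, ∑ a', ∑ α, if 2 * (n : ℕ) = q.1 then
        (w n α * D.t α a' b) •
          (srcParam P I T N (D.kernel Δ p.1 p.2 i (2 * (n : ℕ)) k₂ j a a') * srcO P (n, α, j)) else 0
    let odd (w : ℂ) (J : Lab N T I → SrcAlg P N T I) : SrcAlg P N T I :=
      ∑ n : Fin N, ∑ a', ∑ α, if 2 * (n : ℕ) + 1 = q.1 then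
        (w * D.t α a' b) •
          (srcParam P I T N (D.kernel Δ p.1 p.2 i (2 * (n : ℕ) + 1) k₂ j a a') * J (n, α, j)) else 0
    match st with
    | .bose =>
      (!![even fun _ _ => 1, odd (-2 * (-1) ^ k₂) (D.srcSbar .bose);
          odd (-2 * (-1) ^ k₂) (D.srcS .bose), even fun n α => (-1) ^ ((n : ℕ) + D.τ α)] :
        Matrix (Fin 2) (Fin 2) (SrcAlg P N T I)) c d
    | .fermi =>
      (!![even fun _ _ => (-1) ^ k₂, odd 2 (D.srcSbar .fermi);
          odd 2 (D.srcS .fermi), even fun n α => (-1) ^ ((n : ℕ) + 1 + k₂ + D.τ α)] :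
        Matrix (Fin 2) (Fin 2) (SrcAlg P N T I)) c d

end Kernel

/-- The supertrace `str X = ∑_{n,k,i,a} (-1)^{n-k} tr_{2×2} X_{nkia,nkia}`. -/
def superTrace {N : ℕ} {R : Type*} [Ring R] [Fintype I] [Fintype A]
    (X : Matrix (SIndex N I A) (SIndex N I A) R) : R :=
  ∑ p : NK N, ∑ i, ∑ a, (-1) ^ ((p.1 : ℕ) - (p.2 : ℕ)) * ∑ c, X ((p, i, a), c) ((p, i, a), c)

/-- `str log (1 - λ K)`, a formal power series in `λ`. -/
def superTraceLog {N : ℕ} {R : Type*} [Ring R] [Algebra ℂ R] [Fintype I] [DecidableEq I]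
    [Fintype A] [DecidableEq A] (K : Matrix (SIndex N I A) (SIndex N I A) R) : PowerSeries R :=
  PowerSeries.mk fun m =>
    superTrace (PowerSeries.coeff m (seriesLog (1 - PowerSeries.X * PowerSeries.C K)))

/-! ### Correlators -/

/-- `∂/∂(J_{O_n^α})^i`. -/
def derivO (P : Type*) {N : ℕ} {T I : Type*} (l : Lab N T I) : Module.End ℂ (SrcAlg P N T I) :=
  LinearMap.rTensor _ (MvPolynomial.pderiv l).toLinearMap

/-- The left derivative with respect to an odd generator. -/
def derivOdd {P : Type*} {N : ℕ} {T I : Type*} (o : OddGen P N T I) :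
    Module.End ℂ (SrcAlg P N T I) :=
  LinearMap.lTensor _ (Gr.deriv o)

/-- `-∂/∂(J_{S_n^α})^i`. -/
def derivS (P : Type*) {N : ℕ} {T I : Type*} (l : Lab N T I) : Module.End ℂ (SrcAlg P N T I) :=
  -derivOdd (.inr (.inl l))

/-- `-∂/∂(J̄_{S_n^α})^i`. -/
def derivSbar (P : Type*) {N : ℕ} {T I : Type*} (l : Lab N T I) :
    Module.End ℂ (SrcAlg P N T I) :=
  -derivOdd (.inr (.inr l))

/-- Evaluation at vanishing sources. -/
def atZero (P : Type*) (N : ℕ) (T I : Type*) : SrcAlg P N T I →ₗ[ℂ] Gr P :=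
  (TensorProduct.lid ℂ (Gr P)).toLinearMap ∘ₗ
    TensorProduct.map (MvPolynomial.aeval fun _ => (0 : ℂ)).toLinearMap
      (Gr.restrict P (Lab N T I ⊕ Lab N T I)).toLinearMap

/-- `(∂ W[λJ])|_{J = 0}` for a differential operator `∂` in the sources. -/
def correlator {N : ℕ} (d : Module.End ℂ (SrcAlg P N T I)) (W : PowerSeries (SrcAlg P N T I)) :
    PowerSeries (Gr P) :=
  PowerSeries.mk fun m => atZero P N T I (d (PowerSeries.coeff m W))

section Formulas

variable [Fintype I] [DecidableEq I] [Fintype A] [DecidableEq A]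

/-- The closed expression for `⟨O_{n_0}^{α_0} ⋯ O_{n_M}^{α_M}⟩_conn`, with `M + 1` operators.
Positions are cyclic: `m + 1` is taken modulo `M + 1`. -/
def corrO {N : ℕ} (D : OperatorData P I A T) (st : Statistics)
    (Δ : Matrix (I × A) (I × A) (Gr P)) {M : ℕ} (l : Fin (M + 1) → Lab N T I) : Gr P :=
  (st.sign / (M + 1) *
      ((1 + st.sign ^ (M + 1) * (-1) ^ ∑ m, (((l m).1 : ℕ) + D.τ (l m).2.1)) / 2)) •
    ∑ k : (m : Fin (M + 1)) → Fin (2 * ((l m).1 : ℕ) + 1), ∑ σ : Equiv.Perm (Fin (M + 1)),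
      ((-1) ^ (k (σ 0) : ℕ) * ∏ m, st.sign ^ (k (σ m) : ℕ)) •
        (List.ofFn fun m =>
          D.kernel Δ (2 * ((l (σ m)).1 : ℕ)) (k (σ m)) (l (σ m)).2.2
            (2 * ((l (σ (m + 1))).1 : ℕ)) (k (σ (m + 1))) (l (σ (m + 1))).2.2 *
          (D.t (l (σ (m + 1))).2.1).map (algebraMap ℂ (Gr P))).prod.trace

/-- The closed expression for
`⟨S_{n_0}^{α_0} S̄_{n'_0}^{α'_0} ⋯ S_{n_M}^{α_M} S̄_{n'_M}^{α'_M}⟩_conn`, with `M + 1` operators of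
each kind. -/
def corrS {N : ℕ} (D : OperatorData P I A T) (st : Statistics)
    (Δ : Matrix (I × A) (I × A) (Gr P)) {M : ℕ} (l l' : Fin (M + 1) → Lab N T I) : Gr P :=
  (st.sign * 2 ^ (2 * (M + 1) - 1) / (M + 1)) •
    ∑ k : (m : Fin (M + 1)) → Fin (2 * ((l m).1 : ℕ) + 2),
    ∑ k' : (m : Fin (M + 1)) → Fin (2 * ((l' m).1 : ℕ) + 2),
    ∑ ρ : Equiv.Perm (Fin (M + 1)), ∑ σ : Equiv.Perm (Fin (M + 1)),
      (((Equiv.Perm.sign σ : ℤ) : ℂ) * ((Equiv.Perm.sign ρ : ℤ) : ℂ) * (-1) ^ (k (σ 0) : ℕ) *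
          ∏ m, st.sign ^ ((k (σ m) : ℕ) + (k' (ρ m) : ℕ))) •
        (List.ofFn fun m =>
          D.kernel Δ (2 * ((l (σ m)).1 : ℕ) + 1) (k (σ m)) (l (σ m)).2.2
            (2 * ((l' (ρ m)).1 : ℕ) + 1) (k' (ρ m)) (l' (ρ m)).2.2 *
          (D.t (l' (ρ m)).2.1).map (algebraMap ℂ (Gr P)) *
          D.kernel Δ (2 * ((l' (ρ m)).1 : ℕ) + 1) (k' (ρ m)) (l' (ρ m)).2.2
            (2 * ((l (σ (m + 1))).1 : ℕ) + 1) (k (σ (m + 1))) (l (σ (m + 1))).2.2 *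
          (D.t (l (σ (m + 1))).2.1).map (algebraMap ℂ (Gr P))).prod.trace

end Formulas

end SuperGauss

end

open SuperGauss

open scoped TensorProduct

noncomputable section

namespace SuperGauss

/-! ### Gaussian functionals on algebras with (anti)commuting generators -/

/-! Both integrals are Gaussian functionals, and the theorem rests on one algebraic fact about
these. Let generators `Φ` (φ and φ̄ together) commute up to ε = ±1, and let `L` be linear over the
commutative ring of even elements of the source algebra and satisfy the Schwinger-Dyson equations
L(Φ_x f) = Σ_y G_xy L(∂_y f), as in `IsGaussian`. For a quadratic s = Σ c_xy Φ_x Φ_y with S = c + ε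
cᵀ these equations give a closed recursion for ⟨s^m⟩ and ⟨Φ_x Φ_y s^m⟩. Its solution says Z' = Z T
with T = (ε/2) Σ_m λ^m tr (G S)^(m+1), hence log Z = -(ε/2) tr log(1 - λ G S); see
`IsGaussian.moments`, `coeff_seriesLog_moments` and `IsGaussian.coeff_seriesLog`.

The free theories are of this kind. The Berezin integral annihilates derivatives, the integral over
complex variables admits integration by parts because its weight decays, and a nilpotent part of the
exponent is handled by the product rule (`isGaussian_weight`). The symmetry of Δ makes G
off-diagonal with both blocks Δ⁻¹. Every polynomial expectation is a multiple of `L 1`, so Z[0] is a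
unit as soon as some expectation is one: undo the weight and integrate the product of all fermions,
or the constant 1 against the numerical Gaussian weight. The latter integral is evaluated by writing
B = P* (1 + i D) P with D real and diagonal.

The source term is such an s. Its coefficients are even, since C_{2n} and J_O are even while
C_{2n+1} and J_S are both odd. The symmetries of C_n and t^α determine S, and admissibility is
exactly the condition under which the S and S̄ terms are doubled by symmetrization instead of
cancelled. The supermatrix K factors as V W, where V contains v_{n,k} and W contains u_{n,k} Δ⁻¹ t
J; in the other order W V = G S. Entries carrying the index (n,k) have parity n - k in both factors,
and the sign in the supertrace compensates for exchanging them, so that str (V W)^m = tr (W V)^m for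
m ≥ 1 (`superTrace_mul_pow`). This turns the trace over field space into the supertrace
(`connectedFunctional_eq`); the compact and the explicit kernel are two spellings of the same
supermatrix.

For the correlators, rescaling the sources selects a single power of λ, switches off the sources
that do not occur, and makes correlators with unequal numbers of S and S̄ vanish. The remaining
supertrace is expanded into a sum over closed paths through columns labelled by sources. With J_O
alone the two diagonal blocks decouple, and their contributions add up to the factor 1 + (±1)^M
(-1)^(…). With the odd sources alone K is off-diagonal, and its square is again block diagonal,
which allows the same expansion with pairs of edges. Derivatives of a product of even sources form a
permanent, those of odd sources a determinant for each kind, which gives the sums over permutations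
with their signs. The source of an edge sits at its endpoint, so positions must be rotated once; for
odd sources this costs the sign of a cycle. -/

/-- Left derivatives `∂` with respect to generators `Φ`, which commute up to the factor `ε`. -/
structure FieldCalculus (E F Y : Type*) [CommRing E] [Ring F] [Algebra E F] [DecidableEq Y] where
  Φ : Y → F
  d : Y → F →ₗ[E] F
  ε : E
  ε_sq : ε * ε = 1
  comm : ∀ x y, Φ x * Φ y = ε • (Φ y * Φ x)
  d_one : ∀ y, d y 1 = 0
  d_mul : ∀ x y f, d y (Φ x * f) = (if x = y then f else 0) + ε • (Φ x * d y f)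

namespace FieldCalculus

variable {E F R Y : Type*} [CommRing E] [Ring F] [Ring R] [Algebra E F] [Algebra E R]
  [DecidableEq Y] [Fintype Y] (𝓕 : FieldCalculus E F Y)

/-- The quadratic form with coefficients `c`. -/
def quad (c : Matrix Y Y E) : F := ∑ x, ∑ y, c x y • (𝓕.Φ x * 𝓕.Φ y)

/-- The (anti)symmetrization of the coefficients of a quadratic form. -/
def symmetrize (c : Matrix Y Y E) : Matrix Y Y E := c + 𝓕.ε • c.transpose

/-- The derivative picks up ε twice on its way through Φ_x Φ_y and so leaves without a sign.
Contracting with the second factor costs one ε, which is why c + ε cᵀ appears. -/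
lemma d_quad_mul (c : Matrix Y Y E) (y : Y) (f : F) :
    𝓕.d y (𝓕.quad c * f) =
      (∑ z, 𝓕.symmetrize c y z • 𝓕.Φ z) * f + 𝓕.quad c * 𝓕.d y f := by
  simp only [quad, Finset.sum_mul, map_sum, smul_mul_assoc, map_smul, mul_assoc, d_mul,
    mul_add, smul_add, mul_smul_comm, Finset.sum_add_distrib, symmetrize, Matrix.add_apply,
    Matrix.smul_apply, Matrix.transpose_apply, add_smul, mul_ite, mul_zero, smul_smul, 𝓕.ε_sq,
    one_smul, smul_ite, smul_zero]
  have h1 : ∀ x, (∑ x_1, if x = y then c x x_1 • (𝓕.Φ x_1 * f) else 0) =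
      if x = y then ∑ x_1, c x x_1 • (𝓕.Φ x_1 * f) else 0 := by
    intro x; split_ifs <;> simp
  simp only [h1, Finset.sum_ite_eq', Finset.mem_univ, if_true]
  simp only [smul_eq_mul, ← add_assoc]
  simp only [mul_comm 𝓕.ε, add_mul, Finset.sum_mul, smul_mul_assoc]

lemma two_smul_quad (c : Matrix Y Y E) :
    (2 : E) • 𝓕.quad c = ∑ x, ∑ y, 𝓕.symmetrize c x y • (𝓕.Φ x * 𝓕.Φ y) := by
  have : ∑ x, ∑ y, (𝓕.ε * c y x) • (𝓕.Φ x * 𝓕.Φ y) = 𝓕.quad c := by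
    rw [quad, Finset.sum_comm]
    refine Finset.sum_congr rfl fun x _ => Finset.sum_congr rfl fun y _ => ?_
    rw [𝓕.comm y x, smul_smul, mul_right_comm, 𝓕.ε_sq, one_mul]
  simp only [symmetrize, Matrix.add_apply, Matrix.smul_apply, Matrix.transpose_apply, smul_eq_mul,
    add_smul, Finset.sum_add_distrib]
  rw [this, two_smul, quad]

lemma commute_quad (c : Matrix Y Y E) (z : Y) : Commute (𝓕.quad c) (𝓕.Φ z) := by
  refine Commute.sum_left _ _ _ fun x _ => Commute.sum_left _ _ _ fun y _ => ?_
  refine Commute.smul_left ?_ _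
  rw [Commute, SemiconjBy, mul_assoc, 𝓕.comm y z, mul_smul_comm, ← mul_assoc, 𝓕.comm x z,
    smul_mul_assoc, smul_smul, 𝓕.ε_sq, one_smul, mul_assoc]

lemma d_quad_pow (c : Matrix Y Y E) (y : Y) (m : ℕ) :
    𝓕.d y (𝓕.quad c ^ m) =
      m • ((∑ z, 𝓕.symmetrize c y z • 𝓕.Φ z) * 𝓕.quad c ^ (m - 1)) := by
  induction m with
  | zero => simp [𝓕.d_one]
  | succ m ih =>
    have hc : Commute (𝓕.quad c) (∑ z, 𝓕.symmetrize c y z • 𝓕.Φ z) :=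
      Commute.sum_right _ _ _ fun z _ => (𝓕.commute_quad c z).smul_right _
    rw [pow_succ', d_quad_mul, ih, mul_smul_comm, ← mul_assoc, hc.eq, mul_assoc]
    cases m with
    | zero => simp
    | succ m =>
      rw [add_tsub_cancel_right, add_tsub_cancel_right, ← pow_succ', succ_nsmul' _ (m + 1)]

/-- The functional `L` satisfies the Schwinger-Dyson equations with propagator `G`. -/
def IsGaussian (L : F →ₗ[E] R) (G : Matrix Y Y E) : Prop :=
  ∀ x f, L (𝓕.Φ x * f) = ∑ y, G x y • L (𝓕.d y f)

/-- The coefficients of `⟨s ^ m⟩` and of `⟨Φ_x Φ_y s ^ m⟩`, divided by `m!`, for a quadratic `s`. -/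
def moments [Algebra ℂ E] (ε : E) (G S : Matrix Y Y E) : ℕ → E × Matrix Y Y E
  | 0 => (1, G)
  | m + 1 =>
    let z := ((m + 1 : ℂ)⁻¹ / 2) • (ε * (S * (moments ε G S m).2).trace)
    (z, z • G + G * S * (moments ε G S m).2)

variable {𝓕} {L : F →ₗ[E] R} {G : Matrix Y Y E}

/-- Every expectation value is a multiple of `L 1`. -/
lemma IsGaussian.exists_smul (h : 𝓕.IsGaussian L G) {f : F}
    (hf : f ∈ Algebra.adjoin E (Set.range 𝓕.Φ)) : ∃ z : E, L f = z • L 1 := by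
  -- The derivative of a word is a combination of strictly shorter words, one for each letter. The
  -- Schwinger-Dyson equation therefore allows induction on the length.
  have hd : ∀ (l : List Y) y, ∃ w : Fin l.length → E, ∃ v : Fin l.length → List Y,
      (∀ i, (v i).length < l.length) ∧
      𝓕.d y (l.map 𝓕.Φ).prod = ∑ i, w i • ((v i).map 𝓕.Φ).prod := by
    intro l y
    induction l with
    | nil => exact ⟨Fin.elim0, Fin.elim0, fun i => i.elim0, by simp [𝓕.d_one]⟩
    | cons x l ih =>
      obtain ⟨w, v, hv, e⟩ := ih
      refine ⟨Fin.cons (if x = y then 1 else 0) fun i => 𝓕.ε * w i,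
        Fin.cons l fun i => x :: v i, fun i => ?_, ?_⟩
      · refine Fin.cases ?_ (fun i => ?_) i
        · simp
        · simpa using hv i
      · simp [𝓕.d_mul, e, Fin.sum_univ_succ, Finset.mul_sum, Finset.smul_sum, mul_smul]
  have key : ∀ n (l : List Y), l.length = n → ∃ z : E, L (l.map 𝓕.Φ).prod = z • L 1 := by
    intro n
    induction n using Nat.strong_induction_on with
    | _ n ih =>
      intro l hl
      cases l with
      | nil => exact ⟨1, by simp⟩
      | cons x l =>
        choose w v hv e using hd l
        have : ∀ y i, ∃ z : E, L ((v y i).map 𝓕.Φ).prod = z • L 1 := fun y i =>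
          ih _ ((hv y i).trans (by simp at hl; omega)) _ rfl
        choose z hz using this
        refine ⟨∑ y, G x y • ∑ i, w y i * z y i, ?_⟩
        simp [h x, e, hz, Finset.sum_smul, mul_smul, Finset.smul_sum]
  rw [← Subalgebra.mem_toSubmodule, Algebra.adjoin_eq_span] at hf
  induction hf using Submodule.span_induction with
  | mem x hx =>
    obtain ⟨l, hl, rfl⟩ := Submonoid.exists_list_of_mem_closure hx
    have : l ∈ Set.range (List.map 𝓕.Φ) := by
      rw [Set.range_list_map]; exact hl
    obtain ⟨l', rfl⟩ := this
    exact key _ l' rfl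
  | zero => exact ⟨0, by simp⟩
  | add x y _ _ hx hy =>
    obtain ⟨z, hz⟩ := hx
    obtain ⟨w, hw⟩ := hy
    exact ⟨z + w, by rw [map_add, hz, hw, add_smul]⟩
  | smul a x _ hx =>
    obtain ⟨z, hz⟩ := hx
    exact ⟨a * z, by rw [map_smul, hz, mul_smul]⟩

/-- The two families have to be computed together: 2 s = Σ S_xy Φ_x Φ_y reduces ⟨s^(m+1)⟩ to ⟨Φ Φ
s^m⟩, and the Schwinger-Dyson equation reduces ⟨Φ Φ s^m⟩ to ⟨s^m⟩ and ⟨Φ Φ s^(m-1)⟩. -/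
lemma IsGaussian.moments [Algebra ℂ E] (h : 𝓕.IsGaussian L G) (c : Matrix Y Y E) (m : ℕ) :
    L (𝓕.quad c ^ m) = (m.factorial • (FieldCalculus.moments 𝓕.ε G (𝓕.symmetrize c) m).1) • L 1 ∧
    ∀ x y, L (𝓕.Φ x * (𝓕.Φ y * 𝓕.quad c ^ m)) =
      (m.factorial • (FieldCalculus.moments 𝓕.ε G (𝓕.symmetrize c) m).2 x y) • L 1 := by
  have hS : ∀ x y, 𝓕.symmetrize c x y = 𝓕.ε * 𝓕.symmetrize c y x := by
    intro x y
    simp only [symmetrize, Matrix.add_apply, Matrix.smul_apply, Matrix.transpose_apply, smul_eq_mul,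
      mul_add, ← mul_assoc, 𝓕.ε_sq, one_mul, add_comm]
  -- Contracting Φ_x with Φ_y gives G, contracting it with one of the m factors s gives G S. The ε
  -- from passing Φ_y is undone by moving the new generator Φ_w back to the front.
  have step : ∀ m x y, L (𝓕.Φ x * (𝓕.Φ y * 𝓕.quad c ^ m)) = G x y • L (𝓕.quad c ^ m) +
      m • ∑ w, (G * 𝓕.symmetrize c) x w • L (𝓕.Φ w * (𝓕.Φ y * 𝓕.quad c ^ (m - 1))) := by
    intro m x y
    have h1 : ∀ z, 𝓕.ε • (𝓕.Φ y * 𝓕.d z (𝓕.quad c ^ m)) =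
        m • ∑ w, 𝓕.symmetrize c z w • (𝓕.Φ w * (𝓕.Φ y * 𝓕.quad c ^ (m - 1))) := by
      intro z
      rw [d_quad_pow, mul_smul_comm, smul_comm, ← mul_assoc, Finset.mul_sum, Finset.sum_mul,
        Finset.smul_sum]
      congr 1
      refine Finset.sum_congr rfl fun w _ => ?_
      rw [mul_smul_comm, 𝓕.comm y w, smul_mul_assoc, smul_mul_assoc, smul_comm, smul_smul 𝓕.ε,
        𝓕.ε_sq, one_smul, mul_assoc]
    rw [h x]
    simp only [𝓕.d_mul, h1, map_add, apply_ite L, map_zero, smul_add, smul_ite, smul_zero,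
      Finset.sum_add_distrib, Finset.sum_ite_eq, Finset.mem_univ, if_true, map_nsmul, map_sum,
      map_smul, Matrix.mul_apply, Finset.sum_smul, Finset.smul_sum]
    congr 1
    rw [Finset.sum_comm]
    refine Finset.sum_congr rfl fun w _ => Finset.sum_congr rfl fun y _ => ?_
    rw [mul_smul, smul_comm (G _ _)]
  induction m with
  | zero =>
    refine ⟨by simp [FieldCalculus.moments], fun x y => ?_⟩
    rw [step]; simp [FieldCalculus.moments]
  | succ m ih =>
    have h1 : L (𝓕.quad c ^ (m + 1)) = ((m + 1).factorial •
        (FieldCalculus.moments 𝓕.ε G (𝓕.symmetrize c) (m + 1)).1) • L 1 := by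
      have h2 : (2 : E) • L (𝓕.quad c ^ (m + 1)) =
          (m.factorial • (𝓕.ε * (𝓕.symmetrize c *
            (FieldCalculus.moments 𝓕.ε G (𝓕.symmetrize c) m).2).trace)) • L 1 := by
        rw [← map_smul, pow_succ', ← smul_mul_assoc, two_smul_quad]
        simp only [Finset.sum_mul, map_sum, smul_mul_assoc, map_smul, mul_assoc, ih.2,
          Matrix.trace, Matrix.diag, Matrix.mul_apply, Finset.mul_sum, Finset.smul_sum,
          Finset.sum_smul, smul_smul]
        rw [Finset.sum_comm]
        refine Finset.sum_congr rfl fun w _ => Finset.sum_congr rfl fun y _ => ?_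
        -- The sum Σ S_xy M_xy becomes the trace of S M only after transposing S; this is the origin
        -- of the ε in `moments`.
        rw [hS y w]
        simp [mul_assoc, mul_left_comm]
      have h3 : (algebraMap ℂ E 2⁻¹) * 2 = 1 := by
        rw [← map_ofNat (algebraMap ℂ E) 2, ← map_mul]; norm_num
      have h4 := congrArg (fun t => (algebraMap ℂ E 2⁻¹) • t) h2
      simp only [smul_smul, h3, one_smul] at h4
      rw [h4]
      congr 1
      simp only [FieldCalculus.moments, Nat.factorial_succ, Algebra.smul_def]
      push_cast
      have h5 : (algebraMap ℂ E (m + 1)⁻¹) * (m + 1) = 1 := by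
        have : ((m : E) + 1) = algebraMap ℂ E (m + 1) := by simp
        rw [this, ← map_mul, inv_mul_cancel₀ (by exact_mod_cast Nat.succ_ne_zero m), map_one]
      rw [div_eq_mul_inv, map_mul]
      linear_combination (-(algebraMap ℂ E 2⁻¹) * (m.factorial : E) * (𝓕.ε * (𝓕.symmetrize c *
            (FieldCalculus.moments 𝓕.ε G (𝓕.symmetrize c) m).2).trace)) * h5
    refine ⟨h1, fun x y => ?_⟩
    have h2 : (FieldCalculus.moments 𝓕.ε G (𝓕.symmetrize c) (m + 1)).2 =
        (FieldCalculus.moments 𝓕.ε G (𝓕.symmetrize c) (m + 1)).1 • G +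
          G * 𝓕.symmetrize c * (FieldCalculus.moments 𝓕.ε G (𝓕.symmetrize c) m).2 := rfl
    rw [step, h1, h2]
    simp only [add_tsub_cancel_right, ih.2, Matrix.add_apply,
      Matrix.smul_apply, Matrix.mul_apply (N := (FieldCalculus.moments _ _ _ _).2),
      smul_smul, ← Finset.sum_smul, ← add_smul, ← smul_assoc]
    congr 1
    simp only [smul_eq_mul, nsmul_eq_mul, Nat.factorial_succ, Finset.mul_sum, mul_add]
    push_cast
    congr 1
    · ring
    · refine Finset.sum_congr rfl fun w _ => ?_
      ring

end FieldCalculus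

/-! ### The logarithm of a formal power series -/

lemma map_seriesLog {R S : Type*} [Ring R] [Ring S] [Algebra ℂ R] [Algebra ℂ S] (f : R →ₐ[ℂ] S)
    (F : PowerSeries R) :
    seriesLog (PowerSeries.map (f : R →+* S) F) = PowerSeries.map (f : R →+* S) (seriesLog F) := by
  ext m
  simp only [seriesLog, PowerSeries.coeff_mk, PowerSeries.coeff_map, map_sum]
  refine Finset.sum_congr rfl fun r _ => ?_
  rw [← map_one (PowerSeries.map (f : R →+* S)), ← map_sub, ← map_pow, PowerSeries.coeff_map]
  exact (map_smul f _ _).symm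

/-- If `F' = F T`, then `(log F)' = T`. -/
lemma coeff_succ_seriesLog {E : Type*} [CommRing E] [Algebra ℂ E] (F T : PowerSeries E)
    (h0 : PowerSeries.constantCoeff F = 1) (hF : PowerSeries.derivative E F = F * T) (m : ℕ) :
    PowerSeries.coeff (m + 1) (seriesLog F) = ((m + 1 : ℂ)⁻¹) • PowerSeries.coeff m T := by
  have h1 : PowerSeries.coeff (m + 1) (seriesLog F) = PowerSeries.coeff (m + 1)
      (∑ r ∈ Finset.range (m + 1), ((-1 : ℂ) ^ r / (r + 1)) • (F - 1) ^ (r + 1)) := by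
    simp only [seriesLog, PowerSeries.coeff_mk, map_sum]
    rw [← Finset.Ico_add_one_right_eq_Icc, Finset.sum_Ico_eq_sum_range]
    simp only [add_tsub_cancel_right, PowerSeries.coeff_smul]
    refine Finset.sum_congr rfl fun r _ => ?_
    rw [add_comm 1 r, pow_add, pow_add]
    simp
  -- The truncated logarithm differentiates to a geometric sum in 1 - F times F T. Its remainder
  -- contains (1 - F)^(m+1) and does not reach the coefficient of order m.
  have h2 : PowerSeries.derivative E
      (∑ r ∈ Finset.range (m + 1), ((-1 : ℂ) ^ r / (r + 1)) • (F - 1) ^ (r + 1)) =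
      T - (1 - F) ^ (m + 1) * T := by
    have h3 : ∀ r : ℕ, PowerSeries.derivative E (((-1 : ℂ) ^ r / (r + 1)) • (F - 1) ^ (r + 1)) =
        (1 - F) ^ r * (F * T) := by
      intro r
      have e1 : ((-1 : ℂ) ^ r / (r + 1)) • (F - 1) ^ (r + 1) =
          (algebraMap ℂ E ((-1 : ℂ) ^ r / (r + 1))) • (F - 1) ^ (r + 1) := by
        rw [algebraMap_smul]
      have e2 : ((-1 : ℂ) ^ r / (r + 1)) * (r + 1) = (-1) ^ r :=
        div_mul_cancel₀ _ (by exact_mod_cast Nat.succ_ne_zero r)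
      rw [e1, Derivation.map_smul, Derivation.leibniz_pow, map_sub, Derivation.map_one_eq_zero, sub_zero, hF,
        add_tsub_cancel_right, ← neg_sub F 1, neg_pow (F - 1), ← Nat.cast_smul_eq_nsmul E, smul_smul]
      have e3 : algebraMap ℂ E ((-1 : ℂ) ^ r / (r + 1)) * ((r + 1 : ℕ) : E) = (-1) ^ r := by
        have : ((r + 1 : ℕ) : E) = algebraMap ℂ E (r + 1) := by simp
        rw [this, ← map_mul, e2]; simp
      rw [e3, smul_eq_mul, Algebra.smul_def, mul_assoc]
      simp
    rw [map_sum]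
    simp only [h3]
    rw [← Finset.sum_mul, ← mul_assoc]
    have := mul_neg_geom_sum (1 - F) (m + 1)
    rw [sub_sub_cancel] at this
    rw [mul_comm _ F, this, sub_mul, one_mul]
  have h4 : PowerSeries.coeff m ((1 - F) ^ (m + 1) * T) = 0 := by
    have : PowerSeries.X ∣ 1 - F := by
      rw [PowerSeries.X_dvd_iff, map_sub, h0, map_one, sub_self]
    exact PowerSeries.X_pow_dvd_iff.1 ((pow_dvd_pow_of_dvd this _).mul_right T) m (Nat.lt_succ_self m)
  have h5 := congrArg (PowerSeries.coeff m) h2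
  rw [PowerSeries.coeff_derivative, map_sub, h4, sub_zero] at h5
  rw [h1, ← h5, Algebra.smul_def, mul_comm, mul_assoc]
  have : ((m : E) + 1) * algebraMap ℂ E (m + 1)⁻¹ = 1 := by
    have : ((m : E) + 1) = algebraMap ℂ E (m + 1) := by simp
    rw [this, ← map_mul, mul_inv_cancel₀ (by exact_mod_cast Nat.succ_ne_zero m), map_one]
  rw [this, mul_one]

/-! ### Logarithms of Gaussian generating series. -/

namespace FieldCalculus
variable {E F R Y : Type*} [CommRing E] [Ring F] [Ring R] [Algebra E F] [Algebra E R]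
  [Algebra ℂ E] [Algebra ℂ R] [IsScalarTower ℂ E R] [Algebra ℂ F]
  [DecidableEq Y] [Fintype Y] {𝓕 : FieldCalculus E F Y} {L : F →ₗ[E] R} {G : Matrix Y Y E}

/-- Solving the recursion for the matrices and taking the trace exhibits the logarithmic derivative
of the series as (ε/2) Σ λ^m tr (G S)^(m+1). -/
lemma coeff_seriesLog_moments (ε : E) (G S : Matrix Y Y E) (m : ℕ) :
    PowerSeries.coeff (m + 1) (seriesLog (PowerSeries.mk fun m => (moments ε G S m).1)) =
      ((2 * (m + 1) : ℂ)⁻¹) • (ε * ((G * S) ^ (m + 1)).trace) := by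
  rw [coeff_succ_seriesLog _ (PowerSeries.mk fun m => (2⁻¹ : ℂ) • (ε * ((G * S) ^ (m + 1)).trace))]
  · rw [PowerSeries.coeff_mk, smul_smul, mul_inv, mul_comm]
  · simp [moments]
  -- Unrolled, the recursion says that the series of matrices is the scalar series times the
  -- geometric series Σ (G S)^p G.
  · have h1 : ∀ m, (moments ε G S m).2 = ∑ p ∈ Finset.HasAntidiagonal.antidiagonal m,
        (moments ε G S p.1).1 • ((G * S) ^ p.2 * G) := by
      intro m
      induction m with
      | zero => simp [moments]
      | succ m ih =>
        rw [Finset.Nat.antidiagonal_succ']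
        have : (moments ε G S (m + 1)).2 =
          (moments ε G S (m + 1)).1 • G + G * S * (moments ε G S m).2 := rfl
        rw [this, ih]
        simp [Finset.mul_sum, pow_succ', mul_assoc]
    ext m
    rw [PowerSeries.coeff_derivative, PowerSeries.coeff_mk, PowerSeries.coeff_mul]
    simp only [PowerSeries.coeff_mk]
    have h2 : (moments ε G S (m + 1)).1 =
      ((m + 1 : ℂ)⁻¹ / 2) • (ε * (S * (moments ε G S m).2).trace) := rfl
    have h3 : ∀ p : ℕ × ℕ, (S * ((G * S) ^ p.2 * G)).trace = ((G * S) ^ (p.2 + 1)).trace := by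
      intro p
      rw [Matrix.trace_mul_comm, pow_succ, mul_assoc]
    rw [h2, h1]
    simp only [Matrix.mul_sum, Matrix.mul_smul, Matrix.trace_sum, Matrix.trace_smul, h3, smul_eq_mul]
    simp only [Algebra.smul_def, Finset.mul_sum, Finset.sum_mul]
    refine Finset.sum_congr rfl fun p _ => ?_
    have h4 : ((m : E) + 1) * algebraMap ℂ E ((m + 1 : ℂ)⁻¹ / 2) = algebraMap ℂ E 2⁻¹ := by
      have e1 : ((m : E) + 1) = algebraMap ℂ E (m + 1) := by simp
      have e2 : (m + 1 : ℂ) ≠ 0 := by exact_mod_cast Nat.succ_ne_zero m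
      rw [e1, ← map_mul]
      congr 1
      field_simp
    rw [← h4]
    ring

/-- The connected functional of a Gaussian theory with quadratic interaction. -/
theorem IsGaussian.coeff_seriesLog (h : 𝓕.IsGaussian L G) (L' : F →ₗ[ℂ] R) (hL : ∀ f, L' f = L f)
    (hu : IsUnit (L 1)) (c : Matrix Y Y E) (m : ℕ) :
    PowerSeries.coeff m (seriesLog (normalizedExp L' (𝓕.quad c))) =
      ((2 * m : ℂ)⁻¹) • algebraMap E R (𝓕.ε * ((G * 𝓕.symmetrize c) ^ m).trace) := by
  -- Normalization cancels `L 1`, so the series is the image of one over the commutative ring `E`,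
  -- where the derivative argument applies.
  have h1 : normalizedExp L' (𝓕.quad c) =
      PowerSeries.map (((Algebra.ofId E R).restrictScalars ℂ : E →ₐ[ℂ] R) : E →+* R)
        (PowerSeries.mk fun m => (FieldCalculus.moments 𝓕.ε G (𝓕.symmetrize c) m).1) := by
    ext m
    simp only [normalizedExp, PowerSeries.coeff_mk, PowerSeries.coeff_map, hL, (h.moments c m).1]
    rw [Algebra.smul_def (_ : E), Algebra.commutes, ← mul_assoc, Ring.inverse_mul_cancel _ hu, one_mul,
      map_nsmul, ← Nat.cast_smul_eq_nsmul ℂ, smul_smul, inv_mul_cancel₀, one_smul]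
    · rfl
    · exact_mod_cast Nat.factorial_ne_zero m
  rw [h1, map_seriesLog, PowerSeries.coeff_map]
  cases m with
  | zero => simp [seriesLog]
  | succ m =>
    rw [coeff_seriesLog_moments, Nat.cast_succ]
    exact map_smul ((Algebra.ofId E R).restrictScalars ℂ : E →ₐ[ℂ] R) _ _

end FieldCalculus

/-! ### Parity in Grassmann algebras -/

namespace Gr
variable {σ τ : Type*}

lemma ι_mul_ι (a b : σ →₀ ℂ) : ExteriorAlgebra.ι ℂ a * ExteriorAlgebra.ι ℂ b =
    -(ExteriorAlgebra.ι ℂ b * ExteriorAlgebra.ι ℂ a) :=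
  eq_neg_of_add_eq_zero_left (ExteriorAlgebra.ι_add_mul_swap a b)

lemma mul_mem {i j : ZMod 2} {x y : Gr σ} (hx : x ∈ part σ i) (hy : y ∈ part σ j) :
    x * y ∈ part σ (i + j) :=
  CliffordAlgebra.evenOdd_mul_le _ i j (Submodule.mul_mem_mul hx hy)

lemma algebraMap_mem (r : ℂ) : algebraMap ℂ (Gr σ) r ∈ part σ 0 := by
  rw [Algebra.algebraMap_eq_smul_one]
  exact Submodule.smul_mem _ _ (CliffordAlgebra.one_le_evenOdd_zero _ (Submodule.one_le.1 le_rfl))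

lemma ι_mem (a : σ →₀ ℂ) : ExteriorAlgebra.ι ℂ a ∈ part σ 1 :=
  CliffordAlgebra.ι_mem_evenOdd_one _ _

lemma ι_mul_ι_mul_mem (a b : σ →₀ ℂ) {i : ZMod 2} {x : Gr σ} (hx : x ∈ part σ i) :
    ExteriorAlgebra.ι ℂ a * ExteriorAlgebra.ι ℂ b * x ∈ part σ i := by
  simpa using mul_mem (CliffordAlgebra.ι_mul_ι_mem_evenOdd_zero _ a b) hx

@[elab_as_elim]
lemma part_induction_zero {p : ∀ x : Gr σ, x ∈ part σ 0 → Prop}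
    (h0 : ∀ r : ℂ, p (algebraMap ℂ _ r) (algebraMap_mem r))
    (ha : ∀ x y hx hy, p x hx → p y hy → p (x + y) (add_mem hx hy))
    (hι : ∀ a b x hx, p x hx → p (ExteriorAlgebra.ι ℂ a * ExteriorAlgebra.ι ℂ b * x)
      (ι_mul_ι_mul_mem a b hx))
    (x : Gr σ) (hx : x ∈ part σ 0) : p x hx :=
  CliffordAlgebra.even_induction (Q := (0 : QuadraticForm ℂ (σ →₀ ℂ))) (motive := p)
    h0 ha hι x hx

@[elab_as_elim]
lemma part_induction_one {p : ∀ x : Gr σ, x ∈ part σ 1 → Prop}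
    (h0 : ∀ a, p (ExteriorAlgebra.ι ℂ a) (ι_mem a))
    (ha : ∀ x y hx hy, p x hx → p y hy → p (x + y) (add_mem hx hy))
    (hι : ∀ a b x hx, p x hx → p (ExteriorAlgebra.ι ℂ a * ExteriorAlgebra.ι ℂ b * x)
      (ι_mul_ι_mul_mem a b hx))
    (x : Gr σ) (hx : x ∈ part σ 1) : p x hx :=
  CliffordAlgebra.odd_induction (Q := (0 : QuadraticForm ℂ (σ →₀ ℂ))) (P := p) h0 ha hι x hx

lemma commute_ι_mul_ι (a b : σ →₀ ℂ) (y : Gr σ) :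
    Commute (ExteriorAlgebra.ι ℂ a * ExteriorAlgebra.ι ℂ b) y := by
  induction y using ExteriorAlgebra.induction with
  | algebraMap r => exact (Algebra.commutes r _).symm
  | ι c =>
    rw [Commute, SemiconjBy, mul_assoc, ι_mul_ι b c, mul_neg, ← mul_assoc, ι_mul_ι a c, neg_mul,
      neg_neg, mul_assoc]
  | mul x y hx hy => exact hx.mul_right hy
  | add x y hx hy => exact hx.add_right hy

lemma commute_even {x : Gr σ} (hx : x ∈ part σ 0) (y : Gr σ) : Commute x y := by
  induction x, hx using part_induction_zero with
  | h0 r => exact Algebra.commutes r _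
  | ha x z _ _ h1 h2 => exact h1.add_left h2
  | hι a b x _ h => exact (commute_ι_mul_ι a b y).mul_left h

lemma ι_mul_odd (a : σ →₀ ℂ) {x : Gr σ} (hx : x ∈ part σ 1) :
    ExteriorAlgebra.ι ℂ a * x = -(x * ExteriorAlgebra.ι ℂ a) := by
  induction x, hx using part_induction_one with
  | h0 b => exact ι_mul_ι a b
  | ha x z _ _ h1 h2 => rw [mul_add, add_mul, h1, h2, neg_add]
  | hι b c x _ h => rw [← mul_assoc, ← (commute_ι_mul_ι b c _).eq, mul_assoc, h, mul_neg, ← mul_assoc]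

lemma odd_mul_odd {x y : Gr σ} (hx : x ∈ part σ 1) (hy : y ∈ part σ 1) : x * y = -(y * x) := by
  induction x, hx using part_induction_one with
  | h0 b => exact ι_mul_odd b hy
  | ha x z _ _ h1 h2 => rw [mul_add, add_mul, h1, h2, neg_add]
  | hι b c x _ h => rw [mul_assoc, h, mul_neg, ← mul_assoc, (commute_ι_mul_ι b c _).eq, mul_assoc]

lemma gen_mem (o : σ) : gen o ∈ part σ 1 := CliffordAlgebra.ι_mem_evenOdd_one _ _

lemma map_mem (f : (σ →₀ ℂ) →ₗ[ℂ] (τ →₀ ℂ)) {i : ZMod 2} {x : Gr σ} (hx : x ∈ part σ i) :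
    ExteriorAlgebra.map f x ∈ part τ i := by
  have h : ∀ a b y j, y ∈ part τ j → ExteriorAlgebra.map f (ExteriorAlgebra.ι ℂ a) *
      ExteriorAlgebra.map f (ExteriorAlgebra.ι ℂ b) * y ∈ part τ j := by
    intro a b y j hy
    rw [ExteriorAlgebra.map_apply_ι, ExteriorAlgebra.map_apply_ι]
    exact ι_mul_ι_mul_mem _ _ hy
  have hi : ∀ i : ZMod 2, i = 0 ∨ i = 1 := by decide
  obtain rfl | rfl := hi i
  · induction x, hx using part_induction_zero with
    | h0 r => rw [AlgHom.commutes]; exact algebraMap_mem r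
    | ha x y _ _ h1 h2 => rw [map_add]; exact add_mem h1 h2
    | hι a b x _ hx => rw [map_mul, map_mul]; exact h a b _ _ hx
  · induction x, hx using part_induction_one with
    | h0 a => rw [ExteriorAlgebra.map_apply_ι]; exact ι_mem _
    | ha x y _ _ h1 h2 => rw [map_add]; exact add_mem h1 h2
    | hι a b x _ hx => rw [map_mul, map_mul]; exact h a b _ _ hx

lemma inl_mem {i : ZMod 2} {x : Gr σ} (hx : x ∈ part σ i) : inl σ τ x ∈ part (σ ⊕ τ) i :=
  map_mem _ hx

@[simp] lemma inl_gen (o : σ) : inl σ τ (gen o) = gen (.inl o) := by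
  simp [inl, gen, ExteriorAlgebra.map_apply_ι]

lemma restrict_inl (x : Gr σ) : restrict σ τ (inl σ τ x) = x := by
  have : (restrict σ τ).comp (inl σ τ) = AlgHom.id ℂ _ := by
    apply ExteriorAlgebra.hom_ext
    refine LinearMap.ext fun a => ?_
    simp only [LinearMap.comp_apply, AlgHom.toLinearMap_apply, AlgHom.comp_apply, inl, restrict,
      ExteriorAlgebra.map_apply_ι, AlgHom.id_apply]
    congr 1
    ext o
    exact Finsupp.mapDomain_apply Sum.inl_injective _ _
  exact DFunLike.congr_fun this x

lemma restrict_gen_inr (o : τ) : restrict σ τ (gen (.inr o)) = 0 := by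
  rw [restrict, gen, ExteriorAlgebra.map_apply_ι]
  have : Finsupp.lcomapDomain (M := ℂ) (R := ℂ) Sum.inl (Sum.inl_injective (α := σ) (β := τ))
      (Finsupp.single (Sum.inr o) 1) = 0 := by
    ext a
    exact Finsupp.single_eq_of_ne (by simp)
  rw [this, map_zero]

/-! #### Derivatives -/

lemma deriv_ι_mul (o : σ) (a : σ →₀ ℂ) (x : Gr σ) :
    deriv o (ExteriorAlgebra.ι ℂ a * x) = a o • x - ExteriorAlgebra.ι ℂ a * deriv o x :=
  CliffordAlgebra.contractLeft_ι_mul _ _ _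

lemma deriv_gen_mul [DecidableEq σ] (o o' : σ) (x : Gr σ) :
    deriv o (gen o' * x) = (if o' = o then x else 0) - gen o' * deriv o x := by
  rw [gen, deriv_ι_mul, Finsupp.single_apply, ite_smul, one_smul, zero_smul]

@[simp] lemma deriv_one (o : σ) : deriv o (1 : Gr σ) = 0 := CliffordAlgebra.contractLeft_one _ _

lemma deriv_comm (o o' : σ) (x : Gr σ) : deriv o (deriv o' x) = -deriv o' (deriv o x) :=
  CliffordAlgebra.contractLeft_comm _ _ _

lemma deriv_deriv (o : σ) (x : Gr σ) : deriv o (deriv o x) = 0 :=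
  CliffordAlgebra.contractLeft_contractLeft _ _

/-- Left derivatives with respect to a generator that does not occur in `y`. -/
lemma deriv_inl_mul (o : τ) {y : Gr σ} (hy : y ∈ part σ 0) (x : Gr (σ ⊕ τ)) :
    deriv (.inr o) (inl σ τ y * x) = inl σ τ y * deriv (.inr o) x := by
  have h : ∀ a : σ →₀ ℂ, Finsupp.mapDomain (Sum.inl : σ → σ ⊕ τ) a (Sum.inr o) = 0 := by
    intro a
    exact Finsupp.mapDomain_of_notMem_range _ _ (by simp)
  induction y, hy using part_induction_zero generalizing x with
  | h0 r => rw [AlgHom.commutes, ← Algebra.smul_def, ← Algebra.smul_def, map_smul]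
  | ha y z _ _ h1 h2 => rw [map_add, add_mul, add_mul, map_add, h1, h2]
  | hι a b y _ ih =>
    simp only [map_mul, inl, ExteriorAlgebra.map_apply_ι, mul_assoc] at ih ⊢
    rw [deriv_ι_mul, deriv_ι_mul, ih]
    simp [h]

end Gr

/-! ### Parity in superpolynomial algebras -/

namespace SPoly
variable {E O : Type*}

/-- The even and odd parts of a superpolynomial algebra. -/
def part (E O : Type*) (i : ZMod 2) : Submodule ℂ (SPoly E O) :=
  LinearMap.range (LinearMap.lTensor (MvPolynomial E ℂ) (Gr.part O i).subtype)

lemma tmul_mem (f : MvPolynomial E ℂ) {i : ZMod 2} {g : Gr O} (hg : g ∈ Gr.part O i) :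
    f ⊗ₜ[ℂ] g ∈ part E O i := ⟨f ⊗ₜ ⟨g, hg⟩, by simp⟩

lemma part_induction {i : ZMod 2} {p : SPoly E O → Prop} (h0 : p 0)
    (ht : ∀ f g, g ∈ Gr.part O i → p (f ⊗ₜ g)) (ha : ∀ x y, p x → p y → p (x + y))
    {x : SPoly E O} (hx : x ∈ part E O i) : p x := by
  obtain ⟨y, rfl⟩ := hx
  induction y using TensorProduct.induction_on with
  | zero => simpa using h0
  | tmul f g => exact ht f g g.2
  | add x y hx hy => rw [map_add]; exact ha _ _ hx hy

lemma mul_mem {i j : ZMod 2} {x y : SPoly E O} (hx : x ∈ part E O i) (hy : y ∈ part E O j) :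
    x * y ∈ part E O (i + j) := by
  refine part_induction (p := fun x => x * y ∈ part E O (i + j)) ?_ ?_ ?_ hx
  · rw [zero_mul]; exact zero_mem _
  · intro f g hg
    refine part_induction (p := fun y => f ⊗ₜ[ℂ] g * y ∈ part E O (i + j)) ?_ ?_ ?_ hy
    · rw [mul_zero]; exact zero_mem _
    · intro f' g' hg'
      rw [Algebra.TensorProduct.tmul_mul_tmul]
      exact tmul_mem _ (Gr.mul_mem hg hg')
    · intro x y h1 h2; rw [mul_add]; exact add_mem h1 h2
  · intro x y h1 h2; rw [add_mul]; exact add_mem h1 h2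

lemma ofGr_mem {i : ZMod 2} {g : Gr O} (hg : g ∈ Gr.part O i) :
    (ofGr g : SPoly E O) ∈ part E O i := tmul_mem 1 hg

lemma evenVar_mem (e : E) : (evenVar e : SPoly E O) ∈ part E O 0 :=
  tmul_mem _ (by simpa using Gr.algebraMap_mem (σ := O) 1)

lemma oddVar_mem (o : O) : (oddVar o : SPoly E O) ∈ part E O 1 := ofGr_mem (Gr.gen_mem o)

lemma algebraMap_mem (r : ℂ) : algebraMap ℂ (SPoly E O) r ∈ part E O 0 := by
  rw [← AlgHom.commutes ofGr]; exact ofGr_mem (Gr.algebraMap_mem r)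

lemma commute_even {x : SPoly E O} (hx : x ∈ part E O 0) (y : SPoly E O) : Commute x y := by
  refine part_induction (p := fun x => Commute x y) (Commute.zero_left y) ?_
    (fun x y h1 h2 => h1.add_left h2) hx
  intro f g hg
  induction y using TensorProduct.induction_on with
  | zero => exact Commute.zero_right _
  | tmul f' g' =>
    rw [Commute, SemiconjBy, Algebra.TensorProduct.tmul_mul_tmul,
      Algebra.TensorProduct.tmul_mul_tmul, mul_comm, (Gr.commute_even hg g').eq]
  | add x y h1 h2 => exact h1.add_right h2

lemma odd_mul_odd {x y : SPoly E O} (hx : x ∈ part E O 1) (hy : y ∈ part E O 1) :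
    x * y = -(y * x) := by
  refine part_induction (p := fun x => x * y = -(y * x)) (by simp) ?_
    (fun x y h1 h2 => by rw [add_mul, mul_add, h1, h2, neg_add]) hx
  intro f g hg
  refine part_induction (p := fun y => f ⊗ₜ[ℂ] g * y = -(y * f ⊗ₜ[ℂ] g)) (by simp) ?_
    (fun x y h1 h2 => by rw [add_mul, mul_add, h1, h2, neg_add]) hy
  intro f' g' hg'
  rw [Algebra.TensorProduct.tmul_mul_tmul, Algebra.TensorProduct.tmul_mul_tmul, mul_comm,
    Gr.odd_mul_odd hg hg', TensorProduct.tmul_neg]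

lemma neg_one_pow_congr {R : Type*} [Ring R] {m n : ℕ} (h : (m : ZMod 2) = n) :
    (-1 : R) ^ m = (-1) ^ n := by
  rw [ZMod.natCast_eq_natCast_iff] at h
  rw [← Nat.div_add_mod m 2, ← Nat.div_add_mod n 2, h, pow_add, pow_add, pow_mul, pow_mul]
  simp

/-- Elements of the parities `m`, `n` commute up to the sign `(-1)^{m n}`. -/
lemma mul_comm_of_mem {m n : ℕ} {x y : SPoly E O} (hx : x ∈ part E O m) (hy : y ∈ part E O n) :
    x * y = (-1) ^ (m * n) * (y * x) := by
  have h : ∀ i : ZMod 2, i = 0 ∨ i = 1 := by decide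
  rcases h m with h1 | h1
  · rw [neg_one_pow_congr (n := 0) (by simp [h1]), pow_zero, one_mul]
    rw [h1] at hx; exact (commute_even hx y).eq
  rcases h n with h2 | h2
  · rw [neg_one_pow_congr (n := 0) (by simp [h2]), pow_zero, one_mul]
    rw [h2] at hy; exact (commute_even hy x).eq.symm
  · rw [neg_one_pow_congr (n := 1) (by simp [h1, h2]), pow_one]
    rw [h1] at hx; rw [h2] at hy; rw [odd_mul_odd hx hy]; exact (neg_one_mul (y * x)).symm

/-- The subalgebra of even elements. -/
def evenSubalgebra (E O : Type*) : Subalgebra ℂ (SPoly E O) where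
  carrier := part E O 0
  mul_mem' hx hy := by simpa using mul_mem hx hy
  add_mem' hx hy := add_mem hx hy
  algebraMap_mem' r := algebraMap_mem r

/-- The even elements of a superpolynomial algebra, a commutative ring. -/
def Even (E O : Type*) : Type _ := evenSubalgebra E O

instance : Ring (Even E O) := inferInstanceAs (Ring (evenSubalgebra E O))

instance : CommRing (Even E O) where
  mul_comm x y := Subtype.ext (commute_even x.2 y.1).eq

instance : Algebra ℂ (Even E O) := inferInstanceAs (Algebra ℂ (evenSubalgebra E O))

/-- The inclusion of the even elements. -/
def Even.val : Even E O →ₐ[ℂ] SPoly E O := (evenSubalgebra E O).val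

lemma Even.val_mem (x : Even E O) : x.val ∈ part E O 0 := x.2

lemma Even.val_injective : Function.Injective (Even.val (E := E) (O := O)) :=
  Subtype.val_injective

/-- An element of the even part. -/
def Even.mk (x : SPoly E O) (hx : x ∈ part E O 0) : Even E O := ⟨x, hx⟩

/-- Even elements are central and can serve as scalars. The integrals become linear over a
commutative ring, over which the Gaussian computation can be carried out. -/
instance : Algebra (Even E O) (SPoly E O) :=
  RingHom.toAlgebra' (Even.val (E := E) (O := O)).toRingHom fun x y =>
    (commute_even (Even.val_mem x) y).eq

lemma Even.smul_def (x : Even E O) (y : SPoly E O) : x • y = x.val * y := rfl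

instance : IsScalarTower ℂ (Even E O) (SPoly E O) := IsScalarTower.of_algebraMap_eq fun r =>
  ((Even.val (E := E) (O := O)).commutes r).symm

end SPoly

/-! ### Exponentials of nilpotent quadratic forms as weights -/

lemma nilExp_eq_sum {F : Type*} [Ring F] [Algebra ℂ F] {p : F} {n : ℕ} (hn : p ^ n = 0) :
    nilExp p = ∑ m ∈ Finset.range n, ((m.factorial : ℂ)⁻¹) • p ^ m := by
  have h : nilpotencyClass p ≤ n := Nat.sInf_le hn
  have h0 : p ^ nilpotencyClass p = 0 := pow_nilpotencyClass ⟨n, hn⟩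
  rw [nilExp, ← Finset.sum_range_add_sum_Ico _ h, left_eq_add]
  refine Finset.sum_eq_zero fun m hm => ?_
  rw [pow_eq_zero_of_le (Finset.mem_Ico.1 hm).1 h0, smul_zero]

lemma nilExp_mul_nilExp_neg {F : Type*} [Ring F] [Algebra ℂ F] {p : F} (hp : IsNilpotent p) :
    nilExp p * nilExp (-p) = 1 := by
  let _ : Module ℚ F := Module.compHom F (algebraMap ℚ ℂ)
  have h : ∀ x : F, nilExp x = IsNilpotent.exp x := by
    intro x
    refine Finset.sum_congr rfl fun m _ => ?_
    change _ = (algebraMap ℚ ℂ (m.factorial : ℚ)⁻¹) • x ^ m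
    simp
  rw [h, h]
  exact IsNilpotent.exp_mul_exp_neg_self hp

namespace FieldCalculus
variable {E F R Y : Type*} [CommRing E] [Ring F] [Ring R] [Algebra E F] [Algebra E R]
  [Algebra ℂ E] [Algebra ℂ F] [IsScalarTower ℂ E F]
  [DecidableEq Y] [Fintype Y] {𝓕 : FieldCalculus E F Y} {L : F →ₗ[E] R} {G : Matrix Y Y E}

lemma d_complex_smul (y : Y) (r : ℂ) (f : F) : 𝓕.d y (r • f) = r • 𝓕.d y f := by
  rw [← algebraMap_smul E r f, map_smul, algebraMap_smul]

lemma d_quad_pow_mul (c : Matrix Y Y E) (y : Y) (m : ℕ) (f : F) :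
    𝓕.d y (𝓕.quad c ^ m * f) =
      m • ((∑ z, 𝓕.symmetrize c y z • 𝓕.Φ z) * (𝓕.quad c ^ (m - 1) * f)) +
        𝓕.quad c ^ m * 𝓕.d y f := by
  induction m with
  | zero => simp
  | succ m ih =>
    have hc : Commute (𝓕.quad c) (∑ z, 𝓕.symmetrize c y z • 𝓕.Φ z) :=
      Commute.sum_right _ _ _ fun z _ => (𝓕.commute_quad c z).smul_right _
    generalize hl : (∑ z, 𝓕.symmetrize c y z • 𝓕.Φ z) = l at *
    rw [pow_succ', mul_assoc, d_quad_mul, ih, hl, mul_add, ← add_assoc, mul_smul_comm,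
      ← mul_assoc _ l, hc.eq, mul_assoc l, ← mul_assoc _ (_ ^ (m - 1)), mul_assoc _ (_ ^ m)]
    congr 1
    cases m with
    | zero => simp
    | succ m =>
      rw [add_tsub_cancel_right, add_tsub_cancel_right, ← pow_succ', succ_nsmul' _ (m + 1)]

/-- The form commutes with the linear factor produced by each differentiation, so the exponential
obeys the usual product rule with no correction from the noncommutativity. -/
lemma d_nilExp_quad_mul (c : Matrix Y Y E) (hc : IsNilpotent (𝓕.quad c)) (y : Y) (f : F) :
    𝓕.d y (nilExp (𝓕.quad c) * f) =
      (∑ z, 𝓕.symmetrize c y z • 𝓕.Φ z) * (nilExp (𝓕.quad c) * f) +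
        nilExp (𝓕.quad c) * 𝓕.d y f := by
  obtain ⟨n, hn⟩ := hc
  -- One vanishing term is added, so that after the derivative has lowered the exponents the sum
  -- still runs over all of `Finset.range n`.
  have h1 : nilExp (𝓕.quad c) = ∑ m ∈ Finset.range (n + 1),
      ((m.factorial : ℂ)⁻¹) • 𝓕.quad c ^ m := nilExp_eq_sum (by rw [pow_succ, hn, zero_mul])
  have h2 := nilExp_eq_sum hn
  calc 𝓕.d y (nilExp (𝓕.quad c) * f)
      = ∑ m ∈ Finset.range (n + 1), ((m.factorial : ℂ)⁻¹) • (m •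
        ((∑ z, 𝓕.symmetrize c y z • 𝓕.Φ z) * (𝓕.quad c ^ (m - 1) * f)) +
          𝓕.quad c ^ m * 𝓕.d y f) := by
        rw [h1, Finset.sum_mul, map_sum]
        refine Finset.sum_congr rfl fun m _ => ?_
        rw [smul_mul_assoc, d_complex_smul, d_quad_pow_mul]
    _ = _ := by
        simp only [smul_add, Finset.sum_add_distrib]
        congr 1
        · rw [Finset.sum_range_succ', h2]
          simp only [zero_smul, smul_zero, add_zero, add_tsub_cancel_right, Finset.sum_mul,
            Finset.mul_sum, smul_mul_assoc, mul_smul_comm]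
          refine Finset.sum_congr rfl fun m _ => ?_
          rw [← Nat.cast_smul_eq_nsmul ℂ, smul_smul, Nat.factorial_succ]
          congr 1
          have e1 : (m.factorial : ℂ) ≠ 0 := by exact_mod_cast Nat.factorial_ne_zero m
          have e2 : ((m : ℂ) + 1) ≠ 0 := by exact_mod_cast Nat.succ_ne_zero m
          push_cast
          field_simp
        · rw [h1, Finset.sum_mul]
          simp only [smul_mul_assoc]

/-- Schwinger-Dyson equations for a functional with the quadratic weight `exp(- q)`, from those
of the functional without the weight. -/
lemma isGaussian_weight (L₀ : F →ₗ[E] R) (D₀ c : Matrix Y Y E) (hc : IsNilpotent (𝓕.quad (-c)))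
    (hcomm : ∀ f, Commute (nilExp (𝓕.quad (-c))) f)
    (h₀ : ∀ y f, L₀ (𝓕.d y f) = ∑ z, D₀ y z • L₀ (𝓕.Φ z * f))
    (hG : G * (D₀ + 𝓕.symmetrize c) = 1)
    (hL : ∀ f, L f = L₀ (f * nilExp (𝓕.quad (-c)))) : 𝓕.IsGaussian L G := by
  have hs : 𝓕.symmetrize (-c) = -𝓕.symmetrize c := by
    simp [symmetrize, Matrix.transpose_neg, add_comm]
  -- Differentiate exp(-q) f and integrate with `L₀`: the weight contributes -S Φ, which adds S to
  -- the matrix `D₀` of the unweighted equations. Inverting the sum yields the propagator.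
  have h1 : ∀ y f, L (𝓕.d y f) = ∑ z, (D₀ + 𝓕.symmetrize c) y z • L (𝓕.Φ z * f) := by
    intro y f
    have h2 := congrArg L₀ (𝓕.d_nilExp_quad_mul (-c) hc y f)
    rw [h₀, map_add, hs] at h2
    rw [hL, ← (hcomm _).eq, ← sub_eq_iff_eq_add'.2 h2]
    simp only [hL, Matrix.add_apply, add_smul, Finset.sum_add_distrib, Matrix.neg_apply,
      neg_smul, Finset.sum_neg_distrib, neg_mul, map_neg, sub_neg_eq_add, Finset.sum_mul, map_sum,
      smul_mul_assoc, map_smul, (hcomm _).eq, mul_assoc]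
  intro x f
  simp only [h1, Finset.smul_sum, smul_smul]
  rw [Finset.sum_comm]
  simp only [← Finset.sum_smul, ← Matrix.mul_apply, hG, Matrix.one_apply, ite_smul, one_smul,
    zero_smul, Finset.sum_ite_eq, Finset.mem_univ, if_true]

end FieldCalculus

/-! ### Derivatives and integrals with respect to additional generators -/

namespace SPoly
variable {E O Y : Type*}

/-- The inclusion that adds odd generators `Y`. -/
def inclOdd (E O Y : Type*) : SPoly E O →ₐ[ℂ] SPoly E (O ⊕ Y) :=
  Algebra.TensorProduct.map (AlgHom.id ℂ _) (Gr.inl O Y)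

/-- The inclusion that adds even generators `Y`. -/
def inclEven (E O Y : Type*) : SPoly E O →ₐ[ℂ] SPoly (E ⊕ Y) O :=
  Algebra.TensorProduct.map (MvPolynomial.rename Sum.inl) (AlgHom.id ℂ _)

lemma inclOdd_tmul (f : MvPolynomial E ℂ) (g : Gr O) :
    inclOdd E O Y (f ⊗ₜ g) = f ⊗ₜ Gr.inl O Y g := rfl

lemma inclEven_tmul (f : MvPolynomial E ℂ) (g : Gr O) :
    inclEven E O Y (f ⊗ₜ g) = MvPolynomial.rename Sum.inl f ⊗ₜ g := rfl

lemma inclOdd_mem {i : ZMod 2} {x : SPoly E O} (hx : x ∈ part E O i) :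
    inclOdd E O Y x ∈ part E (O ⊕ Y) i := by
  refine part_induction (p := fun x => inclOdd E O Y x ∈ part E (O ⊕ Y) i) ?_ ?_ ?_ hx
  · rw [map_zero]; exact zero_mem _
  · intro f g hg; exact tmul_mem _ (Gr.inl_mem hg)
  · intro x y h1 h2; rw [map_add]; exact add_mem h1 h2

lemma inclEven_mem {i : ZMod 2} {x : SPoly E O} (hx : x ∈ part E O i) :
    inclEven E O Y x ∈ part (E ⊕ Y) O i := by
  refine part_induction (p := fun x => inclEven E O Y x ∈ part (E ⊕ Y) O i) ?_ ?_ ?_ hx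
  · rw [map_zero]; exact zero_mem _
  · intro f g hg; exact tmul_mem _ hg
  · intro x y h1 h2; rw [map_add]; exact add_mem h1 h2

instance : Algebra (Even E O) (SPoly E (O ⊕ Y)) :=
  RingHom.toAlgebra' ((inclOdd E O Y).comp (Even.val (E := E) (O := O))).toRingHom fun x y =>
    (commute_even (inclOdd_mem (Even.val_mem x)) y).eq

instance : Algebra (Even E O) (SPoly (E ⊕ Y) O) :=
  RingHom.toAlgebra' ((inclEven E O Y).comp (Even.val (E := E) (O := O))).toRingHom fun x y =>
    (commute_even (inclEven_mem (Even.val_mem x)) y).eq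

lemma Even.smul_odd (x : Even E O) (y : SPoly E (O ⊕ Y)) : x • y = inclOdd E O Y x.val * y := rfl

lemma Even.smul_even (x : Even E O) (y : SPoly (E ⊕ Y) O) : x • y = inclEven E O Y x.val * y := rfl

instance : IsScalarTower ℂ (Even E O) (SPoly E (O ⊕ Y)) := IsScalarTower.of_algebraMap_eq fun r =>
  (((inclOdd E O Y).comp (Even.val (E := E) (O := O))).commutes r).symm

instance : IsScalarTower ℂ (Even E O) (SPoly (E ⊕ Y) O) := IsScalarTower.of_algebraMap_eq fun r =>
  (((inclEven E O Y).comp (Even.val (E := E) (O := O))).commutes r).symm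

/-- Switches to the negation that comes from the ring structure, as the scalar lemmas expect it. -/
lemma neg_eq (x : SPoly E O) : -x = @Neg.neg _ Ring.toNeg x := rfl

lemma Even.neg_one_smul_odd (x : SPoly E (O ⊕ Y)) : (-1 : Even E O) • x = -x := by
  rw [neg_eq]
  exact neg_one_smul (Even E O) x

/-- A map between Grassmann algebras that is linear over even elements. -/
lemma lTensor_inclOdd_mul {O' : Type*} (φ : Gr (O ⊕ Y) →ₗ[ℂ] Gr O') (ψ : Gr O →ₐ[ℂ] Gr O')
    (h : ∀ y ∈ Gr.part O 0, ∀ x, φ (Gr.inl O Y y * x) = ψ y * φ x) {y : SPoly E O}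
    (hy : y ∈ part E O 0) (x : SPoly E (O ⊕ Y)) :
    LinearMap.lTensor (MvPolynomial E ℂ) φ (inclOdd E O Y y * x) =
      Algebra.TensorProduct.map (AlgHom.id ℂ (MvPolynomial E ℂ)) ψ y *
        LinearMap.lTensor (MvPolynomial E ℂ) φ x := by
  refine part_induction (p := fun y => LinearMap.lTensor (MvPolynomial E ℂ) φ (inclOdd E O Y y * x) =
      Algebra.TensorProduct.map (AlgHom.id ℂ (MvPolynomial E ℂ)) ψ y *
        LinearMap.lTensor (MvPolynomial E ℂ) φ x) ?_ ?_ ?_ hy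
  · simp only [map_zero, zero_mul]
  · intro f g hg
    induction x using TensorProduct.induction_on with
    | zero => simp only [mul_zero, map_zero]
    | tmul f' g' =>
      rw [inclOdd_tmul, Algebra.TensorProduct.tmul_mul_tmul, LinearMap.lTensor_tmul,
        LinearMap.lTensor_tmul, Algebra.TensorProduct.map_tmul, Algebra.TensorProduct.tmul_mul_tmul,
        h g hg]
      rfl
    | add x y h1 h2 => simp only [mul_add, map_add, h1, h2]
  · intro x y h1 h2; simp only [add_mul, map_add, h1, h2]

/-- No parity condition is needed here, because the map acts on the commutative tensor factor only.
-/
lemma rTensor_inclEven_mul {E' : Type*} (φ : MvPolynomial (E ⊕ Y) ℂ →ₗ[ℂ] MvPolynomial E' ℂ)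
    (ψ : MvPolynomial E ℂ →ₐ[ℂ] MvPolynomial E' ℂ)
    (h : ∀ y x, φ (MvPolynomial.rename Sum.inl y * x) = ψ y * φ x) (y : SPoly E O)
    (x : SPoly (E ⊕ Y) O) :
    LinearMap.rTensor (Gr O) φ (inclEven E O Y y * x) =
      Algebra.TensorProduct.map ψ (AlgHom.id ℂ (Gr O)) y * LinearMap.rTensor (Gr O) φ x := by
  induction y using TensorProduct.induction_on with
  | zero => simp only [map_zero, zero_mul]
  | tmul f g =>
    induction x using TensorProduct.induction_on with
    | zero => simp only [mul_zero, map_zero]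
    | tmul f' g' =>
      rw [inclEven_tmul, Algebra.TensorProduct.tmul_mul_tmul, LinearMap.rTensor_tmul,
        LinearMap.rTensor_tmul, Algebra.TensorProduct.map_tmul, Algebra.TensorProduct.tmul_mul_tmul,
        h]
      rfl
    | add x y h1 h2 => simp only [mul_add, map_add, h1, h2]
  | add x y h1 h2 => simp only [add_mul, map_add, h1, h2]

lemma lTensor_deriv_oddVar_mul [DecidableEq O] (o o' : O) (f : SPoly E O) :
    LinearMap.lTensor (MvPolynomial E ℂ) (Gr.deriv o) (oddVar o' * f) =
      (if o' = o then f else 0) - oddVar o' * LinearMap.lTensor (MvPolynomial E ℂ) (Gr.deriv o) f := by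
  induction f using TensorProduct.induction_on with
  | zero => simp only [mul_zero, map_zero, ite_self, sub_zero]
  | tmul f g =>
    change LinearMap.lTensor _ _ ((1 : MvPolynomial E ℂ) ⊗ₜ[ℂ] Gr.gen o' * f ⊗ₜ[ℂ] g) =
      _ - (1 : MvPolynomial E ℂ) ⊗ₜ[ℂ] Gr.gen o' * _
    rw [LinearMap.lTensor_tmul, Algebra.TensorProduct.tmul_mul_tmul,
      Algebra.TensorProduct.tmul_mul_tmul, LinearMap.lTensor_tmul, Gr.deriv_gen_mul, one_mul,
      TensorProduct.tmul_sub]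
    split_ifs <;> simp
  | add x y h1 h2 =>
    simp only [mul_add, map_add, h1, h2]
    split_ifs <;> abel

lemma rTensor_pderiv_evenVar_mul [DecidableEq E] (o o' : E) (f : SPoly E O) :
    LinearMap.rTensor (Gr O) (MvPolynomial.pderiv o).toLinearMap (evenVar o' * f) =
      (if o' = o then f else 0) +
        evenVar o' * LinearMap.rTensor (Gr O) (MvPolynomial.pderiv o).toLinearMap f := by
  induction f using TensorProduct.induction_on with
  | zero => simp only [mul_zero, map_zero, ite_self, add_zero]
  | tmul f g =>
    change LinearMap.rTensor _ _ (MvPolynomial.X o' ⊗ₜ[ℂ] 1 * f ⊗ₜ[ℂ] g) =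
      _ + MvPolynomial.X o' ⊗ₜ[ℂ] 1 * _
    rw [LinearMap.rTensor_tmul, Algebra.TensorProduct.tmul_mul_tmul,
      Algebra.TensorProduct.tmul_mul_tmul, LinearMap.rTensor_tmul, one_mul]
    simp only [Derivation.coeFn_coe, Derivation.leibniz,
      MvPolynomial.pderiv_X, smul_eq_mul, Pi.single_apply, TensorProduct.add_tmul]
    rw [add_comm, mul_ite, mul_one, mul_zero]
    simp only [eq_comm]
    split_ifs <;> simp
  | add x y h1 h2 =>
    simp only [mul_add, map_add, h1, h2]
    split_ifs <;> abel

lemma lTensor_deriv_smul (y : Y) (r : Even E O) (x : SPoly E (O ⊕ Y)) :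
    LinearMap.lTensor (MvPolynomial E ℂ) (Gr.deriv (.inr y)) (r • x) =
      r • LinearMap.lTensor (MvPolynomial E ℂ) (Gr.deriv (.inr y)) x := by
  rw [Even.smul_odd, Even.smul_odd, inclOdd]
  exact lTensor_inclOdd_mul (Gr.deriv (.inr y)) (Gr.inl O Y)
    (fun z hz x => Gr.deriv_inl_mul y hz x) (Even.val_mem r) x

/-- The calculus of anticommuting generators. -/
def oddCalculus (E O Y : Type*) [DecidableEq Y] :
    FieldCalculus (Even E O) (SPoly E (O ⊕ Y)) Y where
  Φ y := oddVar (.inr y)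
  d y :=
    { toFun := LinearMap.lTensor (MvPolynomial E ℂ) (Gr.deriv (σ := O ⊕ Y) (.inr y))
      map_add' := by intro x y; rw [map_add]
      map_smul' := lTensor_deriv_smul y }
  ε := -1
  ε_sq := by simp
  comm x y := by
    rw [odd_mul_odd (oddVar_mem _) (oddVar_mem _)]
    exact (Even.neg_one_smul_odd _).symm
  d_one y := by
    change LinearMap.lTensor _ _ (1 ⊗ₜ 1) = 0
    rw [LinearMap.lTensor_tmul, Gr.deriv_one, TensorProduct.tmul_zero]
  d_mul x y f := by
    classical
    refine (lTensor_deriv_oddVar_mul (E := E) (Sum.inr y : O ⊕ Y) (Sum.inr x) f).trans ?_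
    simp only [Sum.inr.injEq, sub_eq_add_neg]
    congr 1
    exact (Even.neg_one_smul_odd _).symm

/-- The calculus of commuting generators. -/
def evenCalculus (E O Y : Type*) [DecidableEq Y] :
    FieldCalculus (Even E O) (SPoly (E ⊕ Y) O) Y where
  Φ y := evenVar (.inr y)
  d y :=
    { toFun := LinearMap.rTensor (Gr O) (MvPolynomial.pderiv (.inr y)).toLinearMap
      map_add' := fun x y => by rw [map_add]
      map_smul' := fun r x => rTensor_inclEven_mul _ (MvPolynomial.rename Sum.inl)
        (fun f g => by
          simp only [Derivation.coeFn_coe, Derivation.leibniz,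
            smul_eq_mul]
          rw [MvPolynomial.pderiv_eq_zero_of_notMem_vars (f := MvPolynomial.rename Sum.inl f),
            mul_zero, add_zero]
          classical
          intro h
          have := MvPolynomial.vars_rename _ _ h
          simp at this) r.val x }
  ε := 1
  ε_sq := by simp
  comm x y := by
    rw [one_smul]
    exact commute_even (evenVar_mem _) _
  d_one y := by
    change LinearMap.rTensor _ _ (1 ⊗ₜ 1) = 0
    rw [LinearMap.rTensor_tmul]
    simp
  d_mul x y f := by
    classical
    refine (rTensor_pderiv_evenVar_mul (O := O) (Sum.inr y : E ⊕ Y) (Sum.inr x) f).trans ?_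
    simp only [Sum.inr.injEq, one_smul]
    congr

end SPoly

/-! ### The Berezin integral -/

namespace Gr
variable {O X : Type*}

/-- The operator `∂/∂ψ̄ₓ ∂/∂ψₓ`. -/
def derivPair (O : Type*) {X : Type*} (x : X) : Module.End ℂ (Gr (O ⊕ (X ⊕ X))) :=
  deriv (σ := O ⊕ (X ⊕ X)) (.inr (.inr x)) * deriv (.inr (.inl x))

/-- The product `ψₓ ψ̄ₓ`. -/
def genPair (O : Type*) {X : Type*} (x : X) : Gr (O ⊕ (X ⊕ X)) :=
  gen (.inr (.inl x)) * gen (.inr (.inr x))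

lemma derivPair_deriv (x : X) (z : O ⊕ (X ⊕ X)) (g : Gr (O ⊕ (X ⊕ X))) :
    derivPair O x (deriv z g) = deriv z (derivPair O x g) := by
  simp only [derivPair, Module.End.mul_apply]
  rw [deriv_comm (.inr (.inl x)) z, map_neg, deriv_comm (.inr (.inr x)) z, neg_neg]

lemma derivPair_inl_mul (x : X) {y : Gr O} (hy : y ∈ part O 0) (g : Gr (O ⊕ (X ⊕ X))) :
    derivPair O x (inl O (X ⊕ X) y * g) = inl O (X ⊕ X) y * derivPair O x g := by
  simp only [derivPair, Module.End.mul_apply, deriv_inl_mul _ hy]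

lemma derivPair_genPair_mul {x y : X} (h : x ≠ y) (g : Gr (O ⊕ (X ⊕ X))) :
    derivPair O x (genPair O y * g) = genPair O y * derivPair O x g := by
  classical
  simp only [derivPair, genPair, Module.End.mul_apply, mul_assoc, deriv_gen_mul, Sum.inr.injEq,
    Sum.inl.injEq, reduceCtorEq, h.symm, if_false, zero_sub, mul_neg, neg_neg]

lemma derivPair_genPair (x : X) : derivPair O x (genPair O x) = 1 := by
  classical
  rw [← mul_one (genPair O x)]
  simp only [derivPair, genPair, Module.End.mul_apply, mul_assoc, deriv_gen_mul, Sum.inr.injEq,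
    reduceCtorEq, if_false, if_true, deriv_one, mul_zero, sub_zero]

lemma prod_derivPair_deriv (l : List X) (z : O ⊕ (X ⊕ X)) (g : Gr (O ⊕ (X ⊕ X))) :
    (l.map (derivPair O)).prod (deriv z g) = deriv z ((l.map (derivPair O)).prod g) := by
  induction l generalizing g with
  | nil => rfl
  | cons x l ih =>
    rw [List.map_cons, List.prod_cons, Module.End.mul_apply, Module.End.mul_apply, ih,
      derivPair_deriv]

lemma prod_derivPair_inl_mul (l : List X) {y : Gr O} (hy : y ∈ part O 0) (g : Gr (O ⊕ (X ⊕ X))) :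
    (l.map (derivPair O)).prod (inl O (X ⊕ X) y * g) =
      inl O (X ⊕ X) y * (l.map (derivPair O)).prod g := by
  induction l generalizing g with
  | nil => rfl
  | cons x l ih =>
    rw [List.map_cons, List.prod_cons, Module.End.mul_apply, Module.End.mul_apply, ih,
      derivPair_inl_mul _ hy]

lemma prod_derivPair_genPair_mul (l : List X) {y : X} (h : y ∉ l) (g : Gr (O ⊕ (X ⊕ X))) :
    (l.map (derivPair O)).prod (genPair O y * g) = genPair O y * (l.map (derivPair O)).prod g := by
  induction l generalizing g with
  | nil => rfl
  | cons x l ih =>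
    rw [List.mem_cons, not_or] at h
    rw [List.map_cons, List.prod_cons, Module.End.mul_apply, Module.End.mul_apply, ih h.2,
      derivPair_genPair_mul (Ne.symm h.1)]

lemma prod_derivPair_prod_genPair (l : List X) (h : l.Nodup) :
    (l.map (derivPair O)).prod (l.map (genPair O)).prod = 1 := by
  induction l with
  | nil => rfl
  | cons x l ih =>
    rw [List.nodup_cons] at h
    rw [List.map_cons, List.prod_cons, Module.End.mul_apply, List.map_cons, List.prod_cons,
      prod_derivPair_genPair_mul l h.1, ih h.2, mul_one, derivPair_genPair]

/-- The pair operators are even and let the derivative pass, until it meets the pair that contains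
it; there it is squared to zero. This is integration by parts for the Berezin integral. -/
lemma prod_derivPair_deriv_of_mem (l : List X) {z : X ⊕ X} (hz : Sum.elim id id z ∈ l)
    (g : Gr (O ⊕ (X ⊕ X))) : (l.map (derivPair O)).prod (deriv (.inr z) g) = 0 := by
  induction l with
  | nil => simp at hz
  | cons x l ih =>
    rw [List.map_cons, List.prod_cons, Module.End.mul_apply]
    rcases List.mem_cons.1 hz with h | h
    · rw [prod_derivPair_deriv, derivPair, Module.End.mul_apply]
      rcases z with z | z
      · obtain rfl : z = x := h
        rw [deriv_deriv, map_zero]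
      · obtain rfl : z = x := h
        rw [deriv_comm, deriv_deriv, map_zero, neg_zero]
    · rw [ih h, map_zero]

end Gr

variable {O X : Type*} [Fintype X]

lemma berezin_apply (g : Gr (O ⊕ (X ⊕ X))) : berezin g =
    Gr.restrict O (X ⊕ X) (((Finset.univ : Finset X).toList.map (Gr.derivPair O)).prod g) := rfl

lemma berezin_deriv (z : X ⊕ X) (g : Gr (O ⊕ (X ⊕ X))) : berezin (Gr.deriv (.inr z) g) = 0 := by
  rw [berezin_apply, Gr.prod_derivPair_deriv_of_mem _ (by simp), map_zero]

lemma berezin_inl_mul {y : Gr O} (hy : y ∈ Gr.part O 0) (g : Gr (O ⊕ (X ⊕ X))) :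
    berezin (Gr.inl O (X ⊕ X) y * g) = y * berezin g := by
  rw [berezin_apply, Gr.prod_derivPair_inl_mul _ hy, map_mul, Gr.restrict_inl, berezin_apply]

lemma berezin_top :
    berezin (((Finset.univ : Finset X).toList.map (Gr.genPair O)).prod) = 1 := by
  rw [berezin_apply, Gr.prod_derivPair_prod_genPair _ (Finset.nodup_toList _), map_one]

namespace SPoly
variable {E : Type*}

lemma fermionIntegral_smul (r : Even E O) (x : SPoly E (O ⊕ (X ⊕ X))) :
    fermionIntegral (r • x) = r • fermionIntegral x := by
  rw [Even.smul_odd, Even.smul_def]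
  refine (lTensor_inclOdd_mul berezin (AlgHom.id ℂ (Gr O)) (fun y hy g => berezin_inl_mul hy g)
    (Even.val_mem r) x).trans ?_
  rw [Algebra.TensorProduct.map_id]
  rfl

/-- The Berezin integral, linear over even elements. -/
def fermionFunctional (E O X : Type*) [Fintype X] :
    SPoly E (O ⊕ (X ⊕ X)) →ₗ[Even E O] SPoly E O where
  toFun := fermionIntegral (E := E) (O := O) (X := X)
  map_add' := by intro x y; rw [map_add]
  map_smul' := fermionIntegral_smul

lemma fermionIntegral_deriv (z : X ⊕ X) (x : SPoly E (O ⊕ (X ⊕ X))) :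
    fermionIntegral (LinearMap.lTensor (MvPolynomial E ℂ) (Gr.deriv (.inr z)) x) = 0 := by
  induction x using TensorProduct.induction_on with
  | zero => rw [map_zero, map_zero]
  | tmul f g =>
    rw [LinearMap.lTensor_tmul, fermionIntegral, LinearMap.lTensor_tmul, berezin_deriv,
      TensorProduct.tmul_zero]
  | add x y h1 h2 => rw [map_add, map_add, h1, h2, add_zero]

/-- The product of all odd field variables. -/
def oddTop (E O X : Type*) [Fintype X] : SPoly E (O ⊕ (X ⊕ X)) :=
  ofGr (((Finset.univ : Finset X).toList.map (Gr.genPair O)).prod)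

lemma fermionIntegral_top : fermionIntegral (oddTop E O X) = 1 := by
  have : fermionIntegral (oddTop E O X) = (1 : MvPolynomial E ℂ) ⊗ₜ[ℂ]
      berezin (((Finset.univ : Finset X).toList.map (Gr.genPair O)).prod) := rfl
  rw [this, berezin_top]
  rfl

lemma oddTop_mem [DecidableEq X] : oddTop E O X ∈
    Algebra.adjoin (Even E O) (Set.range (oddCalculus E O (X ⊕ X)).Φ) := by
  have h : oddTop E O X = ((Finset.univ : Finset X).toList.map fun x =>
      (oddCalculus E O (X ⊕ X)).Φ (.inl x) * (oddCalculus E O (X ⊕ X)).Φ (.inr x)).prod := by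
    rw [oddTop, map_list_prod, List.map_map]
    congr 1
    refine List.map_congr_left fun x _ => ?_
    rw [Function.comp_apply, Gr.genPair, map_mul]
    rfl
  rw [h]
  refine Subalgebra.list_prod_mem _ fun y hy => ?_
  obtain ⟨x, -, rfl⟩ := List.mem_map.1 hy
  exact Subalgebra.mul_mem _ (Algebra.subset_adjoin ⟨_, rfl⟩) (Algebra.subset_adjoin ⟨_, rfl⟩)

end SPoly

/-! ### Gaussian integrals over complex variables -/

open MeasureTheory

section Gaussian
variable {X : Type*} [Fintype X]

/-- The fields `φ`, `φ̄` at a point. -/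
def fieldPoint (φ : X → ℂ) : X ⊕ X → ℂ := Sum.elim φ fun x => starRingEnd ℂ (φ x)

/-- The quadratic form `φ̄ B φ` as a polynomial. -/
def quadPoly (B : Matrix X X ℂ) : MvPolynomial (X ⊕ X) ℂ :=
  ∑ x, ∑ y, MvPolynomial.C (B x y) * (MvPolynomial.X (.inr x) * MvPolynomial.X (.inl y))

lemma eval_quadPoly (B : Matrix X X ℂ) (φ : X → ℂ) :
    MvPolynomial.eval (fieldPoint φ) (quadPoly B) =
      ∑ x, ∑ y, starRingEnd ℂ (φ x) * B x y * φ y := by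
  simp only [quadPoly, map_sum, map_mul, MvPolynomial.eval_C, MvPolynomial.eval_X, fieldPoint,
    Sum.elim_inl, Sum.elim_inr]
  exact Finset.sum_congr rfl fun x _ => Finset.sum_congr rfl fun y _ => by ring

lemma continuous_eval_fieldPoint (p : MvPolynomial (X ⊕ X) ℂ) :
    Continuous fun φ : X → ℂ => MvPolynomial.eval (fieldPoint φ) p := by
  have h : Continuous (fieldPoint (X := X)) := by
    refine continuous_pi fun z => ?_
    rcases z with z | z
    · exact continuous_apply z
    · exact Complex.continuous_conj.comp (continuous_apply z)
  exact (MvPolynomial.continuous_eval p).comp h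

/-- Conjugation is only real-differentiable, so the derivative is taken along a real line. The chain
rule then treats φ and φ̄ as independent variables with the velocities v and v̄. -/
lemma hasDerivAt_eval_fieldPoint (p : MvPolynomial (X ⊕ X) ℂ) (φ v : X → ℂ) :
    HasDerivAt (fun t : ℝ => MvPolynomial.eval (fieldPoint (φ + t • v)) p)
      (∑ z, fieldPoint v z * MvPolynomial.eval (fieldPoint φ) (MvPolynomial.pderiv z p)) 0 := by
  classical
  have h0 : ∀ z, HasDerivAt (fun t : ℝ => fieldPoint (φ + t • v) z) (fieldPoint v z) 0 := by
    have h1 : ∀ a b : ℂ, HasDerivAt (fun t : ℝ => a + (t : ℂ) * b) b 0 := by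
      intro a b
      simpa using ((Complex.ofRealCLM.hasDerivAt (x := (0 : ℝ))).mul_const b).const_add a
    rintro (z | z)
    · simpa [fieldPoint] using h1 (φ z) (v z)
    · simpa [fieldPoint] using h1 (starRingEnd ℂ (φ z)) (starRingEnd ℂ (v z))
  induction p using MvPolynomial.induction_on with
  | C a => simpa using hasDerivAt_const (0 : ℝ) a
  | add p q hp hq =>
    simp only [map_add, mul_add, Finset.sum_add_distrib]
    exact hp.add hq
  | mul_X p z hp =>
    have h := hp.mul (h0 z)
    simp only [map_mul, MvPolynomial.eval_X] at h ⊢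
    refine h.congr_deriv ?_
    simp only [zero_smul, add_zero, Derivation.leibniz, smul_eq_mul, MvPolynomial.pderiv_X, map_add,
      map_mul, MvPolynomial.eval_X, mul_add, Finset.sum_add_distrib, Finset.sum_mul,
      Pi.single_apply]
    rw [add_comm]
    congr 1
    · simp only [apply_ite (MvPolynomial.eval (fieldPoint φ)), map_one, map_zero, mul_ite, mul_one,
        mul_zero]
      simp [mul_comm]
    · exact Finset.sum_congr rfl fun y _ => by ring

/-- A polynomial is dominated by a Gaussian of arbitrarily slow growth. This makes polynomials
integrable against the weight. -/
lemma exists_eval_bound (p : MvPolynomial (X ⊕ X) ℂ) {c : ℝ} (hc : 0 < c) :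
    ∃ C, 0 ≤ C ∧ ∀ φ : X → ℂ, ‖MvPolynomial.eval (fieldPoint φ) p‖ ≤
      C * Real.exp (c * ∑ x, ‖φ x‖ ^ 2) := by
  have hS : ∀ φ : X → ℂ, 0 ≤ ∑ x, ‖φ x‖ ^ 2 := fun φ => Finset.sum_nonneg fun x _ => by positivity
  induction p using MvPolynomial.induction_on generalizing c with
  | C a =>
    refine ⟨‖a‖, norm_nonneg _, fun φ => ?_⟩
    rw [MvPolynomial.eval_C]
    exact le_mul_of_one_le_right (norm_nonneg _) (Real.one_le_exp (mul_nonneg hc.le (hS φ)))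
  | add p q hp hq =>
    obtain ⟨C, hC, h1⟩ := hp hc
    obtain ⟨D, hD, h2⟩ := hq hc
    refine ⟨C + D, add_nonneg hC hD, fun φ => ?_⟩
    rw [map_add, add_mul]
    exact (norm_add_le _ _).trans (add_le_add (h1 φ) (h2 φ))
  | mul_X p z hp =>
    -- Half of the exponent is spent on `p`, the other half on the additional variable.
    obtain ⟨C, hC, h1⟩ := hp (half_pos hc)
    refine ⟨C * (1 + 2 / c), by positivity, fun φ => ?_⟩
    have h2 : ‖fieldPoint φ z‖ ^ 2 ≤ ∑ x, ‖φ x‖ ^ 2 := by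
      have h3 : ‖fieldPoint φ z‖ = ‖φ (Sum.elim id id z)‖ := by
        rcases z with z | z <;> simp [fieldPoint]
      rw [h3]
      exact Finset.single_le_sum (f := fun x => ‖φ x‖ ^ 2) (fun x _ => by positivity)
        (Finset.mem_univ _)
    have h4 : ‖fieldPoint φ z‖ ≤ (1 + 2 / c) * Real.exp (c / 2 * ∑ x, ‖φ x‖ ^ 2) := by
      set S := ∑ x, ‖φ x‖ ^ 2
      have h5 : c / 2 * S + 1 ≤ Real.exp (c / 2 * S) := Real.add_one_le_exp _
      have h6 : S ≤ 2 / c * Real.exp (c / 2 * S) := by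
        have h7 : S = 2 / c * (c / 2 * S) := by field_simp
        calc S = 2 / c * (c / 2 * S) := h7
          _ ≤ _ := by gcongr; linarith
      have h8 : (1 : ℝ) ≤ Real.exp (c / 2 * S) := Real.one_le_exp (mul_nonneg (by positivity) (hS φ))
      nlinarith [sq_nonneg (‖fieldPoint φ z‖ - 1), norm_nonneg (fieldPoint φ z)]
    rw [map_mul, MvPolynomial.eval_X, norm_mul]
    calc _ ≤ (C * Real.exp (c / 2 * ∑ x, ‖φ x‖ ^ 2)) *
          ((1 + 2 / c) * Real.exp (c / 2 * ∑ x, ‖φ x‖ ^ 2)) :=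
          mul_le_mul (h1 φ) h4 (norm_nonneg _) (by positivity)
      _ = C * (1 + 2 / c) * (Real.exp (c / 2 * ∑ x, ‖φ x‖ ^ 2) *
            Real.exp (c / 2 * ∑ x, ‖φ x‖ ^ 2)) := by ring
      _ = _ := by rw [← Real.exp_add, ← add_mul, add_halves]

lemma integrable_exp_neg_sum_sq {c : ℝ} (hc : 0 < c) :
    Integrable fun φ : X → ℂ => Real.exp (-c * ∑ x, ‖φ x‖ ^ 2) := by
  have h1 : Integrable fun z : ℂ => Real.exp (-c * ‖z‖ ^ 2) := by
    have := GaussianFourier.integrable_cexp_neg_mul_sq_norm_add (V := ℂ) (b := (c : ℂ))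
      (by simpa using hc) 0 0
    refine this.norm.congr (Filter.Eventually.of_forall fun z => ?_)
    simp only [Complex.norm_exp]
    congr 1
    simp [← Complex.ofReal_pow, ← Complex.ofReal_neg, ← Complex.ofReal_mul]
  have h2 := Integrable.fintype_prod (ι := X) (f := fun _ z => Real.exp (-c * ‖z‖ ^ 2))
    (μ := fun _ => (volume : Measure ℂ)) fun _ => h1
  refine h2.congr (Filter.Eventually.of_forall fun φ => ?_)
  simp only [← Real.exp_sum, Finset.mul_sum]

/-- The Gaussian weight decays: the real part of `φ̄ B φ` dominates `|φ|²`. -/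
def IsCoercive (B : Matrix X X ℂ) : Prop :=
  ∃ c : ℝ, 0 < c ∧ ∀ φ : X → ℂ,
    c * ∑ x, ‖φ x‖ ^ 2 ≤ (∑ x, ∑ y, starRingEnd ℂ (φ x) * B x y * φ y).re

variable {B : Matrix X X ℂ}

lemma IsCoercive.integrable (hB : IsCoercive B) (p : MvPolynomial (X ⊕ X) ℂ) :
    Integrable fun φ : X → ℂ => MvPolynomial.eval (fieldPoint φ) p *
      Complex.exp (-MvPolynomial.eval (fieldPoint φ) (quadPoly B)) := by
  obtain ⟨c, hc, h⟩ := hB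
  obtain ⟨C, hC, hp⟩ := exists_eval_bound p (half_pos hc)
  refine ((integrable_exp_neg_sum_sq (half_pos hc)).const_mul C).mono'
    (((continuous_eval_fieldPoint p).mul
      (continuous_eval_fieldPoint (quadPoly B)).neg.cexp).aestronglyMeasurable)
    (Filter.Eventually.of_forall fun φ => ?_)
  rw [norm_mul, Complex.norm_exp, eval_quadPoly]
  calc _ ≤ (C * Real.exp (c / 2 * ∑ x, ‖φ x‖ ^ 2)) * Real.exp (-(c * ∑ x, ‖φ x‖ ^ 2)) := by
        refine mul_le_mul (hp φ) (Real.exp_le_exp.2 ?_) (Real.exp_nonneg _) (by positivity)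
        rw [Complex.neg_re]
        exact neg_le_neg (h φ)
    _ = _ := by
        rw [mul_assoc, ← Real.exp_add]
        congr 2
        ring

/-- The Gaussian integral of a polynomial in `φ`, `φ̄`. -/
def gaussFunctional (hB : IsCoercive B) : MvPolynomial (X ⊕ X) ℂ →ₗ[ℂ] ℂ where
  toFun p := ∫ φ : X → ℂ, MvPolynomial.eval (fieldPoint φ) p *
    Complex.exp (-MvPolynomial.eval (fieldPoint φ) (quadPoly B))
  map_add' p q := by
    simp only [map_add, add_mul]
    exact integral_add (hB.integrable p) (hB.integrable q)
  map_smul' r p := by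
    simp only [MvPolynomial.smul_eval, mul_assoc, RingHom.id_apply, smul_eq_mul]
    exact integral_const_mul r _

lemma gaussFunctional_monomial (hB : IsCoercive B) (m : X ⊕ X →₀ ℕ) :
    gaussFunctional hB (MvPolynomial.monomial m 1) = gaussMoment B m := by
  simp only [gaussFunctional, LinearMap.coe_mk, AddHom.coe_mk, gaussMoment, eval_quadPoly]
  congr 1
  funext φ
  congr 1
  rw [MvPolynomial.eval_monomial, one_mul, Finsupp.prod_fintype _ _ (by simp)]
  simp [Fintype.prod_sum_type, fieldPoint, Finset.prod_mul_distrib]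

/-- Integration by parts along real directions of ℂ^X; the Wirtinger derivatives are recovered from
the directions 1 and i at each point. -/
lemma gaussFunctional_pderiv (hB : IsCoercive B) (z : X ⊕ X) (p : MvPolynomial (X ⊕ X) ℂ) :
    gaussFunctional hB (MvPolynomial.pderiv z p) =
      gaussFunctional hB (MvPolynomial.pderiv z (quadPoly B) * p) := by
  classical
  set D : X ⊕ X → MvPolynomial (X ⊕ X) ℂ := fun z =>
    MvPolynomial.pderiv z p - MvPolynomial.pderiv z (quadPoly B) * p with hD
  have key : ∀ v : X → ℂ, ∑ z, fieldPoint v z * gaussFunctional hB (D z) = 0 := by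
    intro v
    have h1 : ∀ φ : X → ℂ, HasLineDerivAt ℝ (fun φ : X → ℂ => MvPolynomial.eval (fieldPoint φ) p *
        Complex.exp (-MvPolynomial.eval (fieldPoint φ) (quadPoly B)))
        (MvPolynomial.eval (fieldPoint φ) (∑ z, fieldPoint v z • D z) *
          Complex.exp (-MvPolynomial.eval (fieldPoint φ) (quadPoly B))) φ v := by
      intro φ
      have h2 := (hasDerivAt_eval_fieldPoint p φ v).mul
        (hasDerivAt_eval_fieldPoint (quadPoly B) φ v).neg.cexp
      refine h2.congr_deriv ?_
      simp only [Pi.neg_apply, zero_smul, add_zero, hD, map_sum, MvPolynomial.smul_eval, map_sub,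
        map_mul, Finset.sum_mul, mul_neg, Finset.mul_sum]
      rw [← Finset.sum_neg_distrib, ← Finset.sum_add_distrib]
      refine Finset.sum_congr rfl fun z _ => ?_
      ring
    -- The other factor in the integration by parts is the constant 1, whose derivative vanishes.
    have h3 := integral_bilinear_hasLineDerivAt_right_eq_neg_left_of_integrable
      (μ := (volume : Measure (X → ℂ))) (B := ContinuousLinearMap.mul ℝ ℂ) (v := v)
      (f := fun _ => (1 : ℂ)) (f' := fun _ => 0)
      (g := fun φ : X → ℂ => MvPolynomial.eval (fieldPoint φ) p *
        Complex.exp (-MvPolynomial.eval (fieldPoint φ) (quadPoly B)))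
      (g' := fun φ => MvPolynomial.eval (fieldPoint φ) (∑ z, fieldPoint v z • D z) *
          Complex.exp (-MvPolynomial.eval (fieldPoint φ) (quadPoly B)))
      (by simp)
      (by simpa only [ContinuousLinearMap.mul_apply', one_mul] using
        hB.integrable (∑ z, fieldPoint v z • D z))
      (by simpa only [ContinuousLinearMap.mul_apply', one_mul] using hB.integrable p)
      (fun φ _ => by simpa [HasLineDerivAt] using hasDerivAt_const (0 : ℝ) (1 : ℂ))
      (fun φ _ => h1 φ)
    have h4 : gaussFunctional hB (∑ z, fieldPoint v z • D z) = 0 := by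
      simpa [gaussFunctional] using h3
    simpa using h4
  have h0 : gaussFunctional hB (D z) = 0 := by
    -- The unit direction at x gives the sum of the φ and φ̄ equations, the direction i below gives
    -- i times their difference; together they imply both.
    have e1 : ∀ x, gaussFunctional hB (D (.inl x)) + gaussFunctional hB (D (.inr x)) = 0 := by
      intro x
      simpa [Fintype.sum_sum_type, fieldPoint, Pi.single_apply, apply_ite] using
        key (Pi.single x 1)
    have e2 : ∀ x, Complex.I * gaussFunctional hB (D (.inl x)) +
        -Complex.I * gaussFunctional hB (D (.inr x)) = 0 := by
      intro x
      simpa [Fintype.sum_sum_type, fieldPoint, Pi.single_apply, apply_ite] using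
        key (Pi.single x Complex.I)
    have e3 : ∀ x, gaussFunctional hB (D (.inl x)) = 0 := by
      intro x
      have : (2 * Complex.I) * gaussFunctional hB (D (.inl x)) = 0 := by
        linear_combination e2 x + Complex.I * e1 x
      simpa using this
    rcases z with z | z
    · exact e3 z
    · simpa [e3 z] using e1 z
  rw [hD] at h0
  simpa [sub_eq_zero] using h0

end Gaussian

/-! ### Normal form of matrices with positive definite Hermitian part -/

open MeasureTheory Matrix

section Accretive
variable {X : Type*} [Fintype X] [DecidableEq X]

-- Write B = H + i K with H and K Hermitian and H positive definite. With H = Q* Q the matrix (Q⁻¹)*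
-- K Q⁻¹ is Hermitian, and P = U* Q for a unitary U that diagonalizes it reduces H to 1 and K to a
-- real diagonal matrix simultaneously.
open scoped MatrixOrder ComplexOrder in
lemma exists_factorization {B : Matrix X X ℂ}
    (hB : ∀ z : X → ℂ, z ≠ 0 → 0 < (∑ x, ∑ y, starRingEnd ℂ (z x) * B x y * z y).re) :
    ∃ (P : Matrix X X ℂ) (d : X → ℝ), IsUnit P ∧
      B = Pᴴ * diagonal (fun x => (1 + d x * Complex.I : ℂ)) * P := by
  set H : Matrix X X ℂ := (1 / 2 : ℂ) • (B + Bᴴ) with hH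
  set K : Matrix X X ℂ := (-Complex.I / 2) • (B - Bᴴ) with hK
  have hHK : B = H + Complex.I • K := by
    rw [hH, hK, smul_smul]
    have : Complex.I * (-Complex.I / 2) = 1 / 2 := by
      linear_combination (-1 / 2 : ℂ) * Complex.I_mul_I
    rw [this, ← smul_add, add_add_sub_cancel, ← two_smul ℂ B, smul_smul]
    norm_num
  have hHh : H.IsHermitian := by
    simp [hH, IsHermitian, conjTranspose_smul, add_comm]
  have hKh : K.IsHermitian := by
    simp only [hK, IsHermitian, conjTranspose_smul, conjTranspose_sub, conjTranspose_conjTranspose]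
    have : star (-Complex.I / 2) = Complex.I / 2 := by simp
    rw [this, ← neg_sub B, smul_neg, neg_div, neg_smul]
  have hpos : H.PosDef := by
    refine PosDef.of_dotProduct_mulVec_pos hHh fun z hz => ?_
    have h1 := hB z hz
    have h2 : (star z ⬝ᵥ (B *ᵥ z)).re = (∑ x, ∑ y, starRingEnd ℂ (z x) * B x y * z y).re := by
      simp [dotProduct, mulVec, Finset.mul_sum, mul_assoc]
    have h3 : star z ⬝ᵥ (Bᴴ *ᵥ z) = star (star z ⬝ᵥ (B *ᵥ z)) := by
      rw [star_dotProduct, star_mulVec, conjTranspose_conjTranspose, dotProduct_mulVec,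
        dotProduct_comm]
    have h4 : star z ⬝ᵥ (H *ᵥ z) = (((star z ⬝ᵥ (B *ᵥ z)).re : ℝ) : ℂ) := by
      rw [hH, smul_mulVec, dotProduct_smul, add_mulVec, dotProduct_add, h3, smul_eq_mul]
      have := Complex.add_conj (star z ⬝ᵥ (B *ᵥ z))
      rw [Complex.star_def, this]
      push_cast
      ring
    rw [h4, h2]
    exact_mod_cast h1
  obtain ⟨Q, hQ⟩ := (CStarAlgebra.nonneg_iff_eq_star_mul_self (a := H)).1
    (nonneg_iff_posSemidef.2 hpos.posSemidef)
  have hQu : IsUnit Q := by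
    have := hpos.isUnit
    rw [hQ] at this
    rw [isUnit_iff_isUnit_det] at this ⊢
    rw [det_mul] at this
    exact isUnit_of_mul_isUnit_right this
  have hQQ : Q⁻¹ * Q = 1 := nonsing_inv_mul _ ((isUnit_iff_isUnit_det _).1 hQu)
  have hQQ' : Qᴴ * Q⁻¹ᴴ = 1 := by rw [← conjTranspose_mul, hQQ, conjTranspose_one]
  set L := Q⁻¹ᴴ * K * Q⁻¹ with hL
  have hLh : L.IsHermitian := by
    simp [hL, IsHermitian, conjTranspose_mul, hKh.eq, mul_assoc]
  set U : Matrix X X ℂ := hLh.eigenvectorUnitary.1 with hU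
  have hUU : U * Uᴴ = 1 := (Unitary.mem_iff.1 hLh.eigenvectorUnitary.2).2
  have hsp : L = U * diagonal (fun x => (hLh.eigenvalues x : ℂ)) * Uᴴ := by
    conv_lhs => rw [hLh.spectral_theorem]
    rfl
  refine ⟨Uᴴ * Q, hLh.eigenvalues, ?_, ?_⟩
  · exact (IsUnit.of_mul_eq_one (b := U) (mul_eq_one_comm.1 hUU)).mul hQu
  · have hd : diagonal (fun x => (1 + hLh.eigenvalues x * Complex.I : ℂ)) =
        1 + Complex.I • diagonal (fun x => (hLh.eigenvalues x : ℂ)) := by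
      rw [← diagonal_one, ← diagonal_smul, diagonal_add]
      congr 1
      funext x
      simp [mul_comm]
    rw [hd, conjTranspose_mul, conjTranspose_conjTranspose]
    have : Qᴴ * U * (1 + Complex.I • diagonal fun x => (hLh.eigenvalues x : ℂ)) * (Uᴴ * Q) =
        Qᴴ * (U * Uᴴ) * Q + Complex.I •
          (Qᴴ * (U * diagonal (fun x => (hLh.eigenvalues x : ℂ)) * Uᴴ) * Q) := by
      simp only [mul_add, add_mul, mul_one, mul_assoc, Matrix.mul_smul, Matrix.smul_mul]
    rw [this, hUU, mul_one, ← hsp, hL]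
    have h5 : Qᴴ * (Q⁻¹ᴴ * K * Q⁻¹) * Q = (Qᴴ * Q⁻¹ᴴ) * K * (Q⁻¹ * Q) := by
      simp only [mul_assoc]
    rw [h5, hQQ, hQQ', one_mul, mul_one]
    change B = star Q * Q + _
    rw [← hQ]
    exact hHK

variable {B : Matrix X X ℂ}

lemma quadratic_factorization (P : Matrix X X ℂ) (e : X → ℂ) (φ : X → ℂ) :
    ∑ x, ∑ y, starRingEnd ℂ (φ x) * (Pᴴ * diagonal e * P) x y * φ y =
      ∑ x, e x * (‖(P *ᵥ φ) x‖ : ℂ) ^ 2 := by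
  have h1 : ∑ x, ∑ y, starRingEnd ℂ (φ x) * (Pᴴ * diagonal e * P) x y * φ y =
      star φ ⬝ᵥ ((Pᴴ * diagonal e * P) *ᵥ φ) := by
    simp [dotProduct, mulVec, Finset.mul_sum, mul_assoc]
  rw [h1, ← mulVec_mulVec, ← mulVec_mulVec, dotProduct_mulVec, ← star_mulVec]
  simp only [dotProduct, mulVec_diagonal, Pi.star_apply]
  refine Finset.sum_congr rfl fun x _ => ?_
  rw [← Complex.conj_mul', Complex.star_def]
  ring

lemma isUnit_of_accretive
    (hB : ∀ z : X → ℂ, z ≠ 0 → 0 < (∑ x, ∑ y, starRingEnd ℂ (z x) * B x y * z y).re) :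
    IsUnit B := by
  obtain ⟨P, d, hP, rfl⟩ := exists_factorization hB
  refine (IsUnit.mul (IsUnit.star hP) ?_).mul hP
  rw [isUnit_iff_isUnit_det, det_diagonal, isUnit_iff_ne_zero, Finset.prod_ne_zero_iff]
  intro x _ h
  simpa using congrArg Complex.re h

lemma isCoercive_of_accretive
    (hB : ∀ z : X → ℂ, z ≠ 0 → 0 < (∑ x, ∑ y, starRingEnd ℂ (z x) * B x y * z y).re) :
    IsCoercive B := by
  obtain ⟨P, d, hP, rfl⟩ := exists_factorization hB
  have hPP : P⁻¹ * P = 1 := nonsing_inv_mul _ ((isUnit_iff_isUnit_det _).1 hP)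
  set f := (P⁻¹).mulVecLin.toContinuousLinearMap with hf
  -- The function space has the sup norm, so passing to the sum of squares costs the number of
  -- points. The summand 1 keeps the constant positive when `X` is empty.
  set C := (Fintype.card X : ℝ) * ‖f‖ ^ 2 + 1 with hC
  have hC0 : 0 < C := by positivity
  refine ⟨C⁻¹, inv_pos.2 hC0, fun φ => ?_⟩
  rw [quadratic_factorization, inv_mul_le_iff₀ hC0]
  set ψ := P *ᵥ φ with hψ
  have hφ : φ = f ψ := by simp [hf, hψ, hPP]
  have h1 : (∑ x, (1 + d x * Complex.I) * (‖ψ x‖ : ℂ) ^ 2).re = ∑ x, ‖ψ x‖ ^ 2 := by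
    rw [Complex.re_sum]
    refine Finset.sum_congr rfl fun x _ => ?_
    rw [← Complex.ofReal_pow, Complex.re_mul_ofReal]
    simp
  have h2 : ‖ψ‖ ^ 2 ≤ ∑ x, ‖ψ x‖ ^ 2 := by
    have h0 : 0 ≤ ∑ x, ‖ψ x‖ ^ 2 := Finset.sum_nonneg fun x _ => by positivity
    have : ‖ψ‖ ≤ √(∑ x, ‖ψ x‖ ^ 2) := (pi_norm_le_iff_of_nonneg (Real.sqrt_nonneg _)).2 fun x =>
      Real.le_sqrt_of_sq_le (Finset.single_le_sum (f := fun x => ‖ψ x‖ ^ 2)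
        (fun x _ => by positivity) (Finset.mem_univ x))
    calc ‖ψ‖ ^ 2 ≤ √(∑ x, ‖ψ x‖ ^ 2) ^ 2 := by gcongr
      _ = _ := Real.sq_sqrt h0
  rw [h1]
  calc ∑ x, ‖φ x‖ ^ 2 ≤ ∑ _x : X, ‖φ‖ ^ 2 := by
        gcongr with x
        exact norm_le_pi_norm φ x
    _ = Fintype.card X * ‖φ‖ ^ 2 := by simp
    _ ≤ Fintype.card X * (‖f‖ * ‖ψ‖) ^ 2 := by
        gcongr
        rw [hφ]
        exact f.le_opNorm ψ
    _ ≤ C * ‖ψ‖ ^ 2 := by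
        rw [mul_pow, ← mul_assoc, hC]
        gcongr
        linarith
    _ ≤ _ := by gcongr

/-- After the substitution ψ = P φ, which has a nonzero real determinant, the integral splits into
Gaussian integrals over ℂ, each a power of π / (1 + i d_x) and hence nonzero. -/
lemma gaussFunctional_one_ne_zero
    (hB : ∀ z : X → ℂ, z ≠ 0 → 0 < (∑ x, ∑ y, starRingEnd ℂ (z x) * B x y * z y).re)
    (hB' : IsCoercive B) : gaussFunctional hB' 1 ≠ 0 := by
  obtain ⟨P, d, hP, rfl⟩ := exists_factorization hB
  simp only [gaussFunctional, LinearMap.coe_mk, AddHom.coe_mk, map_one, one_mul, eval_quadPoly,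
    quadratic_factorization]
  have hPP : P⁻¹ * P = 1 := nonsing_inv_mul _ ((isUnit_iff_isUnit_det _).1 hP)
  have hPP' : P * P⁻¹ = 1 := mul_nonsing_inv _ ((isUnit_iff_isUnit_det _).1 hP)
  set e : (X → ℂ) ≃ₗ[ℝ] (X → ℂ) :=
    LinearEquiv.ofLinearMap (P.mulVecLin.restrictScalars ℝ) ((P⁻¹).mulVecLin.restrictScalars ℝ)
      (LinearMap.ext fun v => by simp [hPP']) (LinearMap.ext fun v => by simp [hPP]) with he
  have hdet : LinearMap.det (e : (X → ℂ) →ₗ[ℝ] (X → ℂ)) ≠ 0 := e.isUnit_det'.ne_zero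
  set g : (X → ℂ) → ℂ := fun ψ => Complex.exp (-∑ x, (1 + d x * Complex.I) * (‖ψ x‖ : ℂ) ^ 2)
    with hg
  have hmap := Measure.map_linearMap_addHaar_eq_smul_addHaar (volume : Measure (X → ℂ)) hdet
  have h1 := (e.toContinuousLinearEquiv.toHomeomorph.measurableEmbedding).integral_map
    (μ := (volume : Measure (X → ℂ))) g
  have h2 : (∫ φ : X → ℂ, Complex.exp (-∑ x, (1 + d x * Complex.I) * (‖(P *ᵥ φ) x‖ : ℂ) ^ 2)) =
      ∫ ψ, g ψ ∂(Measure.map (e : (X → ℂ) →ₗ[ℝ] (X → ℂ)) volume) := h1.symm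
  rw [h2, hmap, integral_smul_measure]
  refine smul_ne_zero ?_ ?_
  · rw [ENNReal.toReal_ofReal (abs_nonneg _)]
    exact abs_ne_zero.2 (inv_ne_zero hdet)
  · have h3 : ∀ ψ, g ψ = ∏ x, Complex.exp (-(1 + d x * Complex.I) * (‖ψ x‖ : ℂ) ^ 2) := by
      intro ψ
      rw [hg, ← Complex.exp_sum]
      simp only [neg_mul, Finset.sum_neg_distrib]
    simp only [h3]
    rw [integral_fintype_prod_volume_eq_prod
      (fun x (z : ℂ) => Complex.exp (-(1 + d x * Complex.I) * (‖z‖ : ℂ) ^ 2)),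
      Finset.prod_ne_zero_iff]
    intro x _
    have hre : 0 < (1 + d x * Complex.I : ℂ).re := by simp
    rw [GaussianFourier.integral_cexp_neg_mul_sq_norm hre]
    have h0 : (1 + d x * Complex.I : ℂ) ≠ 0 := fun h => by simp [h] at hre
    rw [Complex.cpow_ne_zero_iff]
    left
    exact div_ne_zero (by exact_mod_cast Real.pi_ne_zero) h0

end Accretive

/-! ### The bosonic integral as a linear functional -/

section Boson
variable {E O X : Type*} [Fintype X] {B : Matrix X X ℂ}

/-- Polynomials in two sets of variables are spanned by products. -/
lemma MvPolynomial_linearMap_ext {Y M : Type*} [AddCommMonoid M] [Module ℂ M]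
    {f g : MvPolynomial (E ⊕ Y) ℂ →ₗ[ℂ] M}
    (h : ∀ a b, f (MvPolynomial.rename Sum.inl a * MvPolynomial.rename Sum.inr b) =
      g (MvPolynomial.rename Sum.inl a * MvPolynomial.rename Sum.inr b)) : f = g := by
  refine (MvPolynomial.basisMonomials (E ⊕ Y) ℂ).ext fun m => ?_
  have := h (MvPolynomial.monomial (Finsupp.sumFinsuppEquivProdFinsupp m).1 1)
    (MvPolynomial.monomial (Finsupp.sumFinsuppEquivProdFinsupp m).2 1)
  rw [MvPolynomial.rename_monomial, MvPolynomial.rename_monomial, MvPolynomial.monomial_mul,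
    one_mul] at this
  have h2 : Finsupp.mapDomain Sum.inl (Finsupp.sumFinsuppEquivProdFinsupp m).1 +
      Finsupp.mapDomain Sum.inr (Finsupp.sumFinsuppEquivProdFinsupp m).2 = m := by
    ext z
    rcases z with z | z
    · rw [Finsupp.add_apply, Finsupp.mapDomain_apply Sum.inl_injective,
        Finsupp.mapDomain_of_notMem_range _ _ (by simp)]
      simp
    · rw [Finsupp.add_apply, Finsupp.mapDomain_apply Sum.inr_injective,
        Finsupp.mapDomain_of_notMem_range _ _ (by simp)]
      simp
  rw [h2] at this
  simpa using this

/-- The bosonic integral on polynomials. -/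
def polyIntegral (E : Type*) (B : Matrix X X ℂ) :
    MvPolynomial (E ⊕ (X ⊕ X)) ℂ →ₗ[ℂ] MvPolynomial E ℂ :=
  (MvPolynomial.basisMonomials (E ⊕ (X ⊕ X)) ℂ).constr ℂ fun m =>
    gaussMoment B (Finsupp.sumFinsuppEquivProdFinsupp m).2 •
      MvPolynomial.monomial (Finsupp.sumFinsuppEquivProdFinsupp m).1 1

/-- The integral sees the field variables only and pulls out the others. By bilinearity this need be
checked on monomials only, on which the integral is defined. -/
lemma polyIntegral_mul (hB : IsCoercive B) (a : MvPolynomial E ℂ) (b : MvPolynomial (X ⊕ X) ℂ) :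
    polyIntegral E B (MvPolynomial.rename Sum.inl a * MvPolynomial.rename Sum.inr b) =
      gaussFunctional hB b • a := by
  have h1 : ((LinearMap.mul ℂ (MvPolynomial (E ⊕ (X ⊕ X)) ℂ)).compl₁₂
      (MvPolynomial.rename Sum.inl).toLinearMap (MvPolynomial.rename Sum.inr).toLinearMap).compr₂
        (polyIntegral E B) = ((LinearMap.lsmul ℂ (MvPolynomial E ℂ)).comp
        (gaussFunctional hB)).flip := by
    refine (MvPolynomial.basisMonomials _ ℂ).ext fun m => (MvPolynomial.basisMonomials _ ℂ).ext
      fun m' => ?_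
    have h2 : Finsupp.sumFinsuppEquivProdFinsupp
        (Finsupp.mapDomain Sum.inl m + Finsupp.mapDomain Sum.inr m') = (m, m') := by
      refine Prod.ext (Finsupp.ext fun z => ?_) (Finsupp.ext fun z => ?_)
      · rw [Finsupp.fst_sumFinsuppEquivProdFinsupp, Finsupp.add_apply,
          Finsupp.mapDomain_apply Sum.inl_injective, Finsupp.mapDomain_of_notMem_range _ _ (by simp),
          add_zero]
      · rw [Finsupp.snd_sumFinsuppEquivProdFinsupp, Finsupp.add_apply,
          Finsupp.mapDomain_apply Sum.inr_injective, Finsupp.mapDomain_of_notMem_range _ _ (by simp),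
          zero_add]
    simp only [LinearMap.compr₂_apply, LinearMap.compl₁₂_apply, MvPolynomial.coe_basisMonomials,
      AlgHom.toLinearMap_apply, MvPolynomial.rename_monomial, LinearMap.mul_apply',
      MvPolynomial.monomial_mul, one_mul, LinearMap.flip_apply, LinearMap.comp_apply,
      LinearMap.lsmul_apply, gaussFunctional_monomial]
    have h3 := (MvPolynomial.basisMonomials (E ⊕ (X ⊕ X)) ℂ).constr_basis ℂ (fun m =>
      gaussMoment B (Finsupp.sumFinsuppEquivProdFinsupp m).2 •
        MvPolynomial.monomial (Finsupp.sumFinsuppEquivProdFinsupp m).1 (1 : ℂ))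
        (Finsupp.mapDomain Sum.inl m + Finsupp.mapDomain Sum.inr m')
    rw [MvPolynomial.coe_basisMonomials] at h3
    simp only [h2] at h3
    exact h3
  exact LinearMap.congr_fun (LinearMap.congr_fun h1 a) b

lemma polyIntegral_rename_mul (hB : IsCoercive B) (a : MvPolynomial E ℂ)
    (p : MvPolynomial (E ⊕ (X ⊕ X)) ℂ) :
    polyIntegral E B (MvPolynomial.rename Sum.inl a * p) = a * polyIntegral E B p := by
  have : (polyIntegral E B).comp (LinearMap.mulLeft ℂ (MvPolynomial.rename Sum.inl a)) =
      (LinearMap.mulLeft ℂ a).comp (polyIntegral E B) := by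
    refine MvPolynomial_linearMap_ext fun c b => ?_
    rw [LinearMap.comp_apply, LinearMap.comp_apply, LinearMap.mulLeft_apply,
      LinearMap.mulLeft_apply, ← mul_assoc, ← map_mul, polyIntegral_mul hB, polyIntegral_mul hB,
      mul_smul_comm]
  exact LinearMap.congr_fun this p

lemma polyIntegral_pderiv (hB : IsCoercive B) (z : X ⊕ X) (p : MvPolynomial (E ⊕ (X ⊕ X)) ℂ) :
    polyIntegral E B (MvPolynomial.pderiv (.inr z) p) = polyIntegral E B
      (MvPolynomial.rename Sum.inr (MvPolynomial.pderiv z (quadPoly B)) * p) := by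
  have : (polyIntegral E B).comp (MvPolynomial.pderiv (.inr z)).toLinearMap =
      (polyIntegral E B).comp (LinearMap.mulLeft ℂ
        (MvPolynomial.rename Sum.inr (MvPolynomial.pderiv z (quadPoly B)))) := by
    refine MvPolynomial_linearMap_ext fun c b => ?_
    rw [LinearMap.comp_apply, LinearMap.comp_apply, LinearMap.mulLeft_apply, mul_left_comm,
      ← map_mul, polyIntegral_mul hB, ← gaussFunctional_pderiv hB, Derivation.coeFn_coe,
      Derivation.leibniz, MvPolynomial.pderiv_rename Sum.inr_injective,
      MvPolynomial.pderiv_eq_zero_of_notMem_vars (f := MvPolynomial.rename Sum.inl c), smul_zero,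
      add_zero, smul_eq_mul, polyIntegral_mul hB]
    classical
    intro h
    have := MvPolynomial.vars_rename _ _ h
    simp at this
  exact LinearMap.congr_fun this p

/-- The coefficients of the derivatives of `φ̄ B φ`. -/
def weightMatrix (B : Matrix X X ℂ) : Matrix (X ⊕ X) (X ⊕ X) ℂ := Matrix.fromBlocks 0 B.transpose B 0

lemma pderiv_quadPoly (z : X ⊕ X) : MvPolynomial.pderiv z (quadPoly B) =
    ∑ w, weightMatrix B z w • MvPolynomial.X w := by
  classical
  rcases z with z | z
  · simp [quadPoly, weightMatrix, MvPolynomial.pderiv_X, Pi.single_apply, MvPolynomial.smul_eq_C_mul]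
  · simp [quadPoly, weightMatrix, MvPolynomial.pderiv_X, Pi.single_apply, MvPolynomial.smul_eq_C_mul]

namespace SPoly

lemma bosonIntegral_smul (hB : IsCoercive B) (r : Even E O) (x : SPoly (E ⊕ (X ⊕ X)) O) :
    bosonIntegral B (r • x) = r • bosonIntegral B x := by
  rw [Even.smul_even, Even.smul_def]
  refine (rTensor_inclEven_mul (polyIntegral E B) (AlgHom.id ℂ _)
    (fun y p => polyIntegral_rename_mul hB y p) r.val x).trans ?_
  rw [Algebra.TensorProduct.map_id]
  rfl

/-- The bosonic integral, linear over even elements. -/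
def bosonFunctional (E O : Type*) (hB : IsCoercive B) :
    SPoly (E ⊕ (X ⊕ X)) O →ₗ[Even E O] SPoly E O where
  toFun := bosonIntegral (E := E) (O := O) B
  map_add' := by intro x y; rw [map_add]
  map_smul' := bosonIntegral_smul hB

lemma bosonIntegral_one (hB : IsCoercive B) :
    bosonIntegral B (1 : SPoly (E ⊕ (X ⊕ X)) O) =
      algebraMap ℂ (SPoly E O) (gaussFunctional hB 1) := by
  change polyIntegral E B 1 ⊗ₜ 1 = _
  have := polyIntegral_mul (E := E) hB 1 1
  rw [map_one, map_one, mul_one] at this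
  rw [this, Algebra.TensorProduct.algebraMap_apply, Algebra.algebraMap_eq_smul_one]

lemma bosonIntegral_tmul (f : MvPolynomial (E ⊕ (X ⊕ X)) ℂ) (g : Gr O) :
    bosonIntegral B (f ⊗ₜ[ℂ] g) = polyIntegral E B f ⊗ₜ[ℂ] g := rfl

lemma bosonIntegral_pderiv (hB : IsCoercive B) (z : X ⊕ X) (x : SPoly (E ⊕ (X ⊕ X)) O) :
    bosonIntegral B (LinearMap.rTensor (Gr O) (MvPolynomial.pderiv (.inr z)).toLinearMap x) =
      ∑ w, weightMatrix B z w • bosonIntegral B (evenVar (.inr w) * x) := by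
  induction x using TensorProduct.induction_on with
  | zero => simp only [mul_zero, map_zero, smul_zero, Finset.sum_const_zero]
  | tmul f g =>
    have h : ∀ w : X ⊕ X, (evenVar (.inr w) * f ⊗ₜ[ℂ] g : SPoly (E ⊕ (X ⊕ X)) O) =
        (MvPolynomial.X (.inr w) * f) ⊗ₜ[ℂ] g := fun w => by
      rw [evenVar, Algebra.TensorProduct.tmul_mul_tmul, one_mul]
    rw [LinearMap.rTensor_tmul, bosonIntegral_tmul, Derivation.coeFn_coe,
      polyIntegral_pderiv hB, pderiv_quadPoly]
    simp only [h, bosonIntegral_tmul, TensorProduct.smul_tmul', ← TensorProduct.sum_tmul, map_sum, map_smul,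
      MvPolynomial.rename_X, Finset.sum_mul, smul_mul_assoc]
  | add x y h1 h2 => simp only [mul_add, map_add, h1, h2, smul_add, Finset.sum_add_distrib]

end SPoly
end Boson

/-! ### Inverses of even kernels -/

/-- Modulo the nilradical the two determinants coincide, and a unit plus a nilpotent element is a
unit. -/
lemma Matrix_isUnit_of_isNilpotent_sub {S X : Type*} [CommRing S] [Fintype X] [DecidableEq X]
    {M N : Matrix X X S} (h : ∀ x y, IsNilpotent (M x y - N x y)) (hN : IsUnit N) : IsUnit M := by
  rw [Matrix.isUnit_iff_isUnit_det] at hN ⊢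
  have h1 : IsNilpotent (M.det - N.det) := by
    rw [← mem_nilradical, ← Ideal.Quotient.eq, RingHom.map_det, RingHom.map_det]
    congr 1
    ext x y
    exact Ideal.Quotient.eq.2 (mem_nilradical.2 (h x y))
  have := h1.isUnit_add_left_of_commute hN (Commute.all _ _)
  rwa [add_sub_cancel] at this

namespace Gr
variable {σ : Type*}

/-- The subalgebra of even elements of a Grassmann algebra. -/
def evenSubalgebra (σ : Type*) : Subalgebra ℂ (Gr σ) where
  carrier := part σ 0
  mul_mem' hx hy := by simpa using mul_mem hx hy
  add_mem' hx hy := add_mem hx hy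
  algebraMap_mem' r := algebraMap_mem r

instance : CommRing (evenSubalgebra σ) where
  __ := (evenSubalgebra σ).toRing
  mul_comm x y := Subtype.ext (commute_even x.2 y.1).eq

/-- Beyond the constants, an even element is built from terms that contain a product of two odd
vectors. Such a product is central, squares to zero and has no numerical part. -/
lemma isNilpotent_sub_body {x : Gr σ} (hx : x ∈ part σ 0) :
    IsNilpotent (x - algebraMap ℂ _ (ExteriorAlgebra.algebraMapInv x)) := by
  induction x, hx using part_induction_zero with
  | h0 r => simp
  | ha x y hx hy h1 h2 =>
    rw [map_add, map_add, add_sub_add_comm]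
    exact (commute_even (sub_mem hx (algebraMap_mem _)) _).isNilpotent_add h1 h2
  | hι a b x hx _ =>
    have h1 : ExteriorAlgebra.algebraMapInv (ExteriorAlgebra.ι ℂ a) = 0 := by
      simp [ExteriorAlgebra.algebraMapInv]
    rw [mul_assoc, map_mul, h1, zero_mul, map_zero, sub_zero, ← mul_assoc]
    refine (commute_ι_mul_ι a b x).isNilpotent_mul_right ⟨2, ?_⟩
    have h2 : ExteriorAlgebra.ι ℂ a * ExteriorAlgebra.ι ℂ a = 0 := ExteriorAlgebra.ι_sq_zero a
    rw [pow_two, mul_assoc, ← mul_assoc (ExteriorAlgebra.ι ℂ b), ι_mul_ι b a, neg_mul, mul_neg,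
      mul_assoc, ← mul_assoc, h2, zero_mul, neg_zero]

/-- Inverses of matrices with even entries have even entries. -/
lemma inverse_mem {X : Type*} [Fintype X] [DecidableEq X] {M G : Matrix X X (Gr σ)}
    (hM : ∀ x y, M x y ∈ part σ 0) (h : G * M = 1) (h' : M * G = 1) (x y : X) :
    G x y ∈ part σ 0 := by
  -- The grading involution fixes the entries of `M` and therefore maps an inverse of `M` to an
  -- inverse of `M`. By uniqueness it fixes `G`, and its fixed elements are the even ones.
  set α := (CliffordAlgebra.involute (Q := (0 : QuadraticForm ℂ (σ →₀ ℂ)))) with hα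
  have hMα : M.map α = M := by
    ext x y
    exact CliffordAlgebra.involute_eq_of_mem_even (hM x y)
  have hG : G.map α = G := by
    have h1 : M * G.map α = 1 := by
      have := congrArg (fun N : Matrix X X (Gr σ) => N.map α) h'
      simp only [Matrix.map_mul, hMα] at this
      rw [this, Matrix.map_one _ (map_zero _) (map_one _)]
    calc G.map α = G * M * G.map α := by rw [h, one_mul]
      _ = G := by rw [mul_assoc, h1, mul_one]
  have h2 : α (G x y) = G x y := congrFun (congrFun hG x) y
  have hc := CliffordAlgebra.evenOdd_isCompl (Q := (0 : QuadraticForm ℂ (σ →₀ ℂ)))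
  have hx : G x y ∈ (CliffordAlgebra.evenOdd (0 : QuadraticForm ℂ (σ →₀ ℂ)) 0) ⊔
      CliffordAlgebra.evenOdd 0 1 := by
    rw [hc.sup_eq_top]
    exact Submodule.mem_top
  obtain ⟨e, he, o, ho, heo⟩ := Submodule.mem_sup.1 hx
  have h3 := h2
  rw [← heo, map_add, hα, CliffordAlgebra.involute_eq_of_mem_even he,
    CliffordAlgebra.involute_eq_of_mem_odd ho, add_right_inj, neg_eq_iff_add_eq_zero,
    ← two_smul ℂ, smul_eq_zero] at h3
  rw [← heo, h3.resolve_left two_ne_zero, add_zero]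
  exact he

/-- Even elements form a commutative ring, so determinants are available there, and the matrix
differs from its numerical part by nilpotent entries. -/
lemma isUnit_of_isUnit_body {X : Type*} [Fintype X] [DecidableEq X] {M : Matrix X X (Gr σ)}
    (hM : ∀ x y, M x y ∈ part σ 0) (h : IsUnit (body M)) : IsUnit M := by
  let N : Matrix X X (evenSubalgebra σ) := Matrix.of fun x y => ⟨M x y, hM x y⟩
  have hN : IsUnit N := by
    refine Matrix_isUnit_of_isNilpotent_sub (N := (algebraMap ℂ _).mapMatrix (body M)) ?_
      (h.map (algebraMap ℂ (evenSubalgebra σ)).mapMatrix)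
    intro x y
    refine (IsNilpotent.map_iff (f := (evenSubalgebra σ).val) Subtype.val_injective).1 ?_
    exact isNilpotent_sub_body (hM x y)
  exact hN.map (evenSubalgebra σ).val.toRingHom.mapMatrix

end Gr

/-! ### Normalization, nilpotency and two-point functions of Gaussian functionals. -/

namespace FieldCalculus

variable {E F R Y : Type*} [CommRing E] [Ring F] [Ring R] [Algebra E F] [Algebra E R]
  [DecidableEq Y] [Fintype Y] (𝓕 : FieldCalculus E F Y) {G : Matrix Y Y E} {L : F →ₗ[E] R}

lemma quad_neg (c : Matrix Y Y E) : 𝓕.quad (-c) = -𝓕.quad c := by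
  simp [quad]

lemma quad_mem (c : Matrix Y Y E) : 𝓕.quad c ∈ Algebra.adjoin E (Set.range 𝓕.Φ) :=
  sum_mem fun x _ => sum_mem fun y _ => Subalgebra.smul_mem _ (mul_mem
    (Algebra.subset_adjoin (Set.mem_range_self x)) (Algebra.subset_adjoin (Set.mem_range_self y))) _

/-- The weighted expectation of t exp(q) is the unweighted one of t, since the exponentials cancel.
It is also a multiple of `L 1`; if it is a unit, then so is `L 1`. -/
lemma isUnit_one_of_weight [Algebra ℂ E] [Algebra ℂ F] [IsScalarTower ℂ E F] (L₀ : F →ₗ[E] R) (c : Matrix Y Y E) (hc : IsNilpotent (𝓕.quad c))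
    (h : 𝓕.IsGaussian L G) (hL : ∀ f, L f = L₀ (f * nilExp (𝓕.quad (-c)))) {t : F}
    (ht : t ∈ Algebra.adjoin E (Set.range 𝓕.Φ)) (hu : IsUnit (L₀ t)) : IsUnit (L 1) := by
  have hm : nilExp (𝓕.quad c) ∈ Algebra.adjoin E (Set.range 𝓕.Φ) := by
    refine sum_mem fun m _ => ?_
    rw [← algebraMap_smul E]
    exact Subalgebra.smul_mem _ (pow_mem (𝓕.quad_mem c) m) _
  obtain ⟨z, hz⟩ := h.exists_smul (mul_mem ht hm)
  rw [hL, quad_neg, mul_assoc, nilExp_mul_nilExp_neg hc, mul_one] at hz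
  rw [hz, Algebra.smul_def] at hu
  exact ((show Commute (algebraMap E R z) (L 1) from Algebra.commutes z (L 1)).isUnit_mul_iff.1 hu).2

lemma isNilpotent_quad (c : Matrix Y Y E)
    (h : ∀ x y, IsNilpotent (c x y • (𝓕.Φ x * 𝓕.Φ y))) : IsNilpotent (𝓕.quad c) := by
  have h2 : ∀ x y z w, Commute (c x y • (𝓕.Φ x * 𝓕.Φ y)) (c z w • (𝓕.Φ z * 𝓕.Φ w)) := by
    intro x y z w
    have h1 : ∀ z, Commute (𝓕.Φ x * 𝓕.Φ y) (𝓕.Φ z) := fun z => by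
      rw [Commute, SemiconjBy, mul_assoc, 𝓕.comm y z, mul_smul_comm, ← mul_assoc, 𝓕.comm x z,
        smul_mul_assoc, smul_smul, 𝓕.ε_sq, one_smul, mul_assoc]
    exact (((h1 z).mul_right (h1 w)).smul_left _).smul_right _
  rw [quad, ← Finset.univ.sum_product' Finset.univ fun x y => c x y • (𝓕.Φ x * 𝓕.Φ y)]
  exact Commute.isNilpotent_sum (fun p _ => h p.1 p.2) fun p q _ _ => h2 _ _ _ _

lemma quad_fromBlocks {X : Type*} [DecidableEq X] [Fintype X] (𝓕 : FieldCalculus E F (X ⊕ X))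
    (a b c d : Matrix X X E) : 𝓕.quad (Matrix.fromBlocks a b c d) =
      ∑ x, ∑ y, (a x y • (𝓕.Φ (.inl x) * 𝓕.Φ (.inl y)) + b x y • (𝓕.Φ (.inl x) * 𝓕.Φ (.inr y)) +
        c x y • (𝓕.Φ (.inr x) * 𝓕.Φ (.inl y)) + d x y • (𝓕.Φ (.inr x) * 𝓕.Φ (.inr y))) := by
  simp only [quad, Fintype.sum_sum_type, Matrix.fromBlocks_apply₁₁, Matrix.fromBlocks_apply₁₂,
    Matrix.fromBlocks_apply₂₁, Matrix.fromBlocks_apply₂₂, ← Finset.sum_add_distrib]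
  simp only [add_assoc]

lemma quad_corner {X : Type*} [DecidableEq X] [Fintype X] (𝓕 : FieldCalculus E F (X ⊕ X))
    (c : Matrix X X E) : 𝓕.quad (Matrix.fromBlocks 0 0 c 0) =
      ∑ x, ∑ y, c x y • (𝓕.Φ (.inr x) * 𝓕.Φ (.inl y)) := by
  simp [quad_fromBlocks]

lemma isNilpotent_quad_of_sq (h : ∀ x, 𝓕.Φ x * 𝓕.Φ x = 0) (c : Matrix Y Y E) :
    IsNilpotent (𝓕.quad c) := by
  refine 𝓕.isNilpotent_quad c fun x y => ⟨2, ?_⟩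
  rw [smul_pow, pow_two (𝓕.Φ x * _), mul_assoc, ← mul_assoc _ (𝓕.Φ x), 𝓕.comm y x,
    smul_mul_assoc, mul_smul_comm, mul_assoc, ← mul_assoc, h, zero_mul, smul_zero, smul_zero]

lemma quad_mem_of_forall {M : Type*} [SetLike M F] [AddSubmonoidClass M F] (S : M)
    (c : Matrix Y Y E) (h : ∀ x y, c x y • (𝓕.Φ x * 𝓕.Φ y) ∈ S) : 𝓕.quad c ∈ S :=
  sum_mem fun x _ => sum_mem fun y _ => h x y

lemma isNilpotent_quad_of_coeff (c : Matrix Y Y E) (h : ∀ x y, IsNilpotent (c x y)) :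
    IsNilpotent (𝓕.quad c) := by
  refine 𝓕.isNilpotent_quad c fun x y => ?_
  obtain ⟨n, hn⟩ := h x y
  exact ⟨n, by rw [smul_pow, hn, zero_smul]⟩

lemma IsGaussian.two_point {𝓕 : FieldCalculus E F Y} (h : 𝓕.IsGaussian L G) (x y : Y) :
    L (𝓕.Φ x * 𝓕.Φ y) = G x y • L 1 := by
  have h1 : ∀ z, 𝓕.d z (𝓕.Φ y) = if y = z then 1 else 0 := fun z => by
    have := 𝓕.d_mul y z 1
    rwa [mul_one, 𝓕.d_one, mul_zero, smul_zero, add_zero] at this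
  rw [h]
  simp only [h1]
  rw [Finset.sum_eq_single y]
  · rw [if_pos rfl]
  · intro z _ hz
    rw [if_neg (Ne.symm hz), map_zero, smul_zero]
  · simp

end FieldCalculus

/-! ### The free theories are Gaussian -/

open SPoly

section Free
variable {P I A T : Type*} {N : ℕ}

lemma srcParam_mem {i : ZMod 2} {g : Gr P} (hg : g ∈ Gr.part P i) :
    srcParam P I T N g ∈ part (Lab N T I) (OddGen P N T I) i := ofGr_mem (Gr.inl_mem hg)

lemma boseParam_eq (g : Gr P) : boseParam P I A T N g =
    inclEven (Lab N T I) (OddGen P N T I) ((I × A) ⊕ (I × A)) (srcParam P I T N g) := by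
  rw [boseParam, srcParam, AlgHom.comp_apply, AlgHom.comp_apply, ofGr, ofGr,
    Algebra.TensorProduct.includeRight_apply, Algebra.TensorProduct.includeRight_apply,
    inclEven_tmul, map_one]

lemma fermiParam_eq (g : Gr P) : fermiParam P I A T N g =
    inclOdd (Lab N T I) (OddGen P N T I) ((I × A) ⊕ (I × A)) (srcParam P I T N g) := rfl

/-- Even parameters in the even part of the algebra of sources. -/
def evenParam (P I T : Type*) (N : ℕ) :
    Gr.evenSubalgebra P →ₐ[ℂ] Even (Lab N T I) (OddGen P N T I) :=
  ((srcParam P I T N).comp (Gr.evenSubalgebra P).val).codRestrict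
    (evenSubalgebra (Lab N T I) (OddGen P N T I)) fun x => srcParam_mem x.2

/-- A matrix with even entries. -/
def evenMatrix {X : Type*} (M : Matrix X X (Gr P)) (hM : ∀ x y, M x y ∈ Gr.part P 0) :
    Matrix X X (Gr.evenSubalgebra P) := Matrix.of fun x y => ⟨M x y, hM x y⟩

variable [Fintype I] [DecidableEq I] [Fintype A] [DecidableEq A] {st : Statistics}
  {Δ : Matrix (I × A) (I × A) (Gr P)}

lemma IsKernel.isUnit (hΔ : IsKernel st Δ) : IsUnit Δ := by
  cases st with
  | bose => exact Gr.isUnit_of_isUnit_body hΔ.1 (isUnit_of_accretive hΔ.2.2)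
  | fermi => exact hΔ.2.2

lemma IsKernel.inverse_mem (hΔ : IsKernel st Δ) (x y : I × A) :
    Ring.inverse Δ x y ∈ Gr.part P 0 :=
  Gr.inverse_mem hΔ.1 (Ring.inverse_mul_cancel _ hΔ.isUnit) (Ring.mul_inverse_cancel _ hΔ.isUnit) x y

/-- The kernel over the even part of the algebra of sources. -/
def IsKernel.lift (hΔ : IsKernel st Δ) (T : Type*) (N : ℕ) :
    Matrix (I × A) (I × A) (Even (Lab N T I) (OddGen P N T I)) :=
  (evenMatrix Δ hΔ.1).map (evenParam P I T N)

/-- The propagator over the even part of the algebra of sources. -/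
def IsKernel.prop (hΔ : IsKernel st Δ) (T : Type*) (N : ℕ) :
    Matrix (I × A) (I × A) (Even (Lab N T I) (OddGen P N T I)) :=
  (evenMatrix (Ring.inverse Δ) hΔ.inverse_mem).map (evenParam P I T N)

lemma IsKernel.val_lift (hΔ : IsKernel st Δ) (x y : I × A) :
    (hΔ.lift T N x y).val = srcParam P I T N (Δ x y) := rfl

lemma IsKernel.prop_mul_lift (hΔ : IsKernel st Δ) : hΔ.prop T N * hΔ.lift T N = 1 := by
  have h : evenMatrix (Ring.inverse Δ) hΔ.inverse_mem * evenMatrix Δ hΔ.1 = 1 := by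
    have h1 : Function.Injective fun M : Matrix (I × A) (I × A) (Gr.evenSubalgebra P) =>
      M.map (Gr.evenSubalgebra P).val := Matrix.map_injective Subtype.val_injective
    apply h1
    simp only [Matrix.map_mul]
    rw [Matrix.map_one _ (map_zero _) (map_one _)]
    exact Ring.inverse_mul_cancel _ hΔ.isUnit
  rw [IsKernel.prop, IsKernel.lift, ← Matrix.map_mul, h, Matrix.map_one _ (map_zero _) (map_one _)]

lemma IsKernel.lift_transpose (hΔ : IsKernel st Δ) :
    (hΔ.lift T N).transpose = st.sign • hΔ.lift T N := by
  ext x y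
  refine Even.val_injective ?_
  rw [Matrix.smul_apply, map_smul, Matrix.transpose_apply, hΔ.val_lift, hΔ.val_lift, ← map_smul]
  exact congrArg _ (congrFun (congrFun hΔ.2.1 x) y)

lemma Statistics.sign_mul_self (st : Statistics) : st.sign * st.sign = 1 := by
  cases st <;> simp [Statistics.sign]

/-- The propagator of `φ`, `φ̄`. -/
def IsKernel.propagator (hΔ : IsKernel st Δ) (T : Type*) (N : ℕ) :
    Matrix ((I × A) ⊕ (I × A)) ((I × A) ⊕ (I × A)) (Even (Lab N T I) (OddGen P N T I)) :=
  Matrix.fromBlocks 0 (hΔ.prop T N) (hΔ.prop T N) 0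

lemma IsKernel.propagator_mul (hΔ : IsKernel st Δ) : hΔ.propagator T N *
    Matrix.fromBlocks 0 (hΔ.lift T N) (hΔ.lift T N) 0 = 1 := by
  rw [IsKernel.propagator, Matrix.fromBlocks_multiply]
  simp [hΔ.prop_mul_lift]

/-! ### Fermionic fields. -/

section Fermi

lemma fermi_quadratic (hΔ : IsKernel .fermi Δ) :
    quadratic (fermiParam P I A T N) Δ (fun x => oddVar (.inr (.inl x)))
      (fun x => oddVar (.inr (.inr x))) =
    (oddCalculus (Lab N T I) (OddGen P N T I) ((I × A) ⊕ (I × A))).quad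
      (Matrix.fromBlocks 0 0 (hΔ.lift T N) 0) := by
  rw [FieldCalculus.quad_corner, quadratic]
  refine Finset.sum_congr rfl fun x _ => Finset.sum_congr rfl fun y _ => ?_
  rw [Even.smul_odd, hΔ.val_lift, ← fermiParam_eq, ← mul_assoc]
  congr 1
  exact (commute_even (by rw [fermiParam_eq]; exact inclOdd_mem (srcParam_mem (hΔ.1 x y))) _).eq.symm

/-- The fermionic integral with its Gaussian weight. -/
def fermiGaussian (T : Type*) (N : ℕ) (Δ : Matrix (I × A) (I × A) (Gr P)) :
    FermiAlg P I A T N →ₗ[Even (Lab N T I) (OddGen P N T I)] SrcAlg P N T I :=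
  fermionFunctional (Lab N T I) (OddGen P N T I) (I × A) ∘ₗ LinearMap.mulRight _
    (nilExp (-quadratic (fermiParam P I A T N) Δ
    (fun x => oddVar (.inr (.inl x))) (fun x => oddVar (.inr (.inr x)))))

lemma fermiGaussian_apply (f : FermiAlg P I A T N) :
    fermiGaussian T N Δ f = fermiIntegral T N Δ f := rfl

lemma fermi_isNilpotent (c : Matrix ((I × A) ⊕ (I × A)) ((I × A) ⊕ (I × A))
    (Even (Lab N T I) (OddGen P N T I))) : IsNilpotent
    ((oddCalculus (Lab N T I) (OddGen P N T I) ((I × A) ⊕ (I × A))).quad c) := by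
  refine FieldCalculus.isNilpotent_quad_of_sq _ (fun x => ?_) c
  change (oddVar (.inr x) * oddVar (.inr x) : FermiAlg P I A T N) = 0
  rw [oddVar, ← map_mul, Gr.gen, ExteriorAlgebra.ι_sq_zero, map_zero]

lemma even_commute_nilExp {E O : Type*} {x : SPoly E O} (hx : x ∈ part E O 0) (f : SPoly E O) :
    Commute (nilExp x) f :=
  Commute.sum_left _ _ _ fun _ _ => ((commute_even hx f).pow_left _).smul_left _

/-- The unweighted Berezin integral kills derivatives, so `D₀ = 0` and the kernel comes from the
weight alone. Antisymmetrizing the corner block and using Δᵀ = -Δ puts Δ into both off-diagonal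
blocks, and the propagator inverts this matrix. -/
lemma fermi_isGaussian (hΔ : IsKernel .fermi Δ) :
    (oddCalculus (Lab N T I) (OddGen P N T I) ((I × A) ⊕ (I × A))).IsGaussian
      (fermiGaussian T N Δ) (hΔ.propagator T N) := by
  refine FieldCalculus.isGaussian_weight (fermionFunctional _ _ _) 0
    (Matrix.fromBlocks 0 0 (hΔ.lift T N) 0) (fermi_isNilpotent _) ?_ ?_ ?_ ?_
  · refine fun f => even_commute_nilExp ?_ f
    refine FieldCalculus.quad_mem_of_forall _ _ _ fun x y => ?_
    rw [Even.smul_odd]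
    have := SPoly.mul_mem (inclOdd_mem (Y := (I × A) ⊕ (I × A)) (Even.val_mem
      ((-Matrix.fromBlocks 0 0 (hΔ.lift T N) 0 : Matrix _ _ (Even (Lab N T I) (OddGen P N T I))) x y)))
      (SPoly.mul_mem (oddVar_mem (E := Lab N T I) (Sum.inr x : OddGen P N T I ⊕ _))
        (oddVar_mem (Sum.inr y)))
    exact this
  · intro y f
    refine (fermionIntegral_deriv y f).trans (Finset.sum_eq_zero fun z _ => ?_).symm
    exact zero_smul (Even (Lab N T I) (OddGen P N T I)) (_ : SrcAlg P N T I)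
  · rw [zero_add, FieldCalculus.symmetrize, Matrix.fromBlocks_transpose, hΔ.lift_transpose]
    have : (oddCalculus (Lab N T I) (OddGen P N T I) ((I × A) ⊕ (I × A))).ε = -1 := rfl
    rw [this, Matrix.fromBlocks_smul, Matrix.fromBlocks_add]
    simpa [Statistics.sign] using hΔ.propagator_mul
  · intro f
    rw [FieldCalculus.quad_neg, ← fermi_quadratic]
    rfl

/-- The test element is the product of all fields, whose unweighted integral is 1. -/
lemma fermi_isUnit_vacuum (hΔ : IsKernel .fermi Δ) : IsUnit (fermiGaussian T N Δ 1) := by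
  refine FieldCalculus.isUnit_one_of_weight _ (fermionFunctional _ _ _)
    (Matrix.fromBlocks 0 0 (hΔ.lift T N) 0) (fermi_isNilpotent _) (fermi_isGaussian hΔ) ?_
    oddTop_mem ?_
  · intro f
    rw [FieldCalculus.quad_neg, ← fermi_quadratic]
    rfl
  · have : fermionFunctional (Lab N T I) (OddGen P N T I) (I × A) (oddTop _ _ _) = 1 :=
      fermionIntegral_top
    rw [this]
    exact isUnit_one

end Fermi

/-! ### Bosonic fields. -/

section Bose

/-- The numerical part of the kernel over the even part of the algebra of sources. -/
def IsKernel.liftBody (_ : IsKernel st Δ) (T : Type*) (N : ℕ) :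
    Matrix (I × A) (I × A) (Even (Lab N T I) (OddGen P N T I)) :=
  (body Δ).map (algebraMap ℂ _)

lemma bose_quadratic (hΔ : IsKernel .bose Δ) :
    quadratic (boseParam P I A T N) (Δ - (body Δ).map (algebraMap ℂ (Gr P)))
      (fun x => evenVar (.inr (.inl x))) (fun x => evenVar (.inr (.inr x))) =
    (evenCalculus (Lab N T I) (OddGen P N T I) ((I × A) ⊕ (I × A))).quad
      (Matrix.fromBlocks 0 0 (hΔ.lift T N - hΔ.liftBody T N) 0) := by
  rw [FieldCalculus.quad_corner, quadratic]
  refine Finset.sum_congr rfl fun x _ => Finset.sum_congr rfl fun y _ => ?_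
  have h : ((hΔ.lift T N - hΔ.liftBody T N) x y).val = srcParam P I T N
      ((Δ - (body Δ).map (algebraMap ℂ (Gr P))) x y) := by
    rw [Matrix.sub_apply, Matrix.sub_apply, map_sub, map_sub, hΔ.val_lift, IsKernel.liftBody,
      Matrix.map_apply, Matrix.map_apply, AlgHom.commutes, AlgHom.commutes]
  rw [Even.smul_even, h, ← boseParam_eq, ← mul_assoc]
  congr 1
  exact (commute_even (evenVar_mem _) _).eq

/-- The bosonic integral with its Gaussian weight. -/
def boseGaussian (T : Type*) (N : ℕ) (hΔ : IsKernel .bose Δ) :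
    BoseAlg P I A T N →ₗ[Even (Lab N T I) (OddGen P N T I)] SrcAlg P N T I :=
  bosonFunctional (Lab N T I) (OddGen P N T I) (isCoercive_of_accretive hΔ.2.2) ∘ₗ
    LinearMap.mulRight _ (nilExp (-quadratic (boseParam P I A T N)
      (Δ - (body Δ).map (algebraMap ℂ (Gr P)))
      (fun x => evenVar (.inr (.inl x))) (fun x => evenVar (.inr (.inr x)))))

lemma boseGaussian_apply (hΔ : IsKernel .bose Δ) (f : BoseAlg P I A T N) :
    boseGaussian T N hΔ f = boseIntegral T N Δ f := rfl

lemma bose_isNilpotent (hΔ : IsKernel .bose Δ) : IsNilpotent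
    ((evenCalculus (Lab N T I) (OddGen P N T I) ((I × A) ⊕ (I × A))).quad
      (Matrix.fromBlocks 0 0 (hΔ.lift T N - hΔ.liftBody T N) 0)) := by
  have h : ∀ x y, IsNilpotent ((hΔ.lift T N - hΔ.liftBody T N) x y) := by
    intro x y
    have h1 := Gr.isNilpotent_sub_body (hΔ.1 x y)
    have h2 : (hΔ.lift T N - hΔ.liftBody T N) x y = evenParam P I T N
        (⟨Δ x y, hΔ.1 x y⟩ - algebraMap ℂ _ (body Δ x y)) := by
      rw [map_sub, AlgHom.commutes]
      rfl
    rw [h2]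
    refine IsNilpotent.map ?_ _
    refine (IsNilpotent.map_iff (f := (Gr.evenSubalgebra P).val) Subtype.val_injective).1 ?_
    exact h1
  refine FieldCalculus.isNilpotent_quad_of_coeff _ _ fun x y => ?_
  rcases x with x | x <;> rcases y with y | y
  · exact IsNilpotent.zero
  · exact IsNilpotent.zero
  · exact h x y
  · exact IsNilpotent.zero

/-- The numerical part B enters `D₀` through integration by parts in the convergent integral, the
nilpotent rest Δ - B through the weight. Only their sum Δ, symmetric by hypothesis, has to be
inverted. -/
lemma bose_isGaussian (hΔ : IsKernel .bose Δ) :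
    (evenCalculus (Lab N T I) (OddGen P N T I) ((I × A) ⊕ (I × A))).IsGaussian
      (boseGaussian T N hΔ) (hΔ.propagator T N) := by
  refine FieldCalculus.isGaussian_weight (bosonFunctional _ _ (isCoercive_of_accretive hΔ.2.2))
    ((weightMatrix (body Δ)).map (algebraMap ℂ _))
    (Matrix.fromBlocks 0 0 (hΔ.lift T N - hΔ.liftBody T N) 0) ?_ ?_ ?_ ?_ ?_
  · rw [FieldCalculus.quad_neg]
    exact (bose_isNilpotent hΔ).neg
  · refine fun f => even_commute_nilExp ?_ f
    refine FieldCalculus.quad_mem_of_forall _ _ _ fun x y => ?_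
    rw [Even.smul_even]
    have := SPoly.mul_mem (inclEven_mem (Y := (I × A) ⊕ (I × A)) (Even.val_mem
      ((-Matrix.fromBlocks 0 0 (hΔ.lift T N - hΔ.liftBody T N) 0 :
        Matrix _ _ (Even (Lab N T I) (OddGen P N T I))) x y)))
      (SPoly.mul_mem (evenVar_mem (O := OddGen P N T I) (Sum.inr x : Lab N T I ⊕ _))
        (evenVar_mem (Sum.inr y)))
    exact this
  · intro y f
    refine (bosonIntegral_pderiv (isCoercive_of_accretive hΔ.2.2) y f).trans ?_
    refine Finset.sum_congr rfl fun w _ => ?_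
    exact (algebraMap_smul (Even (Lab N T I) (OddGen P N T I)) (weightMatrix (body Δ) y w)
      (_ : SrcAlg P N T I)).symm
  · rw [FieldCalculus.symmetrize, Matrix.fromBlocks_transpose, weightMatrix, Matrix.fromBlocks_map,
      Matrix.transpose_sub, hΔ.lift_transpose]
    have : (evenCalculus (Lab N T I) (OddGen P N T I) ((I × A) ⊕ (I × A))).ε = 1 := rfl
    rw [this, one_smul, Matrix.fromBlocks_add, Matrix.fromBlocks_add]
    have h2 : (body Δ).transpose.map (algebraMap ℂ (Even (Lab N T I) (OddGen P N T I))) =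
        (hΔ.liftBody T N).transpose := rfl
    have h3 : (body Δ).map (algebraMap ℂ (Even (Lab N T I) (OddGen P N T I))) =
        hΔ.liftBody T N := rfl
    rw [h2, h3]
    simpa [Statistics.sign] using hΔ.propagator_mul
  · intro f
    rw [FieldCalculus.quad_neg, ← bose_quadratic]
    rfl

/-- The test element is 1, whose integral against the numerical Gaussian weight is a nonzero number.
-/
lemma bose_isUnit_vacuum (hΔ : IsKernel .bose Δ) : IsUnit (boseGaussian T N hΔ 1) := by
  have hB := isCoercive_of_accretive hΔ.2.2
  refine FieldCalculus.isUnit_one_of_weight _ (bosonFunctional _ _ hB)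
    (Matrix.fromBlocks 0 0 (hΔ.lift T N - hΔ.liftBody T N) 0) (bose_isNilpotent hΔ)
    (bose_isGaussian hΔ) (t := 1) ?_ (one_mem _) ?_
  · intro f
    rw [FieldCalculus.quad_neg, ← bose_quadratic]
    rfl
  · have : bosonFunctional (Lab N T I) (OddGen P N T I) hB 1 = algebraMap ℂ _ (gaussFunctional hB 1) :=
      bosonIntegral_one hB
    rw [this]
    exact (isUnit_iff_ne_zero.2 (gaussFunctional_one_ne_zero hΔ.2.2 hB)).map (algebraMap ℂ _)

end Bose

/-! ### Free theories of either statistics. -/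

variable [Fintype T]

theorem IsKernel.isUnit_vacuum (hΔ : IsKernel st Δ) : IsUnit (vacuum T N st Δ) := by
  cases st with
  | bose => exact bose_isUnit_vacuum hΔ
  | fermi => exact fermi_isUnit_vacuum hΔ

theorem IsKernel.twoPoint_eq (hΔ : IsKernel st Δ) (x y : I × A) :
    twoPoint T N st Δ x y = vacuum T N st Δ * srcParam P I T N (Ring.inverse Δ x y) := by
  rw [← (commute_even (srcParam_mem (hΔ.inverse_mem x y)) (vacuum T N st Δ)).eq]
  cases st with
  | bose => exact (bose_isGaussian hΔ).two_point (Sum.inl x) (Sum.inr y)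
  | fermi => exact (fermi_isGaussian hΔ).two_point (Sum.inl x) (Sum.inr y)

/-- The connected functional for a source term with the symmetrized coefficients `S`. -/
theorem IsKernel.coeff_connectedFunctional (hΔ : IsKernel st Δ) {D : OperatorData P I A T}
    (c : Matrix ((I × A) ⊕ (I × A)) ((I × A) ⊕ (I × A)) (Even (Lab N T I) (OddGen P N T I)))
    (hb : st = .bose → boseSource N D =
      (evenCalculus (Lab N T I) (OddGen P N T I) ((I × A) ⊕ (I × A))).quad c)
    (hf : st = .fermi → fermiSource N D =
      (oddCalculus (Lab N T I) (OddGen P N T I) ((I × A) ⊕ (I × A))).quad c) (m : ℕ) :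
    PowerSeries.coeff m (connectedFunctional N D st Δ) = (st.sign / (2 * m)) •
      (((hΔ.propagator T N * (c + st.sign • c.transpose)) ^ m).trace).val := by
  cases st with
  | bose =>
    rw [connectedFunctional, partitionFunction, hb rfl]
    refine ((bose_isGaussian hΔ).coeff_seriesLog (boseIntegral T N Δ) (boseGaussian_apply hΔ)
      (bose_isUnit_vacuum hΔ) c m).trans ?_
    have h1 : (evenCalculus (Lab N T I) (OddGen P N T I) ((I × A) ⊕ (I × A))).ε = 1 := rfl
    rw [FieldCalculus.symmetrize, h1, one_mul, one_smul, Statistics.sign, one_smul, one_div]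
    rfl
  | fermi =>
    rw [connectedFunctional, partitionFunction, hf rfl]
    refine ((fermi_isGaussian hΔ).coeff_seriesLog (fermiIntegral T N Δ) fermiGaussian_apply
      (fermi_isUnit_vacuum hΔ) c m).trans ?_
    have h1 : (oddCalculus (Lab N T I) (OddGen P N T I) ((I × A) ⊕ (I × A))).ε = -1 := rfl
    rw [FieldCalculus.symmetrize, h1, neg_one_mul, neg_one_smul, Statistics.sign, neg_one_smul,
      neg_div, one_div, map_neg, smul_neg]
    exact (neg_smul ((2 * m : ℂ)⁻¹) _).symm

end Free

/-! ### Supertraces in supercommutative algebras -/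

/-- The even and odd parts of a supercommutative algebra. -/
structure IsSupercommutative {R : Type*} [Ring R] [Algebra ℂ R]
    (part : ZMod 2 → Submodule ℂ R) : Prop where
  one_mem : 1 ∈ part 0
  mul_mem : ∀ {i j x y}, x ∈ part i → y ∈ part j → x * y ∈ part (i + j)
  mul_comm : ∀ {m n : ℕ} {x y : R}, x ∈ part m → y ∈ part n →
    x * y = (-1 : ℂ) ^ (m * n) • (y * x)

lemma neg_one_pow_mul_eq_smul {R : Type*} [Ring R] [Algebra ℂ R] (k : ℕ) (x : R) :
    (-1) ^ k * x = (-1 : ℂ) ^ k • x := by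
  rw [Algebra.smul_def]
  simp

lemma SPoly.isSupercommutative (E O : Type*) : IsSupercommutative (SPoly.part E O) where
  one_mem := by
    have := SPoly.algebraMap_mem (E := E) (O := O) 1
    rwa [map_one] at this
  mul_mem := SPoly.mul_mem
  mul_comm hx hy := (SPoly.mul_comm_of_mem hx hy).trans (neg_one_pow_mul_eq_smul _ _)

section Super
variable {R : Type*} [Ring R] [Algebra ℂ R] {part : ZMod 2 → Submodule ℂ R}

variable {N : ℕ} {I A Z : Type*} [Fintype I] [Fintype A] [DecidableEq I] [DecidableEq A] [Fintype Z]
  [DecidableEq Z]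

/-- The parity `n - k` of an index. -/
def SIndex.parity (x : SIndex N I A) : ℕ := (x.1.1.1 : ℕ) - (x.1.1.2 : ℕ)

lemma superTrace_eq (K : Matrix (SIndex N I A) (SIndex N I A) R) :
    superTrace K = ∑ x : SIndex N I A, (-1 : ℂ) ^ x.parity • K x x := by
  simp only [superTrace, Fintype.sum_prod_type, Finset.mul_sum, SIndex.parity]
  refine Finset.sum_congr rfl fun p _ => Finset.sum_congr rfl fun i _ =>
    Finset.sum_congr rfl fun a _ => Finset.sum_congr rfl fun c _ => ?_
  rw [Algebra.smul_def]
  simp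

/-- The cyclicity of the supertrace. -/
lemma superTrace_mul (h : IsSupercommutative part) (V : Matrix (SIndex N I A) Z R)
    (W : Matrix Z (SIndex N I A) R) (hV : ∀ x z, V x z ∈ part (x.parity : ZMod 2))
    (hW : ∀ z x, W z x ∈ part (x.parity : ZMod 2)) : superTrace (V * W) = (W * V).trace := by
  rw [superTrace_eq]
  simp only [Matrix.mul_apply, Matrix.trace, Matrix.diag, Finset.smul_sum]
  rw [Finset.sum_comm]
  refine Finset.sum_congr rfl fun z _ => Finset.sum_congr rfl fun x _ => ?_
  -- Exchanging two entries of the same parity p costs (-1)^(p·p), which cancels the weight (-1)^p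
  -- of the supertrace because p + p² is even.
  rw [h.mul_comm (hV x z) (hW z x), smul_smul, ← pow_add]
  have : Even (x.parity + x.parity * x.parity) := by
    rw [add_comm, ← Nat.mul_succ]
    exact Nat.even_mul_succ_self x.parity
  rw [this.neg_one_pow, one_smul]

/-- Write (V W)^(m+1) as V times (W V)^m W. Since W V has even entries, the second factor has the
parities of W, and one application of cyclicity suffices. -/
lemma superTrace_mul_pow (h : IsSupercommutative part) (V : Matrix (SIndex N I A) Z R)
    (W : Matrix Z (SIndex N I A) R) (hV : ∀ x z, V x z ∈ part (x.parity : ZMod 2))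
    (hW : ∀ z x, W z x ∈ part (x.parity : ZMod 2)) (hWV : ∀ z z', (W * V) z z' ∈ part 0) (m : ℕ) :
    superTrace ((V * W) ^ (m + 1)) = ((W * V) ^ (m + 1)).trace := by
  have h1 : (V * W) ^ (m + 1) = V * ((W * V) ^ m * W) := by
    induction m with
    | zero => simp
    | succ m ih => rw [pow_succ, ih, pow_succ]; simp only [Matrix.mul_assoc]
  have h2 : ∀ (m : ℕ) (z z' : Z), ((W * V) ^ m : Matrix Z Z R) z z' ∈ part 0 := by
    intro m
    induction m with
    | zero =>
      intro z z'
      rw [pow_zero, Matrix.one_apply]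
      split_ifs
      · exact h.one_mem
      · exact zero_mem _
    | succ m ih =>
      intro z z'
      rw [pow_succ, Matrix.mul_apply]
      exact sum_mem fun w _ => by simpa using h.mul_mem (ih z w) (hWV w z')
  rw [h1, superTrace_mul h V _ hV, Matrix.mul_assoc, ← pow_succ]
  intro z x
  rw [Matrix.mul_apply]
  exact sum_mem fun w _ => by simpa using h.mul_mem (h2 m z w) (hW w x)

lemma superTrace_smul (r : ℂ) (K : Matrix (SIndex N I A) (SIndex N I A) R) :
    superTrace (r • K) = r • superTrace K := by
  simp only [superTrace_eq, Matrix.smul_apply, Finset.smul_sum, smul_comm r]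

lemma seriesLog_one_sub_X_mul_C {S : Type*} [Ring S] [Algebra ℂ S] (K : S) (m : ℕ) :
    PowerSeries.coeff m (seriesLog (1 - PowerSeries.X * PowerSeries.C K)) =
      (-(m : ℂ)⁻¹) • K ^ m := by
  have h1 : ∀ r, PowerSeries.coeff m
      ((1 - PowerSeries.X * PowerSeries.C K - 1 : PowerSeries S) ^ r) =
      if m = r then (-K) ^ r else 0 := by
    intro r
    have h2 : (1 - PowerSeries.X * PowerSeries.C K - 1 : PowerSeries S) =
        PowerSeries.C (-K) * PowerSeries.X := by
      rw [sub_right_comm, sub_self, zero_sub, PowerSeries.X_mul, map_neg, neg_mul]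
    rw [h2, (PowerSeries.commute_X _).mul_pow, ← map_pow, PowerSeries.coeff_C_mul_X_pow]
  simp only [seriesLog, PowerSeries.coeff_mk, h1, smul_ite, smul_zero]
  rw [Finset.sum_ite_eq]
  split_ifs with h
  · rw [neg_pow K, neg_one_pow_mul_eq_smul, smul_smul, div_mul_eq_mul_div, ← pow_add, add_right_comm,
      Odd.neg_one_pow (by exact Even.add_one ⟨m, rfl⟩)]
    congr 1
    rw [neg_div, one_div]
  -- At order zero the sum is empty, and the right-hand side vanishes because the inverse of 0 is 0.
  · have : m = 0 := by
      by_contra hm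
      exact h (Finset.mem_Icc.2 ⟨Nat.one_le_iff_ne_zero.2 hm, le_rfl⟩)
    simp [this]

lemma coeff_superTraceLog (K : Matrix (SIndex N I A) (SIndex N I A) R) (m : ℕ) :
    PowerSeries.coeff m (superTraceLog K) = (-(m : ℂ)⁻¹) • superTrace (K ^ m) := by
  rw [superTraceLog, PowerSeries.coeff_mk, seriesLog_one_sub_X_mul_C, superTrace_smul]

end Super

/-! ### The supermatrix as a product -/

lemma sum_fin_two_mul {M : Type*} [AddCommMonoid M] {N : ℕ} (f : Fin (2 * N) → M) :
    ∑ n, f n = ∑ n : Fin N, (f ⟨2 * n, by omega⟩ + f ⟨2 * n + 1, by omega⟩) := by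
  let e : Fin N × Fin 2 ≃ Fin (2 * N) := finProdFinEquiv.trans (finCongr (mul_comm _ _))
  rw [← e.sum_comp, Fintype.sum_prod_type]
  refine Finset.sum_congr rfl fun n _ => ?_
  rw [Fin.sum_univ_two]
  congr 2 <;> ext <;> simp [e, finProdFinEquiv, add_comm]

lemma sum_NK {M : Type*} [AddCommMonoid M] {N : ℕ} (f : NK N → M) :
    ∑ q, f q = ∑ n : Fin N, (∑ k : Fin (2 * n + 1), f ⟨⟨2 * n, by omega⟩, k⟩ +
      ∑ k : Fin (2 * n + 1 + 1), f ⟨⟨2 * n + 1, by omega⟩, k⟩) := by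
  rw [Fintype.sum_sigma, sum_fin_two_mul]

section Abstract
variable {P I A T R : Type*} {N : ℕ} [Ring R] [Algebra ℂ R]
  (D : OperatorData P I A T) (st : Statistics) (Δ : Matrix (I × A) (I × A) (Gr P))
  (c : Gr P →ₐ[ℂ] R) (JO JS JSbar : Lab N T I → R)

/-- The source part of the supermatrix, with the signs of the two statistics. -/
def OperatorData.srcBlock [Fintype T] (q : NK N) (j : I) (a b : A) : Matrix (Fin 2) (Fin 2) R :=
  let l (α : T) : Lab N T I := (⟨(q.1 : ℕ) / 2, by omega⟩, α, j)
  if Even (q.1 : ℕ) then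
    !![∑ α, (st.sign ^ (q.2 : ℕ) * D.t α a b) • JO (l α), 0;
      0, ∑ α, (st.sign ^ ((q.2 : ℕ) + 1) * (-1) ^ ((q.1 : ℕ) / 2 + D.τ α) * D.t α a b) • JO (l α)]
  else
    !![0, ∑ α, (2 * (-st.sign) ^ ((q.2 : ℕ) + 1) * D.t α a b) • JSbar (l α);
      ∑ α, (2 * (-st.sign) ^ ((q.2 : ℕ) + 1) * D.t α a b) • JS (l α), 0]

/-- The coefficients of the source term `∑ t^α ⊗ C_n J`. -/
def OperatorData.opForm [Fintype I] [Fintype T] (w : Fin N → T → ℂ) (p : ℕ) (J : Lab N T I → R) :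
    Matrix (I × A) (I × A) R :=
  Matrix.of fun x y => ∑ n : Fin N, ∑ α, ∑ i,
    (w n α * D.t α x.2 y.2) • (c (D.C st (2 * n + p) i x.1 y.1) * J (n, α, i))

/-- The coefficients of the source term, as seen by the supermatrix. -/
def OperatorData.srcForm [Fintype I] [Fintype T] :
    Matrix (Fin 2) (Fin 2) (Matrix (I × A) (I × A) R) :=
  !![D.opForm st c (fun _ _ => 1) 0 JO, D.opForm st c (fun _ _ => 2) 1 JSbar;
    D.opForm st c (fun _ _ => 2) 1 JS,
    D.opForm st c (fun n α => st.sign * (-1) ^ ((n : ℕ) + D.τ α)) 0 JO]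

lemma OperatorData.srcBlock_even [Fintype T] (n : Fin N) (k : Fin (2 * n + 1)) (j : I) (a b : A) :
    D.srcBlock st JO JS JSbar ⟨⟨2 * n, by omega⟩, k⟩ j a b =
      !![∑ α, (st.sign ^ (k : ℕ) * D.t α a b) • JO (n, α, j), 0;
      0, ∑ α, (st.sign ^ ((k : ℕ) + 1) * (-1) ^ (n + D.τ α) * D.t α a b) • JO (n, α, j)] := by
  have h : 2 * (n : ℕ) / 2 = n := by omega
  simp [OperatorData.srcBlock, h]

lemma OperatorData.srcBlock_odd [Fintype T] (n : Fin N) (k : Fin (2 * n + 1 + 1)) (j : I)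
    (a b : A) : D.srcBlock st JO JS JSbar ⟨⟨2 * n + 1, by omega⟩, k⟩ j a b =
      !![0, ∑ α, (2 * (-st.sign) ^ ((k : ℕ) + 1) * D.t α a b) • JSbar (n, α, j);
      ∑ α, (2 * (-st.sign) ^ ((k : ℕ) + 1) * D.t α a b) • JS (n, α, j), 0] := by
  have h : (2 * (n : ℕ) + 1) / 2 = n := by omega
  simp [OperatorData.srcBlock, h]

lemma Statistics.sign_pow_sub (st : Statistics) {n k : ℕ} (h : k ≤ n) :
    st.sign ^ (n - k) = st.sign ^ (n + k) := by
  have : n + k = (n - k) + 2 * k := by omega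
  rw [this, pow_add, pow_mul, pow_two, st.sign_mul_self, one_pow, mul_one]

variable {D st JO JS JSbar c} {part : ZMod 2 → Submodule ℂ R}

/-- The positions and types of the fields `φ`, `φ̄`. -/
def fieldSide {X : Type*} : Fin 2 → X → X ⊕ X := ![Sum.inl, Sum.inr]

/-- The position of a field. -/
def fieldPos {X : Type*} : X ⊕ X → X := Sum.elim id id

/-- The type of a field. -/
def fieldType {X : Type*} : X ⊕ X → Fin 2 := Sum.elim (fun _ => 0) fun _ => 1

lemma fieldPos_side {X : Type*} (d : Fin 2) (x : X) : fieldPos (fieldSide d x) = x := by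
  fin_cases d <;> rfl

lemma fieldType_side {X : Type*} (d : Fin 2) (x : X) : fieldType (fieldSide d x) = d := by
  fin_cases d <;> rfl

lemma fieldSide_type {X : Type*} (z : X ⊕ X) : fieldSide (fieldType z) (fieldPos z) = z := by
  rcases z with z | z <;> rfl

lemma eq_fieldSide_iff {X : Type*} (z : X ⊕ X) (d : Fin 2) (x : X) :
    z = fieldSide d x ↔ fieldType z = d ∧ fieldPos z = x := by
  constructor
  · rintro rfl
    exact ⟨fieldType_side d x, fieldPos_side d x⟩
  · rintro ⟨rfl, rfl⟩
    exact (fieldSide_type z).symm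

section Forms
variable [Fintype I] [Fintype T]

/-- The signs in `srcBlock` are chosen to reassemble C_n J from the products u J v. For even n the
power ±1^k agrees with the ±1^(n-k) in C_n; for odd n the sign (-1)^(n-k) from exchanging J with v
is also compensated. -/
lemma sum_smul_mul_comm_form (hcomm : ∀ g l, JO l * c g = c g * JO l)
    (hS : ∀ n k : ℕ, k ≤ n → ∀ i j l, JS l * c (D.v n k i j) =
      (-1 : ℂ) ^ (n - k) • (c (D.v n k i j) * JS l))
    (hSbar : ∀ n k : ℕ, k ≤ n → ∀ i j l, JSbar l * c (D.v n k i j) =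
      (-1 : ℂ) ^ (n - k) • (c (D.v n k i j) * JSbar l)) (d d' : Fin 2) (x y : I × A) :
    ∑ q : NK N, ∑ j, c (D.u q.1 q.2 j x.1) * D.srcBlock st JO JS JSbar q j x.2 y.2 d d' *
      c (D.v q.1 q.2 j y.1) = D.srcForm st c JO JS JSbar d d' x y := by
  have hE : ∀ w : T → ℂ, ∀ (n : Fin N) (e : ℕ), ∑ k : Fin (2 * n + 1), ∑ j,
      c (D.u (2 * n) k j x.1) * (∑ α, (st.sign ^ ((k : ℕ) + e) * w α * D.t α x.2 y.2) • JO (n, α, j)) *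
        c (D.v (2 * n) k j y.1) = ∑ α, ∑ i, (st.sign ^ e * w α * D.t α x.2 y.2) •
          (c (D.C st (2 * n) i x.1 y.1) * JO (n, α, i)) := by
    intro w n e
    have h1 : ∀ (k : Fin (2 * n + 1)) j, c (D.u (2 * n) k j x.1) *
        (∑ α, (st.sign ^ ((k : ℕ) + e) * w α * D.t α x.2 y.2) • JO (n, α, j)) *
        c (D.v (2 * n) k j y.1) = ∑ α, (st.sign ^ e * w α * D.t α x.2 y.2) •
          (c (st.sign ^ (2 * n - k : ℕ) • (D.u (2 * n) k j x.1 * D.v (2 * n) k j y.1)) *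
            JO (n, α, j)) := by
      intro k j
      rw [Finset.mul_sum, Finset.sum_mul]
      refine Finset.sum_congr rfl fun α _ => ?_
      rw [mul_smul_comm, smul_mul_assoc, mul_assoc (c _), hcomm, ← mul_assoc (c _), map_smul, map_mul,
        smul_mul_assoc, smul_smul, st.sign_pow_sub (by omega), pow_add _ (2 * (n : ℕ)), pow_mul,
        pow_two, st.sign_mul_self, one_pow, one_mul]
      congr 1
      rw [pow_add]
      ring
    simp only [h1]
    rw [Finset.sum_comm]
    simp only [Finset.sum_comm (s := (Finset.univ : Finset (Fin (2 * n + 1))))]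
    rw [Finset.sum_comm]
    refine Finset.sum_congr rfl fun α _ => Finset.sum_congr rfl fun i _ => ?_
    rw [← Finset.smul_sum, ← Finset.sum_mul, ← map_sum, OperatorData.C, Finset.sum_range]
  have hO : ∀ J : Lab N T I → R, (∀ n k : ℕ, k ≤ n → ∀ i j l, J l * c (D.v n k i j) =
      (-1 : ℂ) ^ (n - k) • (c (D.v n k i j) * J l)) → ∀ (n : Fin N),
      ∑ k : Fin (2 * n + 1 + 1), ∑ j,
      c (D.u (2 * n + 1) k j x.1) *
        (∑ α, (2 * (-st.sign) ^ ((k : ℕ) + 1) * D.t α x.2 y.2) • J (n, α, j)) *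
        c (D.v (2 * n + 1) k j y.1) = ∑ α, ∑ i, (2 * D.t α x.2 y.2) •
          (c (D.C st (2 * n + 1) i x.1 y.1) * J (n, α, i)) := by
    intro J hJ n
    have h1 : ∀ (k : Fin (2 * n + 1 + 1)) j, c (D.u (2 * n + 1) k j x.1) *
        (∑ α, (2 * (-st.sign) ^ ((k : ℕ) + 1) * D.t α x.2 y.2) • J (n, α, j)) *
        c (D.v (2 * n + 1) k j y.1) = ∑ α, (2 * D.t α x.2 y.2) •
          (c (st.sign ^ (2 * n + 1 - k : ℕ) • (D.u (2 * n + 1) k j x.1 * D.v (2 * n + 1) k j y.1)) *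
            J (n, α, j)) := by
      intro k j
      have hk : (k : ℕ) ≤ 2 * n + 1 := by omega
      rw [Finset.mul_sum, Finset.sum_mul]
      refine Finset.sum_congr rfl fun α _ => ?_
      rw [mul_smul_comm, smul_mul_assoc, mul_assoc (c _), hJ _ _ hk, mul_smul_comm, ← mul_assoc (c _),
        map_smul,
        map_mul, smul_mul_assoc, smul_smul, smul_smul]
      congr 1
      have e1 : st.sign ^ (2 * n + 1 - k : ℕ) = (-1) ^ (2 * n + 1 - k : ℕ) * (-st.sign) ^ ((k : ℕ) + 1) := by
        have : (-1 : ℂ) ^ (2 * n + 1 - k : ℕ) = (-1) ^ ((k : ℕ) + 1) := by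
          have h2 : (-1 : ℂ) ^ (2 * n + 1 - k : ℕ) * (-1) ^ (k : ℕ) = -1 := by
            rw [← pow_add, Nat.sub_add_cancel hk, pow_succ, pow_mul]; simp
          have h3 : (-1 : ℂ) ^ (k : ℕ) * (-1) ^ (k : ℕ) = 1 := by
            rw [← pow_add, ← two_mul, pow_mul]; simp
          rw [pow_succ]
          linear_combination (-1) ^ (k : ℕ) * h2 - (-1 : ℂ) ^ (2 * n + 1 - k : ℕ) * h3
        rw [this, ← mul_pow, neg_one_mul, neg_neg, st.sign_pow_sub hk, add_assoc, pow_add, pow_mul,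
          pow_two, st.sign_mul_self, one_pow, one_mul, add_comm]
      rw [e1]
      ring
    simp only [h1]
    rw [Finset.sum_comm]
    simp only [Finset.sum_comm (s := (Finset.univ : Finset (Fin (2 * n + 1 + 1))))]
    rw [Finset.sum_comm]
    refine Finset.sum_congr rfl fun α _ => Finset.sum_congr rfl fun i _ => ?_
    rw [← Finset.smul_sum, ← Finset.sum_mul, ← map_sum, OperatorData.C, Finset.sum_range]
  have h0 : ∀ n : Fin N, ∑ k : Fin (2 * n + 1), ∑ j : I, c (D.u (2 * n) k j x.1) * 0 *
      c (D.v (2 * n) k j y.1) = 0 := by simp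
  have h0' : ∀ n : Fin N, ∑ k : Fin (2 * n + 1 + 1), ∑ j : I, c (D.u (2 * n + 1) k j x.1) * 0 *
      c (D.v (2 * n + 1) k j y.1) = 0 := by simp
  rw [sum_NK]
  simp only [OperatorData.srcBlock_even, OperatorData.srcBlock_odd]
  fin_cases d <;> fin_cases d'
  · have := fun n => hE (fun _ => 1) n 0
    simp only [add_zero, mul_one, pow_zero, one_mul] at this
    simp [OperatorData.srcForm, OperatorData.opForm, this]
  · simp [OperatorData.srcForm, OperatorData.opForm, hO _ hSbar]
  · simp [OperatorData.srcForm, OperatorData.opForm, hO _ hS]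
  · have := fun n : Fin N => hE (fun α => (-1) ^ ((n : ℕ) + D.τ α)) n 1
    simp only [pow_one] at this
    simp [OperatorData.srcForm, OperatorData.opForm, this]

end Forms
end Abstract

section Factor
variable {P I A T R : Type*} {N : ℕ} [Ring R] [Algebra ℂ R]
  [Fintype I] [DecidableEq I] [Fintype A] [DecidableEq A] [Fintype T]
  (D : OperatorData P I A T) (st : Statistics) (Δ : Matrix (I × A) (I × A) (Gr P))
  (c : Gr P →ₐ[ℂ] R) (JO JS JSbar : Lab N T I → R)

/-- The supermatrix for general parameters and sources. -/
def OperatorData.supermatrix : Matrix (SIndex N I A) (SIndex N I A) R :=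
  Matrix.of fun x y => ∑ a', c (D.kernel Δ x.1.1.1 x.1.1.2 x.1.2.1 y.1.1.1 y.1.1.2 y.1.2.1 x.1.2.2 a') *
    D.srcBlock st JO JS JSbar y.1.1 y.1.2.1 a' y.1.2.2 x.2 y.2

/-- The left factor `v` of the supermatrix. -/
def OperatorData.leftFactor (N : ℕ) : Matrix (SIndex N I A) ((I × A) ⊕ (I × A)) R :=
  Matrix.of fun x z => ∑ i', if z = fieldSide x.2 (i', x.1.2.2) then
    c (D.v x.1.1.1 x.1.1.2 x.1.2.1 i') else 0

/-- The right factor `u Δ⁻¹ t J` of the supermatrix. -/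
def OperatorData.rightFactor : Matrix ((I × A) ⊕ (I × A)) (SIndex N I A) R :=
  Matrix.of fun z y => ∑ a', ∑ j',
    c (D.u y.1.1.1 y.1.1.2 y.1.2.1 j' * Ring.inverse Δ (fieldPos z) (j', a')) *
      D.srcBlock st JO JS JSbar y.1.1 y.1.2.1 a' y.1.2.2 (fieldType z) y.2

variable {D st Δ c JO JS JSbar} {part : ZMod 2 → Submodule ℂ R}

lemma leftFactor_mul_rightFactor : D.leftFactor c N * D.rightFactor st Δ c JO JS JSbar =
    D.supermatrix st Δ c JO JS JSbar := by
  ext x y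
  simp only [Matrix.mul_apply, OperatorData.leftFactor, OperatorData.supermatrix, Matrix.of_apply,
    Finset.sum_mul, ite_mul, zero_mul]
  rw [Finset.sum_comm]
  simp only [Finset.sum_ite_eq', Finset.mem_univ, if_true]
  simp only [OperatorData.rightFactor, Matrix.of_apply, fieldPos_side, fieldType_side,
    OperatorData.kernel, Finset.mul_sum, map_sum, Finset.sum_mul, map_mul, mul_assoc]
  rw [Finset.sum_comm]

lemma sum_comm_four {α β γ δ M : Type*} [AddCommMonoid M] [Fintype α] [Fintype β] [Fintype γ]
    [Fintype δ] (f : α → β → γ → δ → M) :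
    ∑ a, ∑ b, ∑ c, ∑ d, f a b c d = ∑ d, ∑ c, ∑ a, ∑ b, f a b c d := by
  calc _ = ∑ a, ∑ c, ∑ b, ∑ d, f a b c d := Finset.sum_congr rfl fun a _ => Finset.sum_comm
    _ = ∑ c, ∑ a, ∑ b, ∑ d, f a b c d := Finset.sum_comm
    _ = ∑ c, ∑ a, ∑ d, ∑ b, f a b c d :=
      Finset.sum_congr rfl fun c _ => Finset.sum_congr rfl fun a _ => Finset.sum_comm
    _ = ∑ c, ∑ d, ∑ a, ∑ b, f a b c d := Finset.sum_congr rfl fun c _ => Finset.sum_comm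
    _ = _ := Finset.sum_comm

lemma sum_fieldSide {M : Type*} [AddCommMonoid M] (z : (I × A) ⊕ (I × A)) (f : A → Fin 2 → I → M) :
    (∑ b, ∑ d, ∑ i, if z = fieldSide d (i, b) then f b d i else 0) =
      f (fieldPos z).2 (fieldType z) (fieldPos z).1 := by
  have h : ∀ b d i, ¬ (b = (fieldPos z).2 ∧ d = fieldType z ∧ i = (fieldPos z).1) →
      (if z = fieldSide d (i, b) then f b d i else 0) = 0 := by
    intro b d i hn
    refine if_neg fun hz => hn ?_
    obtain ⟨h1, h2⟩ := (eq_fieldSide_iff z d (i, b)).1 hz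
    rw [h2]
    exact ⟨rfl, h1.symm, rfl⟩
  rw [Finset.sum_eq_single (fieldPos z).2, Finset.sum_eq_single (fieldType z),
    Finset.sum_eq_single (fieldPos z).1, if_pos]
  · exact (fieldSide_type z).symm
  · exact fun i _ hi => h _ _ _ fun hh => hi hh.2.2
  · simp
  · exact fun d _ hd => Finset.sum_eq_zero fun i _ => h _ _ _ fun hh => hd hh.2.1
  · simp
  · exact fun b _ hb => Finset.sum_eq_zero fun d _ => Finset.sum_eq_zero fun i _ =>
      h _ _ _ fun hh => hb hh.1
  · simp

/-- In this order the summation runs over the large index (n,k), i and rebuilds C_n from u and v.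
The product acts on field positions only and consists of the propagator times the sources. -/
lemma rightFactor_mul_leftFactor_apply (h : IsSupercommutative part) (hD : D.IsGraded st)
    (hΔ : ∀ x y, Ring.inverse Δ x y ∈ Gr.part P 0)
    (hc : ∀ i g, g ∈ Gr.part P i → c g ∈ part i) (hcO : ∀ g l, JO l * c g = c g * JO l)
    (hS : ∀ l, JS l ∈ part 1) (hSbar : ∀ l, JSbar l ∈ part 1) (z z' : (I × A) ⊕ (I × A)) :
    (D.rightFactor st Δ c JO JS JSbar * D.leftFactor c N) z z' =
      ∑ y, c (Ring.inverse Δ (fieldPos z) y) *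
        D.srcForm st c JO JS JSbar (fieldType z) (fieldType z') y (fieldPos z') := by
  have hv : ∀ J : Lab N T I → R, (∀ l, J l ∈ part 1) → ∀ n k : ℕ, k ≤ n → ∀ i j l,
      J l * c (D.v n k i j) = (-1 : ℂ) ^ (n - k) • (c (D.v n k i j) * J l) := by
    intro J hJ n k hk i j l
    have := h.mul_comm (m := 1) (n := n - k) (x := J l) (by simpa using hJ l)
      (hc _ _ (hD.v_mem n k hk i j))
    rwa [one_mul] at this
  simp only [← sum_smul_mul_comm_form hcO (hv JS hS) (hv JSbar hSbar)]
  simp only [Matrix.mul_apply, OperatorData.leftFactor, Matrix.of_apply, Finset.mul_sum, mul_ite,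
    mul_zero]
  simp only [Fintype.sum_prod_type (α₁ := NK N × I × A), Fintype.sum_prod_type (α₁ := NK N),
    Fintype.sum_prod_type (α₁ := I)]
  simp only [sum_fieldSide, OperatorData.rightFactor, Matrix.of_apply, Finset.sum_mul]
  rw [sum_comm_four]
  refine Finset.sum_congr rfl fun j' _ => Finset.sum_congr rfl fun a' _ =>
    Finset.sum_congr rfl fun q _ => Finset.sum_congr rfl fun j _ => ?_
  rw [← (Gr.commute_even (hΔ _ _) _).eq, map_mul]
  simp only [mul_assoc]

lemma leftFactor_mem (hD : D.IsGraded st) (hc : ∀ i g, g ∈ Gr.part P i → c g ∈ part i)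
    (x : SIndex N I A) (z : (I × A) ⊕ (I × A)) : D.leftFactor c N x z ∈ part (x.parity : ZMod 2) := by
  refine sum_mem fun i' _ => ?_
  split_ifs
  · exact hc _ _ (hD.v_mem _ _ (Nat.lt_succ_iff.1 x.1.1.2.2) _ _)
  · exact zero_mem _

lemma srcBlock_mem (hO : ∀ l, JO l ∈ part 0) (hS : ∀ l, JS l ∈ part 1)
    (hSbar : ∀ l, JSbar l ∈ part 1) (q : NK N) (j : I) (a b : A) (d d' : Fin 2) :
    D.srcBlock st JO JS JSbar q j a b d d' ∈ part ((q.1 : ℕ) : ZMod 2) := by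
  have hs : ∀ (J : Lab N T I → R) i (w : T → ℂ) (l : T → Lab N T I), (∀ l, J l ∈ part i) →
      ∑ α, w α • J (l α) ∈ part i := fun J i w l hJ =>
    sum_mem fun α _ => Submodule.smul_mem _ _ (hJ _)
  rw [OperatorData.srcBlock]
  split_ifs with hq
  · have h0 : ((q.1 : ℕ) : ZMod 2) = 0 := (ZMod.natCast_eq_zero_iff_even).2 hq
    rw [h0]
    fin_cases d <;> fin_cases d'
    · exact hs JO 0 _ _ hO
    · exact zero_mem _
    · exact zero_mem _
    · exact hs JO 0 _ _ hO
  · have h1 : ((q.1 : ℕ) : ZMod 2) = 1 := (ZMod.natCast_eq_one_iff_odd).2 (Nat.not_even_iff_odd.1 hq)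
    rw [h1]
    fin_cases d <;> fin_cases d'
    · exact zero_mem _
    · exact hs JSbar 1 _ _ hSbar
    · exact hs JS 1 _ _ hS
    · exact zero_mem _

lemma rightFactor_mem (h : IsSupercommutative part) (hD : D.IsGraded st)
    (hΔ : ∀ x y, Ring.inverse Δ x y ∈ Gr.part P 0)
    (hc : ∀ i g, g ∈ Gr.part P i → c g ∈ part i) (hO : ∀ l, JO l ∈ part 0)
    (hS : ∀ l, JS l ∈ part 1) (hSbar : ∀ l, JSbar l ∈ part 1) (z : (I × A) ⊕ (I × A))
    (y : SIndex N I A) : D.rightFactor st Δ c JO JS JSbar z y ∈ part (y.parity : ZMod 2) := by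
  refine sum_mem fun a' _ => sum_mem fun j' _ => ?_
  have hk : (y.1.1.2 : ℕ) ≤ y.1.1.1 := Nat.lt_succ_iff.1 y.1.1.2.2
  have h1 := h.mul_mem (hc _ _ (Gr.mul_mem (hD.u_mem _ _ hk y.1.2.1 j') (hΔ (fieldPos z) (j', a'))))
    (srcBlock_mem (D := D) (st := st) hO hS hSbar y.1.1 y.1.2.1 a' y.1.2.2 (fieldType z) y.2)
  have h2 : ((y.1.1.2 : ℕ) : ZMod 2) + 0 + ((y.1.1.1 : ℕ) : ZMod 2) = (y.parity : ZMod 2) := by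
    rw [SIndex.parity, Nat.cast_sub hk, add_zero, add_comm, sub_eq_add_neg, ZMod.neg_eq_self_mod_two]
  rwa [h2] at h1

/-- Supertraces of powers of the supermatrix. -/
theorem superTrace_supermatrix_pow (h : IsSupercommutative part) (hD : D.IsGraded st)
    (hΔ : ∀ x y, Ring.inverse Δ x y ∈ Gr.part P 0)
    (hc : ∀ i g, g ∈ Gr.part P i → c g ∈ part i) (hO : ∀ l, JO l ∈ part 0)
    (hS : ∀ l, JS l ∈ part 1) (hSbar : ∀ l, JSbar l ∈ part 1) (m : ℕ) :
    superTrace (D.supermatrix st Δ c JO JS JSbar ^ (m + 1)) =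
      ((D.rightFactor st Δ c JO JS JSbar * D.leftFactor c N) ^ (m + 1)).trace := by
  rw [← leftFactor_mul_rightFactor, superTrace_mul_pow h _ _ (leftFactor_mem hD hc)
    (rightFactor_mem h hD hΔ hc hO hS hSbar)]
  intro z z'
  rw [Matrix.mul_apply]
  refine sum_mem fun x _ => ?_
  have := h.mul_mem (rightFactor_mem h hD hΔ hc hO hS hSbar z x) (leftFactor_mem hD hc x z')
  rwa [CharTwo.add_self_eq_zero] at this

end Factor

/-! ### The source term as a quadratic form -/

section Source
variable {P I A T R : Type*} {N : ℕ} [Ring R] [Algebra ℂ R] [Fintype I] [Fintype A] [Fintype T]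
  {D : OperatorData P I A T} {st : Statistics} {c : Gr P →ₐ[ℂ] R} {JO JS JSbar J : Lab N T I → R}

lemma map_opForm {F : Type*} [Ring F] [Algebra ℂ F] (φ : R →ₐ[ℂ] F) (w : Fin N → T → ℂ) (p : ℕ)
    (x y : I × A) : φ (D.opForm st c w p J x y) =
      D.opForm st (φ.comp c) w p (fun l => φ (J l)) x y := by
  simp only [OperatorData.opForm, Matrix.of_apply, map_sum, map_smul, map_mul, AlgHom.comp_apply]

lemma opForm_smul (r : ℂ) (w : Fin N → T → ℂ) (p : ℕ) (x y : I × A) :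
    r • D.opForm st c w p J x y = D.opForm st c (fun n α => r * w n α) p J x y := by
  simp only [OperatorData.opForm, Matrix.of_apply, Finset.smul_sum, smul_smul, mul_assoc]

lemma opForm_swap_apply (hD : D.IsGraded st) (w : Fin N → T → ℂ) (p : ℕ) (x y : I × A) :
    D.opForm st c w p J y x = D.opForm st c (fun n α =>
      w n α * (-1) ^ ((2 * (n : ℕ) + p + 1) / 2 + D.τ α)) p J x y := by
  simp only [OperatorData.opForm, Matrix.of_apply]
  refine Finset.sum_congr rfl fun n _ => Finset.sum_congr rfl fun α _ =>
    Finset.sum_congr rfl fun i _ => ?_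
  have ht : D.t α y.2 x.2 = (-1) ^ D.τ α * D.t α x.2 y.2 :=
    congrFun (congrFun (hD.t_transpose α) x.2) y.2
  rw [ht, hD.symm _ _ y.1, neg_one_pow_mul_eq_smul _ (D.C st _ i x.1 y.1), map_smul, smul_mul_assoc, smul_smul, pow_add]
  congr 1
  ring

lemma opForm_congr {w w' : Fin N → T → ℂ} {p : ℕ} (h : ∀ n α, (∀ i, J (n, α, i) = 0) ∨ w n α = w' n α)
    (x y : I × A) : D.opForm st c w p J x y = D.opForm st c w' p J x y := by
  simp only [OperatorData.opForm, Matrix.of_apply]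
  refine Finset.sum_congr rfl fun n _ => Finset.sum_congr rfl fun α _ =>
    Finset.sum_congr rfl fun i _ => ?_
  rcases h n α with h | h
  · simp [h]
  · rw [h]

/-- The symmetry sign of C_{2n+1}, that of t^α and the statistics multiply to 1 exactly under
admissibility; the other sources are zero. Hence symmetrization doubles these terms. -/
lemma sign_smul_opForm_odd (hD : D.IsGraded st)
    (hJ : ∀ l : Lab N T I, ¬ D.Admissible st l.1 l.2.1 → J l = 0) (w : Fin N → T → ℂ) (x y : I × A) :
    st.sign • D.opForm st c w 1 J y x = D.opForm st c w 1 J x y := by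
  rw [opForm_swap_apply hD, opForm_smul]
  refine opForm_congr (fun n α => ?_) x y
  by_cases h : D.Admissible st n α
  · right
    have e : (2 * (n : ℕ) + 1 + 1) / 2 = n + 1 := by omega
    rw [e]
    cases st with
    | bose =>
      have h' : Even ((n : ℕ) + 1 + D.τ α) := h
      simp [Statistics.sign, h'.neg_one_pow]
    | fermi =>
      have h' : Even ((n : ℕ) + D.τ α) := h
      rw [add_right_comm, pow_succ, h'.neg_one_pow]
      simp [Statistics.sign]
  · exact Or.inl fun i => hJ (n, α, i) h

/-- The φφ̄ block and its transpose occupy different blocks of the symmetrized form, so no condition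
is needed. The symmetry sign survives as the weight of the second diagonal entry of `srcForm`. -/
lemma sign_smul_opForm_even (hD : D.IsGraded st) (x y : I × A) :
    st.sign • D.opForm st c (fun _ _ => 1) 0 J y x =
      D.opForm st c (fun n α => st.sign * (-1) ^ ((n : ℕ) + D.τ α)) 0 J x y := by
  rw [opForm_swap_apply hD, opForm_smul]
  refine opForm_congr (fun n α => Or.inr ?_) x y
  have e : (2 * (n : ℕ) + 0 + 1) / 2 = n := by omega
  rw [e, one_mul]

/-- Moving v_{n,k} to the left of f produces the sign built into the definition of C_n. -/
lemma op_eq (f g : I × A → R) (n : ℕ) (α : T) (i : I)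
    (hf : ∀ k ≤ n, ∀ j x, c (D.v n k i j) * f x = st.sign ^ (n - k) • (f x * c (D.v n k i j))) :
    D.op c n α i f g = ∑ x, ∑ y, D.t α x.2 y.2 • (c (D.C st n i x.1 y.1) * (f x * g y)) := by
  have h : ∀ k ∈ Finset.range (n + 1), ∑ a, ∑ b,
      D.t α a b • ((∑ j, c (D.u n k i j) * f (j, a)) * (∑ l, c (D.v n k i l) * g (l, b))) =
      ∑ x : I × A, ∑ y : I × A, D.t α x.2 y.2 •
        (c (st.sign ^ (n - k) • (D.u n k i x.1 * D.v n k i y.1)) * (f x * g y)) := by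
    intro k hk
    simp only [Fintype.sum_prod_type, Finset.sum_mul_sum, Finset.smul_sum]
    calc _ = ∑ a, ∑ j, ∑ b, ∑ l, D.t α a b •
          (c (D.u n k i j) * f (j, a) * (c (D.v n k i l) * g (l, b))) :=
          Finset.sum_congr rfl fun a _ => Finset.sum_comm
      _ = ∑ j, ∑ a, ∑ b, ∑ l, D.t α a b •
          (c (D.u n k i j) * f (j, a) * (c (D.v n k i l) * g (l, b))) := Finset.sum_comm
      _ = ∑ j, ∑ a, ∑ l, ∑ b, D.t α a b •
          (c (D.u n k i j) * f (j, a) * (c (D.v n k i l) * g (l, b))) :=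
          Finset.sum_congr rfl fun j _ => Finset.sum_congr rfl fun a _ => Finset.sum_comm
      _ = _ := by
          refine Finset.sum_congr rfl fun j _ => Finset.sum_congr rfl fun a _ =>
            Finset.sum_congr rfl fun l _ => Finset.sum_congr rfl fun b _ => ?_
          have hs : st.sign ^ (n - k) • (c (D.v n k i l) * f (j, a)) = f (j, a) * c (D.v n k i l) := by
            rw [hf k (Nat.lt_succ_iff.1 (Finset.mem_range.1 hk)), smul_smul, ← mul_pow,
              st.sign_mul_self, one_pow, one_smul]
          rw [mul_assoc, ← mul_assoc (f (j, a)), ← hs, map_smul, map_mul]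
          simp only [smul_mul_assoc, mul_smul_comm, mul_assoc]
  rw [OperatorData.op, Finset.sum_congr rfl h, Finset.sum_comm]
  refine Finset.sum_congr rfl fun x _ => ?_
  rw [Finset.sum_comm]
  refine Finset.sum_congr rfl fun y _ => ?_
  rw [OperatorData.C, map_sum, Finset.sum_mul, Finset.smul_sum]

lemma sourceTerm_eq (f fbar : I × A → R)
    (hf : ∀ n k, k ≤ n → ∀ i j x, c (D.v n k i j) * f x = st.sign ^ (n - k) • (f x * c (D.v n k i j)))
    (hfbar : ∀ n k, k ≤ n → ∀ i j x,
      c (D.v n k i j) * fbar x = st.sign ^ (n - k) • (fbar x * c (D.v n k i j)))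
    (hO : ∀ x y l, fbar x * f y * JO l = JO l * (fbar x * f y))
    (hS : ∀ x y l, f x * f y * JS l = JS l * (f x * f y))
    (hSbar : ∀ x y l, fbar x * fbar y * JSbar l = JSbar l * (fbar x * fbar y)) :
    D.sourceTerm c f fbar JO JS JSbar = ∑ x, ∑ y,
      (D.opForm st c (fun _ _ => 1) 0 JO x y * (fbar x * f y) +
        D.opForm st c (fun _ _ => 1) 1 JS x y * (f x * f y) +
        D.opForm st c (fun _ _ => 1) 1 JSbar x y * (fbar x * fbar y)) := by
  have h : ∀ (J : Lab N T I → R) (p : ℕ) (f g : I × A → R),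
      (∀ n k, k ≤ n → ∀ i j x, c (D.v n k i j) * f x = st.sign ^ (n - k) • (f x * c (D.v n k i j))) →
      (∀ x y l, f x * g y * J l = J l * (f x * g y)) →
      ∑ n : Fin N, ∑ α, ∑ i, D.op c (2 * (n : ℕ) + p) α i f g * J (n, α, i) =
        ∑ x, ∑ y, D.opForm st c (fun _ _ => 1) p J x y * (f x * g y) := by
    intro J p f g hf hJ
    have h1 : ∀ (n : Fin N) α i, D.op c (2 * (n : ℕ) + p) α i f g * J (n, α, i) =
        ∑ x, ∑ y, (D.t α x.2 y.2 • (c (D.C st (2 * n + p) i x.1 y.1) * J (n, α, i))) *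
          (f x * g y) := by
      intro n α i
      rw [op_eq (st := st) f g _ α i fun k hk => hf _ _ hk i]
      simp only [Finset.sum_mul, smul_mul_assoc, mul_assoc (c _), hJ]
    simp only [h1, OperatorData.opForm, Matrix.of_apply, Finset.sum_mul, one_mul]
    have h2 := fun n : Fin N => sum_comm_four (M := R) (α := T) (β := I)
      (γ := I × A) (δ := I × A)
      fun α i x y => (D.t α x.2 y.2 • (c (D.C st (2 * n + p) i x.1 y.1) * J (n, α, i))) * (f x * g y)
    simp only [h2]
    rw [Finset.sum_comm]
    conv_rhs => rw [Finset.sum_comm]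
    refine Finset.sum_congr rfl fun y _ => ?_
    rw [Finset.sum_comm]
  simp only [Finset.sum_add_distrib]
  rw [← h JO 0 fbar f hfbar hO, ← h JS 1 f f hf hS, ← h JSbar 1 fbar fbar hfbar hSbar]
  simp only [← Finset.sum_add_distrib, add_zero]
  rfl

end Source

namespace FieldCalculus
variable {P I A T R S F : Type*} {N : ℕ} [Ring R] [Algebra ℂ R] [CommRing S] [Algebra ℂ S] [Ring F]
  [Algebra ℂ F] [Algebra S F] [Fintype I] [Fintype A] [Fintype T] [DecidableEq I] [DecidableEq A]
  {D : OperatorData P I A T} {st : Statistics} {c : Gr P →ₐ[ℂ] R} {JO JS JSbar : Lab N T I → R}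

/-- The source term is a quadratic form. -/
lemma sourceTerm_eq_quad (𝓕 : FieldCalculus S F ((I × A) ⊕ (I × A))) (val : S →ₐ[ℂ] R)
    (incl : R →ₐ[ℂ] F) (hsmul : ∀ a f, a • f = incl (val a) * f) (a b d : Matrix (I × A) (I × A) S)
    (ha : ∀ x y, val (a x y) = D.opForm st c (fun _ _ => 1) 1 JS x y)
    (hb : ∀ x y, val (b x y) = D.opForm st c (fun _ _ => 1) 0 JO x y)
    (hd : ∀ x y, val (d x y) = D.opForm st c (fun _ _ => 1) 1 JSbar x y)
    (hv : ∀ n k, k ≤ n → ∀ i j z,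
      incl (c (D.v n k i j)) * 𝓕.Φ z = st.sign ^ (n - k) • (𝓕.Φ z * incl (c (D.v n k i j))))
    (hcomm : ∀ z z' r, Commute (𝓕.Φ z * 𝓕.Φ z') (incl r)) :
    D.sourceTerm (incl.comp c) (fun x => 𝓕.Φ (.inl x)) (fun x => 𝓕.Φ (.inr x))
      (fun l => incl (JO l)) (fun l => incl (JS l)) (fun l => incl (JSbar l)) =
      𝓕.quad (Matrix.fromBlocks a 0 b d) := by
  rw [sourceTerm_eq (st := st) _ _ (fun n k hk i j x => hv n k hk i j _)
    (fun n k hk i j x => hv n k hk i j _) (fun x y l => hcomm _ _ _) (fun x y l => hcomm _ _ _)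
    (fun x y l => hcomm _ _ _), quad_fromBlocks]
  refine Finset.sum_congr rfl fun x _ => Finset.sum_congr rfl fun y _ => ?_
  simp only [hsmul, ha, hb, hd, map_opForm, Matrix.zero_apply, map_zero, zero_mul, add_zero]
  abel

end FieldCalculus

/-! ### The generating functional -/

open SPoly

section Concrete
variable {P I A T : Type*} {N : ℕ} [Fintype I] [DecidableEq I] [Fintype A] [DecidableEq A] [Fintype T]
  {D : OperatorData P I A T} {st : Statistics} {Δ : Matrix (I × A) (I × A) (Gr P)}

lemma gr_C_mem (hD : D.IsGraded st) (n : ℕ) (i j l : I) : D.C st n i j l ∈ Gr.part P (n : ZMod 2) := by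
  refine sum_mem fun k hk => Submodule.smul_mem _ _ ?_
  have hk' : k ≤ n := Nat.lt_succ_iff.1 (Finset.mem_range.1 hk)
  have := Gr.mul_mem (hD.u_mem n k hk' i j) (hD.v_mem n k hk' i l)
  rwa [← Nat.cast_add, Nat.add_sub_cancel' hk'] at this

/-- C_{2n+p} and its source have the same parity p, so their product is even. The coefficients of
the quadratic form thereby lie in the commutative ring of scalars. -/
lemma opForm_mem {R : Type*} [Ring R] [Algebra ℂ R] {part : ZMod 2 → Submodule ℂ R}
    (h : IsSupercommutative part) (hD : D.IsGraded st) {c : Gr P →ₐ[ℂ] R}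
    (hc : ∀ i g, g ∈ Gr.part P i → c g ∈ part i) {J : Lab N T I → R} {p : ℕ}
    (hJ : ∀ l, J l ∈ part (p : ZMod 2)) (w : Fin N → T → ℂ) (x y : I × A) :
    D.opForm st c w p J x y ∈ part 0 := by
  rw [OperatorData.opForm, Matrix.of_apply]
  refine sum_mem fun n _ => sum_mem fun α _ => sum_mem fun i _ => Submodule.smul_mem _ _ ?_
  have h1 := h.mul_mem (hc _ _ (gr_C_mem hD (2 * n + p) i x.1 y.1)) (hJ (n, α, i))
  have h2 : (((2 * (n : ℕ) + p : ℕ) : ZMod 2) + (p : ZMod 2)) = 0 := by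
    rw [← Nat.cast_add, ZMod.natCast_eq_zero_iff_even]
    exact ⟨n + p, by ring⟩
  rwa [h2] at h1

lemma srcO_mem (l : Lab N T I) : srcO P l ∈ part (Lab N T I) (OddGen P N T I) 0 := evenVar_mem l

lemma oddSource_mem {E O : Type*} {g : Lab N T I → SPoly E O} (hg : ∀ l, g l ∈ part E O 1)
    (l : Lab N T I) : D.oddSource st g l ∈ part E O 1 := by
  rw [OperatorData.oddSource]
  split_ifs
  · exact hg l
  · exact zero_mem _

lemma srcS_mem (l : Lab N T I) : D.srcS st l ∈ part (Lab N T I) (OddGen P N T I) 1 :=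
  oddSource_mem (fun _ => oddVar_mem _) l

lemma srcSbar_mem (l : Lab N T I) : D.srcSbar st l ∈ part (Lab N T I) (OddGen P N T I) 1 :=
  oddSource_mem (fun _ => oddVar_mem _) l

lemma map_oddSource {R R' : Type*} [Ring R] [Ring R'] (f : R →+* R') (g : Lab N T I → R)
    (l : Lab N T I) : f (D.oddSource st g l) = D.oddSource st (fun l => f (g l)) l := by
  simp only [OperatorData.oddSource]
  split_ifs
  · rfl
  · exact map_zero f

lemma oddSource_of_not {R : Type*} [Zero R] {g : Lab N T I → R} {l : Lab N T I}
    (h : ¬ D.Admissible st l.1 l.2.1) : D.oddSource st g l = 0 := if_neg h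

/-- A matrix of quadratic operators in the even part of the algebra of sources. -/
def evenForm (hD : D.IsGraded st) (p : ℕ) {J : Lab N T I → SrcAlg P N T I}
    (hJ : ∀ l, J l ∈ part (Lab N T I) (OddGen P N T I) (p : ZMod 2)) :
    Matrix (I × A) (I × A) (Even (Lab N T I) (OddGen P N T I)) :=
  Matrix.of fun x y => Even.mk (D.opForm st (srcParam P I T N) (fun _ _ => 1) p J x y)
    (opForm_mem (isSupercommutative _ _) hD (fun _ _ => srcParam_mem) hJ _ x y)

/-- The coefficients of the source term. -/
def sourceForm (N : ℕ) (hD : D.IsGraded st) :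
    Matrix ((I × A) ⊕ (I × A)) ((I × A) ⊕ (I × A)) (Even (Lab N T I) (OddGen P N T I)) :=
  Matrix.fromBlocks (evenForm hD 1 (J := D.srcS st) fun l => by simpa using srcS_mem l) 0
    (evenForm hD 0 (J := srcO P) fun l => by simpa using srcO_mem l)
    (evenForm hD 1 (J := D.srcSbar st) fun l => by simpa using srcSbar_mem l)

lemma boseSource_eq (hD : D.IsGraded .bose) : boseSource N D =
    (evenCalculus (Lab N T I) (OddGen P N T I) ((I × A) ⊕ (I × A))).quad (sourceForm N hD) := by
  refine Eq.trans ?_ (FieldCalculus.sourceTerm_eq_quad (D := D) (st := .bose)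
    (c := srcParam P I T N) (JO := srcO P) (JS := D.srcS .bose) (JSbar := D.srcSbar .bose)
    (evenCalculus (Lab N T I) (OddGen P N T I) ((I × A) ⊕ (I × A))) Even.val
    (inclEven (Lab N T I) (OddGen P N T I) ((I × A) ⊕ (I × A))) Even.smul_even _ _ _
    (fun x y => rfl) (fun x y => rfl) (fun x y => rfl) ?_ ?_)
  · rw [boseSource]
    have h1 : (inclEven (Lab N T I) (OddGen P N T I) ((I × A) ⊕ (I × A))).comp (srcParam P I T N) =
        boseParam P I A T N := AlgHom.ext fun g => (boseParam_eq g).symm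
    have h2 : ∀ l, inclEven (Lab N T I) (OddGen P N T I) ((I × A) ⊕ (I × A)) (srcO P l) =
        evenVar (.inl l) := fun l => by
      rw [srcO, evenVar, inclEven_tmul, MvPolynomial.rename_X]
      rfl
    have h3 : ∀ o, inclEven (Lab N T I) (OddGen P N T I) ((I × A) ⊕ (I × A)) (oddVar o) =
        oddVar o := fun o => by
      rw [oddVar, ofGr, Algebra.TensorProduct.includeRight_apply, inclEven_tmul, map_one]
      rfl
    have h4 : ∀ l, inclEven (Lab N T I) (OddGen P N T I) ((I × A) ⊕ (I × A)) (D.srcS .bose l) =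
        D.oddSource .bose (fun l => oddVar (.inr (.inl l))) l := fun l =>
      (map_oddSource (inclEven (Lab N T I) (OddGen P N T I) ((I × A) ⊕ (I × A))).toRingHom _ l).trans
        (congrArg (fun g => D.oddSource .bose g l) (funext fun l => h3 _))
    have h5 : ∀ l, inclEven (Lab N T I) (OddGen P N T I) ((I × A) ⊕ (I × A)) (D.srcSbar .bose l) =
        D.oddSource .bose (fun l => oddVar (.inr (.inr l))) l := fun l =>
      (map_oddSource (inclEven (Lab N T I) (OddGen P N T I) ((I × A) ⊕ (I × A))).toRingHom _ l).trans
        (congrArg (fun g => D.oddSource .bose g l) (funext fun l => h3 _))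
    rw [h1, funext h2, funext h4, funext h5]
    rfl
  · intro n k hk i j z
    rw [Statistics.sign, one_pow, one_smul]
    exact (commute_even (evenVar_mem _) _).eq.symm
  · intro z z' r
    refine commute_even ?_ _
    have := SPoly.mul_mem (evenVar_mem (O := OddGen P N T I) (Sum.inr z : Lab N T I ⊕ _))
      (evenVar_mem (Sum.inr z'))
    rw [add_zero] at this
    exact this

lemma fermiSource_eq (hD : D.IsGraded .fermi) : fermiSource N D =
    (oddCalculus (Lab N T I) (OddGen P N T I) ((I × A) ⊕ (I × A))).quad (sourceForm N hD) := by
  refine Eq.trans ?_ (FieldCalculus.sourceTerm_eq_quad (D := D) (st := .fermi)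
    (c := srcParam P I T N) (JO := srcO P) (JS := D.srcS .fermi) (JSbar := D.srcSbar .fermi)
    (oddCalculus (Lab N T I) (OddGen P N T I) ((I × A) ⊕ (I × A))) Even.val
    (inclOdd (Lab N T I) (OddGen P N T I) ((I × A) ⊕ (I × A))) Even.smul_odd _ _ _
    (fun x y => rfl) (fun x y => rfl) (fun x y => rfl) ?_ ?_)
  · rw [fermiSource]
    have h1 : (inclOdd (Lab N T I) (OddGen P N T I) ((I × A) ⊕ (I × A))).comp (srcParam P I T N) =
        fermiParam P I A T N := AlgHom.ext fun g => rfl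
    have h2 : ∀ l, inclOdd (Lab N T I) (OddGen P N T I) ((I × A) ⊕ (I × A)) (srcO P l) =
        evenVar l := fun l => by
      rw [srcO, evenVar, inclOdd_tmul, map_one]
      rfl
    have h3 : ∀ o, inclOdd (Lab N T I) (OddGen P N T I) ((I × A) ⊕ (I × A)) (oddVar o) =
        oddVar (.inl o) := fun o => by
      rw [oddVar, ofGr, Algebra.TensorProduct.includeRight_apply, inclOdd_tmul, Gr.inl_gen]
      rfl
    have h4 : ∀ l, inclOdd (Lab N T I) (OddGen P N T I) ((I × A) ⊕ (I × A)) (D.srcS .fermi l) =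
        D.oddSource .fermi (fun l => oddVar (.inl (.inr (.inl l)))) l := fun l =>
      (map_oddSource (inclOdd (Lab N T I) (OddGen P N T I) ((I × A) ⊕ (I × A))).toRingHom _ l).trans
        (congrArg (fun g => D.oddSource .fermi g l) (funext fun l => h3 _))
    have h5 : ∀ l, inclOdd (Lab N T I) (OddGen P N T I) ((I × A) ⊕ (I × A)) (D.srcSbar .fermi l) =
        D.oddSource .fermi (fun l => oddVar (.inl (.inr (.inr l)))) l := fun l =>
      (map_oddSource (inclOdd (Lab N T I) (OddGen P N T I) ((I × A) ⊕ (I × A))).toRingHom _ l).trans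
        (congrArg (fun g => D.oddSource .fermi g l) (funext fun l => h3 _))
    rw [h1, funext h2, funext h4, funext h5]
    rfl
  · intro n k hk i j z
    rw [Statistics.sign]
    have := (isSupercommutative (Lab N T I) (OddGen P N T I ⊕ ((I × A) ⊕ (I × A)))).mul_comm
      (n := 1) (inclOdd_mem (srcParam_mem (I := I) (T := T) (N := N) (hD.v_mem n k hk i j)))
      (by simpa using oddVar_mem (E := Lab N T I) (Sum.inr z : OddGen P N T I ⊕ _))
    rwa [mul_one] at this
  · intro z z' r
    refine commute_even ?_ _
    have := SPoly.mul_mem (oddVar_mem (E := Lab N T I) (Sum.inr z : OddGen P N T I ⊕ _))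
      (oddVar_mem (Sum.inr z'))
    have h2 : (1 + 1 : ZMod 2) = 0 := rfl
    rw [h2] at this
    exact this

/-- The index `1 - d` anticipates the multiplication with the propagator, which connects φ to φ̄ and
so exchanges the two field types. -/
lemma val_symmetrize_sourceForm (hD : D.IsGraded st) (d d' : Fin 2) (x y : I × A) :
    ((sourceForm N hD + st.sign • (sourceForm N hD).transpose) (fieldSide (1 - d) x)
      (fieldSide d' y)).val =
      D.srcForm st (srcParam P I T N) (srcO P) (D.srcS st) (D.srcSbar st) d d' x y := by
  have h2 : ∀ J : Lab N T I → SrcAlg P N T I, (∀ l, ¬ D.Admissible st l.1 l.2.1 → J l = 0) →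
      D.opForm st (srcParam P I T N) (fun _ _ => 1) 1 J x y +
        st.sign • D.opForm st (srcParam P I T N) (fun _ _ => 1) 1 J y x =
      D.opForm st (srcParam P I T N) (fun _ _ => 2) 1 J x y := by
    intro J hJ
    rw [sign_smul_opForm_odd hD hJ, ← two_smul ℂ, opForm_smul]
    simp only [mul_one]
  fin_cases d <;> fin_cases d'
  · change (Even.mk (D.opForm st (srcParam P I T N) (fun _ _ => 1) 0 (srcO P) x y) _ +
      st.sign • (0 : Even (Lab N T I) (OddGen P N T I))).val = _
    rw [smul_zero, add_zero]
    rfl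
  · exact h2 (D.srcSbar st) fun l => oddSource_of_not
  · exact h2 (D.srcS st) fun l => oddSource_of_not
  · change ((0 : Even (Lab N T I) (OddGen P N T I)) + st.sign •
      Even.mk (D.opForm st (srcParam P I T N) (fun _ _ => 1) 0 (srcO P) y x) _).val = _
    rw [zero_add]
    exact sign_smul_opForm_even hD x y

/-- The generating functional of connected correlators as the logarithm of a superdeterminant. -/
theorem connectedFunctional_eq (hD : D.IsGraded st) (hΔ : IsKernel st Δ) :
    connectedFunctional N D st Δ = (-(st.sign / 2)) • superTraceLog
      (D.supermatrix st Δ (srcParam P I T N) (srcO P) (D.srcS st) (D.srcSbar st)) := by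
  ext m
  rw [hΔ.coeff_connectedFunctional (sourceForm N hD)
    (by rintro rfl; exact boseSource_eq hD) (by rintro rfl; exact fermiSource_eq hD)]
  refine Eq.trans ?_ (PowerSeries.coeff_smul m (superTraceLog
    (D.supermatrix st Δ (srcParam P I T N) (srcO P) (D.srcS st) (D.srcSbar st)))
    (-(st.sign / 2))).symm
  rw [coeff_superTraceLog, smul_smul]
  cases m with
  -- At order zero both prefactors vanish, as they divide by 0.
  | zero => simp
  | succ m =>
    rw [superTrace_supermatrix_pow (isSupercommutative _ _) hD hΔ.inverse_mem
      (fun _ _ => srcParam_mem) srcO_mem srcS_mem srcSbar_mem]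
    -- This is G S = W V: the left side is formed over the even scalars, the right side in the full
    -- algebra of sources.
    have h1 : (hΔ.propagator T N * (sourceForm N hD + st.sign • (sourceForm N hD).transpose)).map
        Even.val = D.rightFactor st Δ (srcParam P I T N) (srcO P) (D.srcS st) (D.srcSbar st) *
          D.leftFactor (srcParam P I T N) N := by
      ext z z'
      rw [rightFactor_mul_leftFactor_apply (isSupercommutative _ _) hD hΔ.inverse_mem
        (fun _ _ => srcParam_mem) (fun g l => (commute_even (srcO_mem l) _).eq) srcS_mem srcSbar_mem]
      rw [Matrix.map_apply, Matrix.mul_apply, map_sum, Fintype.sum_sum_type]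
      rcases z with z | z
      · have e : ∀ y, hΔ.propagator T N (.inl z) (.inl y) = 0 := fun y => rfl
        simp only [e, zero_mul, map_zero, Finset.sum_const_zero, zero_add, map_mul]
        refine Finset.sum_congr rfl fun y _ => congrArg₂ _ rfl ?_
        have := val_symmetrize_sourceForm (N := N) hD 0 (fieldType z') y (fieldPos z')
        rwa [fieldSide_type] at this
      · have e : ∀ y, hΔ.propagator T N (.inr z) (.inr y) = 0 := fun y => rfl
        simp only [e, zero_mul, map_zero, Finset.sum_const_zero, add_zero, map_mul]
        refine Finset.sum_congr rfl fun y _ => congrArg₂ _ rfl ?_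
        have := val_symmetrize_sourceForm (N := N) hD 1 (fieldType z') y (fieldPos z')
        rwa [fieldSide_type] at this
    rw [← h1]
    have h2 : ∀ (k : ℕ) (M : Matrix ((I × A) ⊕ (I × A)) ((I × A) ⊕ (I × A))
        (Even (Lab N T I) (OddGen P N T I))), ((M ^ k).trace).val = ((M.map Even.val) ^ k).trace := by
      intro k M
      have h3 : (M ^ k).map Even.val = (M.map Even.val) ^ k :=
        map_pow (Even.val (E := Lab N T I) (O := OddGen P N T I)).mapMatrix M k
      rw [← h3, Matrix.trace, map_sum]
      rfl
    rw [h2]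
    congr 1
    field_simp

end Concrete

/-! ### The two forms of the supermatrix -/

section Forms
variable {P I A T R : Type*} {N : ℕ} [Ring R] [Algebra ℂ R]
  [Fintype I] [DecidableEq I] [Fintype A] [DecidableEq A] [Fintype T]
  {D : OperatorData P I A T} {st : Statistics} {Δ : Matrix (I × A) (I × A) (Gr P)}

lemma explicit_entry (m : Fin N) {g : ℕ → ℕ} (hg : Function.Injective g) (X : ℕ → A → R)
    (J : Lab N T I → R) (j : I) (w : Fin N → T → ℂ) (w' : T → ℂ) (hw : ∀ α, w m α = w' α)
    (t : T → A → ℂ) :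
    (∑ n : Fin N, ∑ a', ∑ α,
      if g n = g m then (w n α * t α a') • (X (g n) a' * J (n, α, j)) else 0) =
      ∑ a', X (g m) a' * ∑ α, (w' α * t α a') • J (m, α, j) := by
  rw [Finset.sum_eq_single m]
  · simp only [if_true, Finset.mul_sum, mul_smul_comm, hw]
  · intro n _ hn
    refine Finset.sum_eq_zero fun a' _ => Finset.sum_eq_zero fun α _ => if_neg fun h => hn ?_
    exact Fin.ext (hg h)
  · simp

lemma explicit_entry_ne {g : ℕ → ℕ} {r : ℕ} (hg : ∀ n, g n ≠ r) (X : ℕ → A → R)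
    (J : Lab N T I → R) (j : I) (w : Fin N → T → ℂ) (t : T → A → ℂ) (Y : A → R) :
    (∑ n : Fin N, ∑ a', ∑ α, if g n = r then (w n α * t α a') • (X (g n) a' * J (n, α, j)) else 0) =
      ∑ a', Y a' * 0 := by
  simp [hg]

lemma two_mul_injective : Function.Injective fun n : ℕ => 2 * n := fun a b h => by
  simpa using h

lemma two_mul_add_one_injective : Function.Injective fun n : ℕ => 2 * n + 1 := fun a b h => by
  simpa using h

lemma two_mul_ne_two_mul_add_one (n m : ℕ) : (fun n : ℕ => 2 * n) n ≠ 2 * m + 1 := by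
  simp only; omega

lemma two_mul_add_one_ne_two_mul (n m : ℕ) : (fun n : ℕ => 2 * n + 1) n ≠ 2 * m := by
  simp only; omega

lemma explicitKernel_apply_even (p : NK N) (i : I) (a : A) (c : Fin 2) (m : Fin N)
    (k : Fin (2 * m + 1)) (j : I) (b : A) (d : Fin 2) :
    explicitKernel N D st Δ ((p, i, a), c) ((⟨⟨2 * m, by omega⟩, k⟩, j, b), d) =
      D.supermatrix st Δ (srcParam P I T N) (srcO P) (D.srcS st) (D.srcSbar st)
        ((p, i, a), c) ((⟨⟨2 * m, by omega⟩, k⟩, j, b), d) := by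
  let X : ℕ → A → SrcAlg P N T I := fun n a' =>
    srcParam P I T N (D.kernel Δ p.1 p.2 i n k j a a')
  have e2 := fun (J : Lab N T I → SrcAlg P N T I) (w : ℂ) =>
    explicit_entry_ne (fun n => two_mul_add_one_ne_two_mul n m) X J j (fun _ _ => w)
      (fun α a' => D.t α a' b) (X (2 * m))
  have e1 := fun w => explicit_entry m two_mul_injective X (srcO P) j w
    (t := fun α a' => D.t α a' b)
  have hb := fun a' => D.srcBlock_even st (srcO P) (D.srcS st) (D.srcSbar st) m k j a' b
  rw [OperatorData.supermatrix, Matrix.of_apply]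
  simp only [hb]
  cases st with
  | bose =>
    fin_cases c <;> fin_cases d
    · exact e1 (fun _ _ => 1) _ fun _ => (one_pow _).symm
    · exact e2 _ _
    · exact e2 _ _
    · exact e1 (fun n α => (-1) ^ ((n : ℕ) + D.τ α)) _ fun α => by
        rw [Statistics.sign, one_pow, one_mul]
  | fermi =>
    fin_cases c <;> fin_cases d
    · exact e1 (fun _ _ => (-1) ^ (k : ℕ)) _ fun _ => rfl
    · exact e2 _ _
    · exact e2 _ _
    · exact e1 (fun n α => (-1) ^ ((n : ℕ) + 1 + k + D.τ α)) _ fun α => by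
        rw [Statistics.sign, ← pow_add]; congr 1; omega

lemma explicitKernel_apply_odd (p : NK N) (i : I) (a : A) (c : Fin 2) (m : Fin N)
    (k : Fin (2 * m + 1 + 1)) (j : I) (b : A) (d : Fin 2) :
    explicitKernel N D st Δ ((p, i, a), c) ((⟨⟨2 * m + 1, by omega⟩, k⟩, j, b), d) =
      D.supermatrix st Δ (srcParam P I T N) (srcO P) (D.srcS st) (D.srcSbar st)
        ((p, i, a), c) ((⟨⟨2 * m + 1, by omega⟩, k⟩, j, b), d) := by
  let X : ℕ → A → SrcAlg P N T I := fun n a' =>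
    srcParam P I T N (D.kernel Δ p.1 p.2 i n k j a a')
  have e2 := fun w : Fin N → T → ℂ =>
    explicit_entry_ne (fun n => two_mul_ne_two_mul_add_one n m) X (srcO P) j w
      (fun α a' => D.t α a' b) (X (2 * m + 1))
  have e1 := fun (J : Lab N T I → SrcAlg P N T I) (w : ℂ) =>
    explicit_entry m two_mul_add_one_injective X J j (fun _ _ => w)
    (t := fun α a' => D.t α a' b)
  have hb := fun a' => D.srcBlock_odd st (srcO P) (D.srcS st) (D.srcSbar st) m k j a' b
  rw [OperatorData.supermatrix, Matrix.of_apply]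
  simp only [hb]
  cases st with
  | bose =>
    have hw : (-2 * (-1) ^ (k : ℕ) : ℂ) = 2 * (-Statistics.bose.sign) ^ ((k : ℕ) + 1) := by
      rw [Statistics.sign, pow_succ]; ring
    fin_cases c <;> fin_cases d
    · exact e2 fun _ _ => 1
    · exact e1 _ _ _ fun _ => hw
    · exact e1 _ _ _ fun _ => hw
    · exact e2 fun n α => (-1) ^ ((n : ℕ) + D.τ α)
  | fermi =>
    have hw : (2 : ℂ) = 2 * (-Statistics.fermi.sign) ^ ((k : ℕ) + 1) := by
      rw [Statistics.sign, neg_neg, one_pow, mul_one]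
    fin_cases c <;> fin_cases d
    · exact e2 fun _ _ => (-1) ^ (k : ℕ)
    · exact e1 _ _ _ fun _ => hw
    · exact e1 _ _ _ fun _ => hw
    · exact e2 fun n α => (-1) ^ ((n : ℕ) + 1 + k + D.τ α)

theorem explicitKernel_eq : explicitKernel N D st Δ =
    D.supermatrix st Δ (srcParam P I T N) (srcO P) (D.srcS st) (D.srcSbar st) := by
  ext ⟨⟨p, i, a⟩, c⟩ ⟨⟨⟨⟨n, hn⟩, k⟩, j, b⟩, d⟩
  rcases Nat.even_or_odd' n with ⟨m, rfl | rfl⟩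
  · exact explicitKernel_apply_even p i a c ⟨m, by omega⟩ k j b d
  · exact explicitKernel_apply_odd p i a c ⟨m, by omega⟩ k j b d

lemma swap_mul_diag_mul (κ : R) (m₁ m₂ : ℂ) (e : Matrix (Fin 2) (Fin 2) R) :
    (!![0, κ; κ, 0] : Matrix (Fin 2) (Fin 2) R) * (!![m₁, 0; 0, m₂]).map (algebraMap ℂ R) * e =
      !![m₂ • (κ * e 1 0), m₂ • (κ * e 1 1); m₁ • (κ * e 0 0), m₁ • (κ * e 0 1)] := by
  have h : ∀ m : ℂ, κ * algebraMap ℂ R m = m • κ := fun m => by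
    rw [← Algebra.commutes, Algebra.smul_def]
  have hm : (!![m₁, 0; 0, m₂]).map (algebraMap ℂ R) =
      !![algebraMap ℂ R m₁, 0; 0, algebraMap ℂ R m₂] := by
    ext i j
    fin_cases i <;> fin_cases j <;> simp
  rw [hm, Matrix.mul_fin_two]
  simp only [zero_mul, mul_zero, zero_add, add_zero, h]
  ext i j
  fin_cases i <;> fin_cases j <;> simp [Matrix.mul_apply, Fin.sum_univ_two]

lemma sum_signMatrix (q : NK N) (κ : NK N → A → R) (t : T → A → ℂ)
    (e : T → Matrix (Fin 2) (Fin 2) R) (c d : Fin 2) :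
    ∑ r : NK N, ∑ a', ∑ α, t α a' • ((!![0, κ r a'; κ r a', 0] : Matrix (Fin 2) (Fin 2) R) *
      (signMatrix st r q).map (algebraMap ℂ R) * e α) c d =
    ∑ a', ∑ α, t α a' • ((!![0, κ q a'; κ q a', 0] : Matrix (Fin 2) (Fin 2) R) *
      (signMatrix st q q).map (algebraMap ℂ R) * e α) c d := by
  rw [Finset.sum_eq_single q]
  · intro r _ hr
    have h0 : signMatrix st r q = 0 := if_neg hr
    have h1 : (signMatrix st r q).map (algebraMap ℂ R) = 0 := by
      rw [h0]
      ext i j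
      simp
    refine Finset.sum_eq_zero fun a' _ => Finset.sum_eq_zero fun α _ => ?_
    rw [h1, Matrix.mul_zero, Matrix.zero_mul, Matrix.zero_apply, smul_zero]
  · simp

lemma super_entry (X : A → R) (t : T → A → ℂ) (e : T → R) (w : T → ℂ) (f : T → A → R)
    (hf : ∀ α a, (2 : ℂ) • f α a = w α • (X a * e α)) :
    (2 : ℂ) • ∑ a', ∑ α, t α a' • f α a' = ∑ a', X a' * ∑ α, (w α * t α a') • e α := by
  simp only [Finset.smul_sum, Finset.mul_sum]
  refine Finset.sum_congr rfl fun a _ => Finset.sum_congr rfl fun α _ => ?_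
  rw [smul_comm, hf, smul_smul, mul_comm, mul_smul_comm]

lemma two_smul_smul_half (x e : R) (m w : ℂ) :
    (2 : ℂ) • m • (x * (w / 2) • e) = (m * w) • (x * e) := by
  rw [mul_smul_comm, smul_smul, smul_smul]
  congr 1
  ring

lemma two_smul_smul (x e : R) (m : ℂ) : (2 : ℂ) • m • (x * e) = (2 * m) • (x * e) :=
  smul_smul _ _ _

lemma smul_mul_zero (w : ℂ) (x : R) : w • (x * 0) = 0 := by
  rw [mul_zero, smul_zero]

lemma super_entry_zero (X : A → R) (t : T → A → ℂ) (f : T → A → R) (hf : ∀ α a, f α a = 0) :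
    (2 : ℂ) • ∑ a', ∑ α, t α a' • f α a' = ∑ a', X a' * 0 := by
  simp [hf]

lemma two_smul_superKernel_apply_even (p : NK N) (i : I) (a : A) (c : Fin 2) (m : Fin N)
    (k : Fin (2 * m + 1)) (j : I) (b : A) (d : Fin 2) :
    (2 : ℂ) • superKernel N D st Δ ((p, i, a), c) ((⟨⟨2 * m, by omega⟩, k⟩, j, b), d) =
      D.supermatrix st Δ (srcParam P I T N) (srcO P) (D.srcS st) (D.srcSbar st)
        ((p, i, a), c) ((⟨⟨2 * m, by omega⟩, k⟩, j, b), d) := by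
  let q : NK N := ⟨⟨2 * m, by omega⟩, k⟩
  let κ : NK N → A → SrcAlg P N T I := fun r a' =>
    srcParam P I T N (D.kernel Δ p.1 p.2 i r.1 r.2 j a a')
  have h0 := sum_signMatrix (st := st) q κ (fun α a' => D.t α a' b)
    (fun α => D.sourceMatrix st q.1 α j) c d
  have hb := fun a' => D.srcBlock_even st (srcO P) (D.srcS st) (D.srcSbar st) m k j a' b
  have hq : Even (2 * (m : ℕ)) := even_two_mul _
  have hm : 2 * (m : ℕ) / 2 = m := by omega
  -- The entries of M^± brought into one formula for both statistics, which can be compared with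
  -- `srcBlock`.
  have hM : signMatrix st q q = !![st.sign ^ (k : ℕ) * (st.sign * (-1) ^ (m : ℕ)), 0;
      0, st.sign ^ (k : ℕ)] := by
    cases st with
    | bose =>
      simp only [signMatrix, if_true, q, hq, hm, Statistics.sign, one_pow, one_mul]
    | fermi =>
      simp only [signMatrix, if_true, q, hq, hm, Statistics.sign]
      have h : (-1 : ℂ) ^ ((m : ℕ) + k + 1) = (-1) ^ (k : ℕ) * (-1 * (-1) ^ (m : ℕ)) := by ring
      rw [h]
  have hs : ∀ α, D.sourceMatrix st q.1 α j =
      !![0, ((-1 : ℂ) ^ D.τ α / 2) • srcO P (m, α, j); (1 / 2 : ℂ) • srcO P (m, α, j), 0] := by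
    intro α
    simp only [OperatorData.sourceMatrix, q, hq, hm, if_true]
  rw [superKernel, Matrix.of_apply]
  refine (congrArg ((2 : ℂ) • ·) h0).trans ?_
  simp only [hM, hs, swap_mul_diag_mul]
  rw [OperatorData.supermatrix, Matrix.of_apply]
  simp only [hb]
  let X := κ q
  let J : T → SrcAlg P N T I := fun α => srcO P (m, α, j)
  have hz : ∀ w : ℂ, (2 : ℂ) • ∑ a', ∑ α, D.t α a' b • w • (X a' * 0) = ∑ a', X a' * 0 :=
    fun w => super_entry_zero X (fun α a' => D.t α a' b) (fun α a' => w • (X a' * 0))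
      fun α a' => smul_mul_zero w _
  fin_cases c <;> fin_cases d
  · exact super_entry X (fun α a' => D.t α a' b) J (fun _ => st.sign ^ (k : ℕ))
      (fun α a' => st.sign ^ (k : ℕ) • (X a' * (1 / 2 : ℂ) • J α))
      fun α a' => (two_smul_smul_half (X a') (J α) _ _).trans (congrArg (· • _) (mul_one _))
  · exact hz _
  · exact hz _
  · exact super_entry X (fun α a' => D.t α a' b) J
      (fun α => st.sign ^ ((k : ℕ) + 1) * (-1) ^ ((m : ℕ) + D.τ α))
      (fun α a' => (st.sign ^ (k : ℕ) * (st.sign * (-1) ^ (m : ℕ))) •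
        (X a' * ((-1 : ℂ) ^ D.τ α / 2) • J α))
      fun α a' => (two_smul_smul_half (X a') (J α) _ _).trans (congrArg (· • _) (by ring))

lemma two_smul_superKernel_apply_odd (p : NK N) (i : I) (a : A) (c : Fin 2) (m : Fin N)
    (k : Fin (2 * m + 1 + 1)) (j : I) (b : A) (d : Fin 2) :
    (2 : ℂ) • superKernel N D st Δ ((p, i, a), c) ((⟨⟨2 * m + 1, by omega⟩, k⟩, j, b), d) =
      D.supermatrix st Δ (srcParam P I T N) (srcO P) (D.srcS st) (D.srcSbar st)
        ((p, i, a), c) ((⟨⟨2 * m + 1, by omega⟩, k⟩, j, b), d) := by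
  let q : NK N := ⟨⟨2 * m + 1, by omega⟩, k⟩
  let κ : NK N → A → SrcAlg P N T I := fun r a' =>
    srcParam P I T N (D.kernel Δ p.1 p.2 i r.1 r.2 j a a')
  have h0 := sum_signMatrix (st := st) q κ (fun α a' => D.t α a' b)
    (fun α => D.sourceMatrix st q.1 α j) c d
  have hb := fun a' => D.srcBlock_odd st (srcO P) (D.srcS st) (D.srcSbar st) m k j a' b
  have hq : ¬ Even (2 * (m : ℕ) + 1) := Nat.not_even_bit1 _
  have hm : (2 * (m : ℕ) + 1) / 2 = m := by omega
  have hM : signMatrix st q q =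
      !![(-st.sign) ^ ((k : ℕ) + 1), 0; 0, (-st.sign) ^ ((k : ℕ) + 1)] := by
    cases st with
    | bose => simp only [signMatrix, if_true, q, hq, Statistics.sign, if_false]
    | fermi =>
      simp only [signMatrix, if_true, q, hq, Statistics.sign, if_false, neg_neg, one_pow]
  have hs : ∀ α, D.sourceMatrix st q.1 α j =
      !![D.srcS st (m, α, j), 0; 0, D.srcSbar st (m, α, j)] := by
    intro α
    simp only [OperatorData.sourceMatrix, q, hq, hm, if_false]
  rw [superKernel, Matrix.of_apply]
  refine (congrArg ((2 : ℂ) • ·) h0).trans ?_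
  simp only [hM, hs, swap_mul_diag_mul]
  rw [OperatorData.supermatrix, Matrix.of_apply]
  simp only [hb]
  let X := κ q
  have hz : ∀ w : ℂ, (2 : ℂ) • ∑ a', ∑ α, D.t α a' b • w • (X a' * 0) = ∑ a', X a' * 0 :=
    fun w => super_entry_zero X (fun α a' => D.t α a' b) (fun α a' => w • (X a' * 0))
      fun α a' => smul_mul_zero w _
  fin_cases c <;> fin_cases d
  · exact hz _
  · exact super_entry X (fun α a' => D.t α a' b) (fun α => D.srcSbar st (m, α, j))
      (fun _ => 2 * (-st.sign) ^ ((k : ℕ) + 1))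
      (fun α a' => (-st.sign) ^ ((k : ℕ) + 1) • (X a' * D.srcSbar st (m, α, j)))
      fun α a' => two_smul_smul (X a') _ _
  · exact super_entry X (fun α a' => D.t α a' b) (fun α => D.srcS st (m, α, j))
      (fun _ => 2 * (-st.sign) ^ ((k : ℕ) + 1))
      (fun α a' => (-st.sign) ^ ((k : ℕ) + 1) • (X a' * D.srcS st (m, α, j)))
      fun α a' => two_smul_smul (X a') _ _
  · exact hz _

theorem two_smul_superKernel_eq : (2 : ℂ) • superKernel N D st Δ =
    D.supermatrix st Δ (srcParam P I T N) (srcO P) (D.srcS st) (D.srcSbar st) := by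
  ext ⟨⟨p, i, a⟩, c⟩ ⟨⟨⟨⟨n, hn⟩, k⟩, j, b⟩, d⟩
  rw [Matrix.smul_apply]
  rcases Nat.even_or_odd' n with ⟨m, rfl | rfl⟩
  · exact two_smul_superKernel_apply_even p i a c ⟨m, by omega⟩ k j b d
  · exact two_smul_superKernel_apply_odd p i a c ⟨m, by omega⟩ k j b d

end Forms

/-! ### Sums over paths -/

section Paths
variable {S V W : Type*} [Ring S] [Fintype V] [Fintype W] [DecidableEq V] [DecidableEq W]

lemma sum_fin_cons {M : Type*} [AddCommMonoid M] {m : ℕ} (f : (Fin (m + 1) → W) → M) :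
    ∑ x, f x = ∑ y, ∑ x, f (Fin.cons y x) := by
  rw [← (Fin.consEquiv fun _ : Fin (m + 1) => W).sum_comp, Fintype.sum_prod_type]
  rfl

/-- The expansion of a matrix power into a sum over paths. -/
lemma pow_apply_eq_sum_paths (π : W → V) (C : V → W → S) (B : Matrix V V S)
    (hB : ∀ v v', B v v' = ∑ y, if π y = v' then C v y else 0) (m : ℕ) (y : W) (v : V) :
    (B ^ m) (π y) v = ∑ x : Fin m → W,
      if π ((Fin.cons y x : Fin (m + 1) → W) (Fin.last m)) = v then
        (List.ofFn fun j : Fin m => C (π ((Fin.cons y x : Fin (m + 1) → W) j.castSucc)) (x j)).prod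
      else 0 := by
  induction m generalizing y with
  | zero =>
    rw [Fintype.sum_unique]
    simp [Matrix.one_apply]
  | succ m ih =>
    rw [pow_succ', Matrix.mul_apply, sum_fin_cons]
    simp only [hB, Finset.sum_mul, ite_mul, zero_mul]
    rw [Finset.sum_comm]
    refine Finset.sum_congr rfl fun z _ => ?_
    rw [Finset.sum_ite_eq]
    simp only [Finset.mem_univ, if_true]
    rw [ih z, Finset.mul_sum]
    refine Finset.sum_congr rfl fun x _ => ?_
    rw [mul_ite, mul_zero, List.ofFn_succ, List.prod_cons]
    rfl

/-- The expansion of a weighted trace of a matrix power into a sum over cyclic paths. -/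
lemma sum_smul_pow_apply_eq_sum_paths [Algebra ℂ S] (π : W → V) (C : V → W → S) (B : Matrix V V S)
    (hB : ∀ v v', B v v' = ∑ y, if π y = v' then C v y else 0) (m : ℕ) (e : V → ℂ) :
    ∑ v, e v • (B ^ (m + 1)) v v = ∑ x : Fin (m + 1) → W,
      e (π (x 0)) • (List.ofFn fun j => C (π (x j)) (x (j + 1))).prod := by
  have h1 : ∀ v, (B ^ (m + 1)) v v = ∑ y, ∑ x : Fin m → W,
      if π ((Fin.cons y x : Fin (m + 1) → W) (Fin.last m)) = v then
        C v y * (List.ofFn fun j : Fin m =>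
          C (π ((Fin.cons y x : Fin (m + 1) → W) j.castSucc)) (x j)).prod
      else 0 := by
    intro v
    rw [pow_succ', Matrix.mul_apply]
    simp only [hB, Finset.sum_mul, ite_mul, zero_mul]
    rw [Finset.sum_comm]
    refine Finset.sum_congr rfl fun z _ => ?_
    rw [Finset.sum_ite_eq]
    simp only [Finset.mem_univ, if_true]
    rw [pow_apply_eq_sum_paths π C B hB m z, Finset.mul_sum]
    simp only [mul_ite, mul_zero]
  let F : (Fin (m + 1) → W) → S := fun z => e (π (z (Fin.last m))) •
    (C (π (z (Fin.last m))) (z 0) *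
      (List.ofFn fun j : Fin m => C (π (z j.castSucc)) (z j.succ)).prod)
  calc ∑ v, e v • (B ^ (m + 1)) v v = ∑ z, F z := by
        simp only [h1, Finset.smul_sum, smul_ite, smul_zero]
        rw [Finset.sum_comm, sum_fin_cons]
        refine Finset.sum_congr rfl fun y _ => ?_
        rw [Finset.sum_comm]
        refine Finset.sum_congr rfl fun x _ => ?_
        rw [Finset.sum_ite_eq]
        simp [F]
    _ = _ := by
        -- In `F` the path closes at its last vertex; a rotation of the positions moves the weighted
        -- vertex to position 0.
        rw [← (Equiv.arrowCongr (Equiv.addRight (1 : Fin (m + 1))).symm (Equiv.refl W)).sum_comp]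
        refine Finset.sum_congr rfl fun x _ => ?_
        rw [List.ofFn_succ, List.prod_cons]
        simp [F, Equiv.arrowCongr]

end Paths

/-- The sum over all choices of vertices with prescribed labels. -/
lemma sum_prescribed_labels {L M : Type*} [Fintype L] [DecidableEq L] [AddCommMonoid M] {h : L → ℕ}
    {r : ℕ} (l : Fin r → L) (σ : Equiv.Perm (Fin r)) (F : (Fin r → Σ l, Fin (h l)) → M) :
    (∑ x : Fin r → Σ l, Fin (h l), if ∀ i, l (σ i) = (x i).1 then F x else 0) =
      ∑ k : (m : Fin r) → Fin (h (l m)), F fun m => ⟨l (σ m), k (σ m)⟩ := by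
  rw [← Finset.sum_filter]
  symm
  refine Finset.sum_bij (fun k _ m => ⟨l (σ m), k (σ m)⟩) ?_ ?_ ?_ ?_
  · intro k _
    simp
  · intro k _ k' _ hk
    funext m
    have := congrFun hk (σ.symm m)
    simp only [Equiv.apply_symm_apply, Sigma.mk.injEq, heq_eq_eq, true_and] at this
    obtain ⟨i, rfl⟩ := σ.surjective m
    have := congrFun hk i
    simpa using this
  · intro x hx
    simp only [Finset.mem_filter, Finset.mem_univ, true_and] at hx
    refine ⟨fun m => Fin.cast (by rw [← hx, σ.apply_symm_apply]) (x (σ.symm m)).2,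
      Finset.mem_univ _, ?_⟩
    funext m
    -- The label is kept as a free variable, so that the equality can be substituted and the cast
    -- disappears.
    have h1 : ∀ (y : Σ l, Fin (h l)) (a : L) (ha : a = y.1) (e : h y.1 = h a),
        (⟨a, Fin.cast e y.2⟩ : Σ l, Fin (h l)) = y := by
      rintro ⟨y, k⟩ a rfl e
      rfl
    have h2 := σ.symm_apply_apply m
    have h3 : ∀ i (hi : i = m) (e : h (x i).1 = h (l (σ m))),
        (⟨l (σ m), Fin.cast e (x i).2⟩ : Σ l, Fin (h l)) = x m := by
      rintro i rfl e
      exact h1 _ _ (hx _) e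
    exact h3 _ h2 _
  · intro k _
    rfl

/-! ### Iterated derivatives of products of generators -/

/-- Omitting the factor p is written through the transposition of 0 and p, in the form in which
`Equiv.Perm.decomposeFin` splits a permutation off its value at 0. -/
lemma prod_swap_succ {M : Type*} [CommMonoid M] {r : ℕ} (f : Fin (r + 1) → M) (p : Fin (r + 1)) :
    ∏ j ∈ Finset.univ.erase p, f j = ∏ i : Fin r, f (Equiv.swap 0 p i.succ) := by
  classical
  have hp : ∀ i : Fin r, Equiv.swap 0 p i.succ ≠ p := by
    intro i h
    have : i.succ = 0 := by
      apply (Equiv.swap 0 p).injective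
      rw [h, Equiv.swap_apply_left]
    exact Fin.succ_ne_zero i this
  have h1 : ∏ j ∈ Finset.univ.erase p, f j = ∏ j, if j = p then 1 else f j := by
    rw [← Finset.mul_prod_erase _ _ (Finset.mem_univ p), if_pos rfl, one_mul]
    exact Finset.prod_congr rfl fun j hj => (if_neg (Finset.ne_of_mem_erase hj)).symm
  rw [h1, ← (Equiv.prod_comp (Equiv.swap 0 p)), Fin.prod_univ_succ, Equiv.swap_apply_left, if_pos rfl,
    one_mul]
  exact Finset.prod_congr rfl fun i _ => if_neg (hp i)

lemma derivation_prod {B ι : Type*} [CommRing B] [Algebra ℂ B] [DecidableEq ι]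
    (d : Derivation ℂ B B) (s : Finset ι) (f : ι → B) :
    d (∏ j ∈ s, f j) = ∑ p ∈ s, (∏ j ∈ s.erase p, f j) * d (f p) := by
  induction s using Finset.induction_on with
  | empty => simp
  | insert a s ha ih =>
    rw [Finset.prod_insert ha, d.leibniz, ih, Finset.sum_insert ha, Finset.erase_insert ha,
      smul_eq_mul, smul_eq_mul, add_comm, Finset.mul_sum]
    congr 1
    refine Finset.sum_congr rfl fun p hp => ?_
    have hpa : p ≠ a := fun h => ha (h ▸ hp)
    rw [Finset.erase_insert_of_ne hpa.symm, Finset.prod_insert (fun h => ha (Finset.mem_of_mem_erase h)),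
      mul_assoc]

/-- The permanent of the incidence matrix of two families. -/
lemma prod_pderiv_prod_X {E : Type*} [DecidableEq E] {r : ℕ} (l x : Fin r → E) :
    (List.ofFn fun i => ((MvPolynomial.pderiv (R := ℂ) (l i)).toLinearMap :
      Module.End ℂ (MvPolynomial E ℂ))).prod (∏ j, MvPolynomial.X (x j)) =
      ∑ σ : Equiv.Perm (Fin r), if ∀ i, l (σ i) = x i then 1 else 0 := by
  -- With the list reversed the derivative of index 0 acts first, which fits an induction that
  -- splits off the value of the permutation at 0.
  have key : ∀ (r : ℕ) (l x : Fin r → E),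
      (List.ofFn fun i => ((MvPolynomial.pderiv (R := ℂ) (l i.rev)).toLinearMap :
        Module.End ℂ (MvPolynomial E ℂ))).prod (∏ j, MvPolynomial.X (x j)) =
        ∑ σ : Equiv.Perm (Fin r), if ∀ i, l i = x (σ i) then 1 else 0 := by
    intro r
    induction r with
    | zero =>
      intro l x
      simp
    | succ r ih =>
      intro l x
      rw [List.ofFn_succ', List.concat_eq_append, List.prod_append]
      simp only [Fin.rev_castSucc, Fin.rev_last, List.prod_singleton]
      have h1 : MvPolynomial.pderiv (R := ℂ) (l 0) (∏ j, MvPolynomial.X (x j)) =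
          ∑ p, if l 0 = x p then ∏ i : Fin r, MvPolynomial.X (x (Equiv.swap 0 p i.succ)) else 0 := by
        rw [derivation_prod]
        refine Finset.sum_congr rfl fun p _ => ?_
        rw [MvPolynomial.pderiv_X, Pi.single_apply, prod_swap_succ]
        simp [eq_comm, mul_ite]
      rw [Module.End.mul_apply, Derivation.coeFn_coe, h1, map_sum,
        ← Equiv.Perm.decomposeFin.symm.sum_comp, Fintype.sum_prod_type]
      refine Finset.sum_congr rfl fun p _ => ?_
      simp only [Fin.forall_fin_succ, Equiv.Perm.decomposeFin_symm_apply_zero,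
        Equiv.Perm.decomposeFin_symm_apply_succ]
      split_ifs with h
      · simp only [h, true_and]
        exact ih (fun i => l i.succ) fun i => x (Equiv.swap 0 p i.succ)
      · simp [h]
  have := key r (fun i => l i.rev) x
  simp only [Fin.rev_rev] at this
  rw [this]
  -- The permutation is inverted, since derivatives rather than variables are to be permuted, and
  -- composed with the reversal to undo the reversed order.
  refine Fintype.sum_equiv ((Equiv.inv _).trans (Equiv.mulLeft Fin.revPerm)) _ _ fun σ => ?_
  refine if_congr ?_ rfl rfl
  refine ⟨fun h i => ?_, fun h i => ?_⟩
  · simpa using h (σ.symm i)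
  · simpa using h (σ i)

lemma deriv_prod_gen_mul {R : Type*} [Ring R] [Algebra ℂ R] {n : ℕ} (d : Module.End ℂ R)
    (θ : Fin (n + 1) → R) (a : Fin (n + 1) → ℂ) (hd : ∀ j x, d (θ j * x) = a j • x - θ j * d x)
    (x : R) (hx : d x = 0) : d ((List.ofFn θ).prod * x) =
      ∑ p : Fin (n + 1), ((-1) ^ (p : ℕ) * a p) • ((List.ofFn fun i => θ (p.succAbove i)).prod * x) := by
  induction n with
  | zero => simp [hd, hx]
  | succ n ih =>
    rw [List.ofFn_succ, List.prod_cons, mul_assoc, hd, ih _ _ fun j => hd j.succ,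
      Fin.sum_univ_succ (n := n + 1), sub_eq_add_neg]
    congr 1
    · simp
    · rw [Finset.mul_sum, ← Finset.sum_neg_distrib]
      refine Finset.sum_congr rfl fun p _ => ?_
      rw [List.ofFn_succ, List.prod_cons]
      simp only [Fin.succ_succAbove_zero, Fin.succ_succAbove_succ, Fin.val_succ]
      rw [mul_smul_comm, ← neg_smul, mul_assoc, pow_succ]
      congr 1
      ring

/-- Iterated derivatives of a product of anticommuting generators form a determinant. -/
lemma prod_deriv_prod_gen {R : Type*} [Ring R] [Algebra ℂ R] {r : ℕ}
    (d : Fin r → Module.End ℂ R) (θ : Fin r → R) (δ : Matrix (Fin r) (Fin r) ℂ)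
    (hd : ∀ i j x, d i (θ j * x) = δ i j • x - θ j * d i x) (x : R) (hx : ∀ i, d i x = 0) :
    (List.ofFn d).prod ((List.ofFn θ).prod * x) =
      (((Equiv.Perm.sign (Fin.revPerm : Equiv.Perm (Fin r)) : ℤ) : ℂ) * δ.det) • x := by
  have key : ∀ (r : ℕ) (d : Fin r → Module.End ℂ R) (θ : Fin r → R) (δ : Matrix (Fin r) (Fin r) ℂ),
      (∀ i j x, d i (θ j * x) = δ i j • x - θ j * d i x) → (∀ i, d i x = 0) →
      (List.ofFn fun i => d i.rev).prod ((List.ofFn θ).prod * x) = δ.det • x := by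
    intro r
    induction r with
    | zero =>
      intro d θ δ _ _
      simp
    | succ r ih =>
      intro d θ δ hd hx
      rw [List.ofFn_succ', List.concat_eq_append, List.prod_append]
      simp only [Fin.rev_castSucc, Fin.rev_last, List.prod_singleton]
      rw [Module.End.mul_apply, deriv_prod_gen_mul (d 0) θ (δ 0) (hd 0) x (hx 0), map_sum,
        Matrix.det_succ_row_zero, Finset.sum_smul]
      refine Finset.sum_congr rfl fun p _ => ?_
      rw [map_smul, ih (fun i => d i.succ) (fun i => θ (p.succAbove i))
        (δ.submatrix Fin.succ p.succAbove) (fun i j => hd i.succ (p.succAbove j))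
        (fun i => hx i.succ), smul_smul]
  -- Returning to the original order reverses the rows of the matrix, and the determinant acquires
  -- the sign of the reversal.
  have := key r (fun i => d i.rev) θ (δ.submatrix Fin.revPerm id) (fun i j => hd i.rev j)
    fun i => hx i.rev
  simp only [Fin.rev_rev] at this
  rw [this, Matrix.det_permute]

/-- The reordering of products of pairs of anticommuting elements. -/
lemma prod_mul_eq_of_anticommute {S : Type*} [Ring S] {r : ℕ} (f g : Fin r → S)
    (h : ∀ i j, g i * f j = -(f j * g i)) :
    (List.ofFn fun i => f i * g i).prod =
      (-1) ^ (r * (r - 1) / 2) * ((List.ofFn f).prod * (List.ofFn g).prod) := by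
  have key : ∀ (r : ℕ) (f : Fin r → S) (x : S), (∀ j, x * f j = -(f j * x)) →
      x * (List.ofFn f).prod = (-1) ^ r * ((List.ofFn f).prod * x) := by
    intro r
    induction r with
    | zero => intro f x _; simp
    | succ r ih =>
      intro f x hx
      rw [List.ofFn_succ, List.prod_cons, ← mul_assoc, hx, neg_mul, mul_assoc,
        ih (fun i => f i.succ) x fun j => hx j.succ, ← mul_assoc (f 0),
        ← ((Commute.neg_one_left (f 0)).pow_left r).eq, pow_succ']
      simp only [mul_assoc, neg_mul, one_mul]
  induction r with
  | zero => simp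
  | succ r ih =>
    rw [List.ofFn_succ, List.prod_cons, ih _ _ fun i j => h i.succ j.succ, List.ofFn_succ (f := f),
      List.prod_cons, List.ofFn_succ (f := g), List.prod_cons]
    have h1 := key r (fun i => f i.succ) (g 0) fun j => h 0 j.succ
    set F := (List.ofFn fun i : Fin r => f i.succ).prod
    set G := (List.ofFn fun i : Fin r => g i.succ).prod
    have hc : ∀ (n : ℕ) (x : S), x * (-1) ^ n = (-1) ^ n * x := fun n x =>
      ((Commute.neg_one_left x).pow_left n).eq.symm
    have h2 : (r + 1) * (r + 1 - 1) / 2 = r * (r - 1) / 2 + r := by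
      rw [← Finset.sum_range_id_mul_two, ← Finset.sum_range_id_mul_two, Nat.mul_div_cancel _ two_pos,
        Nat.mul_div_cancel _ two_pos, Finset.sum_range_succ]
    calc f 0 * g 0 * ((-1) ^ (r * (r - 1) / 2) * (F * G))
        = f 0 * g 0 * (-1) ^ (r * (r - 1) / 2) * (F * G) := (mul_assoc _ _ _).symm
      _ = (-1) ^ (r * (r - 1) / 2) * (f 0 * (g 0 * F) * G) := by
        rw [hc]; simp only [mul_assoc]
      _ = _ := by
        rw [h1, ← mul_assoc (f 0), hc, h2, pow_add]; simp only [mul_assoc]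

/-! ### Rescaling the sources -/

/-- The rescaling of the generators of a Grassmann algebra. -/
def Gr.scale {σ : Type*} (s : σ → ℂ) : Gr σ →ₐ[ℂ] Gr σ :=
  ExteriorAlgebra.map (Finsupp.linearCombination ℂ fun o => Finsupp.single o (s o))

lemma Gr.scale_gen {σ : Type*} (s : σ → ℂ) (o : σ) : Gr.scale s (Gr.gen o) = s o • Gr.gen o := by
  rw [Gr.scale, Gr.gen, ExteriorAlgebra.map_apply_ι, Finsupp.linearCombination_single, one_smul,
    ← map_smul, Finsupp.smul_single, smul_eq_mul, mul_one]

/-- The chain rule for a diagonal substitution of the odd generators. -/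
lemma Gr.deriv_scale {σ : Type*} (s : σ → ℂ) (o : σ) (g : Gr σ) :
    Gr.deriv o (Gr.scale s g) = s o • Gr.scale s (Gr.deriv o g) := by
  have hL : ∀ m : σ →₀ ℂ,
      (Finsupp.linearCombination ℂ (fun o => Finsupp.single o (s o)) m : σ →₀ ℂ) o = s o * m o := by
    intro m
    induction m using Finsupp.induction_linear with
    | zero => simp
    | add x y hx hy => rw [map_add, Finsupp.add_apply, hx, hy, Finsupp.add_apply, mul_add]
    | single o' r =>
      rw [Finsupp.linearCombination_single]
      by_cases h : o' = o
      · subst h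
        simp [mul_comm]
      · simp [Finsupp.single_apply, h]
  induction g using CliffordAlgebra.left_induction with
  | algebraMap r =>
    rw [AlgHom.commutes, Gr.deriv, CliffordAlgebra.contractLeft_algebraMap, map_zero, smul_zero]
  | add x y hx hy => simp only [map_add, hx, hy, smul_add]
  | ι_mul x m hx =>
    have h1 : Gr.scale s (CliffordAlgebra.ι 0 m * x) =
        ExteriorAlgebra.ι ℂ (Finsupp.linearCombination ℂ (fun o => Finsupp.single o (s o)) m) *
          Gr.scale s x := by
      rw [map_mul]
      congr 1
      exact ExteriorAlgebra.map_apply_ι _ _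
    have h2 : Gr.scale s (ExteriorAlgebra.ι ℂ m) =
        ExteriorAlgebra.ι ℂ (Finsupp.linearCombination ℂ (fun o => Finsupp.single o (s o)) m) :=
      ExteriorAlgebra.map_apply_ι _ _
    have h3 := Gr.deriv_ι_mul o m x
    rw [h1, Gr.deriv_ι_mul, hL, hx]
    refine Eq.trans ?_ (congrArg (fun z => s o • Gr.scale s z) h3).symm
    simp only [map_sub, map_smul, map_mul, h2, smul_sub, smul_smul, mul_smul_comm]

section Scale
variable {P I T : Type*} {N : ℕ}

/-- The scale factors of the odd generators. -/
def oddScale (P : Type*) {N : ℕ} {T I : Type*} (b c : ℂ) : OddGen P N T I → ℂ :=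
  Sum.elim (fun _ => 1) (Sum.elim (fun _ => b) fun _ => c)

/-- The rescaling of the sources `J_O`, `J_S`, `J̄_S` by the factors `a`, `b`, `c`. -/
def scaleSources (P : Type*) (N : ℕ) (T I : Type*) (a b c : ℂ) :
    SrcAlg P N T I →ₐ[ℂ] SrcAlg P N T I :=
  Algebra.TensorProduct.map (MvPolynomial.aeval fun l => a • MvPolynomial.X l)
    (Gr.scale (oddScale P b c))

variable (a b c : ℂ)

lemma scaleSources_tmul (f : MvPolynomial (Lab N T I) ℂ) (g : Gr (OddGen P N T I)) :
    scaleSources P N T I a b c (f ⊗ₜ g) =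
      MvPolynomial.aeval (fun l => a • MvPolynomial.X l) f ⊗ₜ Gr.scale (oddScale P b c) g := rfl

lemma scaleSources_ofGr (g : Gr (OddGen P N T I)) :
    scaleSources P N T I a b c (ofGr g) = ofGr (Gr.scale (oddScale P b c) g) := by
  refine (scaleSources_tmul a b c 1 g).trans ?_
  rw [map_one]
  rfl

lemma scaleSources_evenVar (l : Lab N T I) :
    scaleSources P N T I a b c (evenVar l) = a • evenVar l := by
  refine (scaleSources_tmul a b c _ 1).trans ?_
  rw [map_one, MvPolynomial.aeval_X]
  exact (TensorProduct.smul_tmul' a _ _).symm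

lemma scaleSources_oddVar (o : OddGen P N T I) :
    scaleSources P N T I a b c (oddVar o) = oddScale P b c o • oddVar o := by
  rw [oddVar, scaleSources_ofGr, Gr.scale_gen, map_smul]

lemma scaleSources_srcParam (g : Gr P) :
    scaleSources P N T I a b c (srcParam P I T N g) = srcParam P I T N g := by
  have h : (Gr.scale (oddScale P b c)).comp (Gr.inl P (Lab N T I ⊕ Lab N T I)) = Gr.inl P _ := by
    refine ExteriorAlgebra.hom_ext (Finsupp.lhom_ext' fun p => LinearMap.ext_ring ?_)
    simp [Gr.inl, Gr.scale, oddScale]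
  rw [srcParam, AlgHom.comp_apply, scaleSources_ofGr]
  exact congrArg ofGr (DFunLike.congr_fun h g)

lemma derivO_scaleSources (l : Lab N T I) (x : SrcAlg P N T I) :
    derivO P l (scaleSources P N T I a b c x) = a • scaleSources P N T I a b c (derivO P l x) := by
  have h : ∀ f : MvPolynomial (Lab N T I) ℂ, MvPolynomial.pderiv l
      (MvPolynomial.aeval (fun l => a • MvPolynomial.X l) f : MvPolynomial (Lab N T I) ℂ) =
      a • MvPolynomial.aeval (fun l => a • MvPolynomial.X l) (MvPolynomial.pderiv l f) := by
    intro f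
    classical
    induction f using MvPolynomial.induction_on with
    | C r => simp
    | add f g hf hg => simp only [map_add, hf, hg, smul_add]
    | mul_X f m hf =>
      simp only [map_mul, Derivation.leibniz, hf, map_add, MvPolynomial.aeval_X, smul_eq_mul,
        Derivation.map_smul, MvPolynomial.pderiv_X, Pi.single_apply, smul_add]
      split_ifs <;> simp
  induction x using TensorProduct.induction_on with
  | zero => simp only [map_zero, smul_zero]
  | add x y hx hy => simp only [map_add, hx, hy, smul_add]
  | tmul f g =>
    rw [scaleSources_tmul, derivO, LinearMap.rTensor_tmul, LinearMap.rTensor_tmul,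
      scaleSources_tmul, Derivation.coeFn_coe, h, TensorProduct.smul_tmul']

lemma derivOdd_scaleSources (o : OddGen P N T I) (x : SrcAlg P N T I) :
    derivOdd o (scaleSources P N T I a b c x) =
      oddScale P b c o • scaleSources P N T I a b c (derivOdd o x) := by
  induction x using TensorProduct.induction_on with
  | zero => simp only [map_zero, smul_zero]
  | add x y hx hy => simp only [map_add, hx, hy, smul_add]
  | tmul f g =>
    rw [scaleSources_tmul, derivOdd, LinearMap.lTensor_tmul, LinearMap.lTensor_tmul,
      scaleSources_tmul, Gr.deriv_scale, TensorProduct.tmul_smul]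

lemma atZero_tmul (f : MvPolynomial (Lab N T I) ℂ) (g : Gr (OddGen P N T I)) :
    atZero P N T I (f ⊗ₜ g) = MvPolynomial.aeval (fun _ => (0 : ℂ)) f • Gr.restrict P _ g := rfl

lemma atZero_srcParam (g : Gr P) : atZero P N T I (srcParam P I T N g) = g := by
  refine (atZero_tmul 1 _).trans ?_
  rw [map_one, one_smul]
  exact Gr.restrict_inl g

lemma atZero_scaleSources (x : SrcAlg P N T I) :
    atZero P N T I (scaleSources P N T I a b c x) = atZero P N T I x := by
  have h1 : (MvPolynomial.aeval fun _ => (0 : ℂ)).comp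
      (MvPolynomial.aeval fun l : Lab N T I => a • MvPolynomial.X l) =
      (MvPolynomial.aeval (fun _ => (0 : ℂ)) : MvPolynomial (Lab N T I) ℂ →ₐ[ℂ] ℂ) := by
    ext l
    simp
  have h2 : (Gr.restrict P (Lab N T I ⊕ Lab N T I)).comp (Gr.scale (oddScale P b c)) =
      Gr.restrict P _ := by
    refine ExteriorAlgebra.hom_ext (Finsupp.lhom_ext' fun p => LinearMap.ext_ring ?_)
    have h3 : Gr.restrict P (Lab N T I ⊕ Lab N T I) (Gr.scale (oddScale P b c) (Gr.gen p)) =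
        Gr.restrict P (Lab N T I ⊕ Lab N T I) (Gr.gen p) := by
      rw [Gr.scale_gen, map_smul]
      rcases p with p | p
      · rw [oddScale, Sum.elim_inl, one_smul]
      · rw [Gr.restrict_gen_inr, smul_zero]
    exact h3
  induction x using TensorProduct.induction_on with
  | zero => simp only [map_zero]
  | add x y hx hy => simp only [map_add, hx, hy]
  | tmul f g =>
    rw [scaleSources_tmul, atZero_tmul, atZero_tmul]
    exact congrArg₂ (· • ·) (DFunLike.congr_fun h1 f) (DFunLike.congr_fun h2 g)

end Scale

/-! ### Homogeneity of the correlators -/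

section Naturality
variable {P I A T R R' : Type*} {N : ℕ} [Ring R] [Algebra ℂ R] [Ring R'] [Algebra ℂ R']
  [Fintype I] [DecidableEq I] [Fintype A] [DecidableEq A] [Fintype T]
  {D : OperatorData P I A T} {st : Statistics} {Δ : Matrix (I × A) (I × A) (Gr P)}
  {c : Gr P →ₐ[ℂ] R} {JO JS JSbar : Lab N T I → R}

lemma map_srcBlock (f : R →ₐ[ℂ] R') (q : NK N) (j : I) (a b : A) (d d' : Fin 2) :
    f (D.srcBlock st JO JS JSbar q j a b d d') =
      D.srcBlock st (fun l => f (JO l)) (fun l => f (JS l)) (fun l => f (JSbar l)) q j a b d d' := by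
  rw [OperatorData.srcBlock, OperatorData.srcBlock]
  split_ifs <;> fin_cases d <;> fin_cases d' <;> simp

lemma map_supermatrix (f : R →ₐ[ℂ] R') : (D.supermatrix st Δ c JO JS JSbar).map f =
    D.supermatrix st Δ (f.comp c) (fun l => f (JO l)) (fun l => f (JS l)) fun l => f (JSbar l) := by
  ext x y
  simp [OperatorData.supermatrix, map_srcBlock]

lemma map_superTrace_pow (f : R →ₐ[ℂ] R') (K : Matrix (SIndex N I A) (SIndex N I A) R) (m : ℕ) :
    f (superTrace (K ^ m)) = superTrace (K.map f ^ m) := by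
  have h : (K ^ m).map f = K.map f ^ m := map_pow f.toRingHom.mapMatrix K m
  rw [← h, superTrace_eq, superTrace_eq, map_sum]
  simp

lemma srcBlock_smul (r : ℂ) (q : NK N) (j : I) (a b : A) (d d' : Fin 2) :
    D.srcBlock st (fun l => r • JO l) (fun l => r • JS l) (fun l => r • JSbar l) q j a b d d' =
      r • D.srcBlock st JO JS JSbar q j a b d d' := by
  rw [OperatorData.srcBlock, OperatorData.srcBlock]
  split_ifs <;> fin_cases d <;> fin_cases d' <;> simp [Finset.smul_sum, smul_smul, mul_comm]

lemma supermatrix_smul (r : ℂ) :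
    D.supermatrix st Δ c (fun l => r • JO l) (fun l => r • JS l) (fun l => r • JSbar l) =
      r • D.supermatrix st Δ c JO JS JSbar := by
  ext x y
  simp only [OperatorData.supermatrix, Matrix.of_apply, Matrix.smul_apply, srcBlock_smul,
    mul_smul_comm, Finset.smul_sum]

/-- Entrywise form of K' g = 2 g K, where g is diag(1, 2) on the two-valued index: quadrupling J_S
alone equals doubling K up to conjugation, because J_S and J̄_S occupy opposite off-diagonal blocks.
-/
lemma srcBlock_rescale (q : NK N) (j : I) (a b : A) (d d' : Fin 2) :
    (if d' = 0 then (1 : ℂ) else 2) •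
        D.srcBlock st (fun _ => 0) (fun l => (4 : ℂ) • JS l) (fun l => (1 : ℂ) • JSbar l) q j a b d d' =
      (2 * if d = 0 then (1 : ℂ) else 2) •
        D.srcBlock st (fun _ => 0) JS JSbar q j a b d d' := by
  rw [OperatorData.srcBlock, OperatorData.srcBlock]
  split_ifs <;> fin_cases d <;> fin_cases d' <;> simp_all [Finset.smul_sum, smul_smul, mul_comm]
  norm_num

/-- The invariance of supertraces under the rescaling of `J_S` against `J̄_S`. -/
lemma superTrace_supermatrix_rescale (m : ℕ) :
    superTrace (D.supermatrix st Δ c (fun _ => 0) (fun l => (4 : ℂ) • JS l)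
        (fun l => (1 : ℂ) • JSbar l) ^ m) =
      (2 : ℂ) ^ m • superTrace (D.supermatrix st Δ c (fun _ => 0) JS JSbar ^ m) := by
  set K := D.supermatrix st Δ c (fun _ => 0) JS JSbar
  set K' := D.supermatrix st Δ c (fun _ => 0) (fun l => (4 : ℂ) • JS l) fun l => (1 : ℂ) • JSbar l
  let g : SIndex N I A → ℂ := fun x => if x.2 = 0 then 1 else 2
  have hg : ∀ x, g x ≠ 0 := fun x => by
    simp only [g]
    split_ifs <;> norm_num
  have h1 : ∀ x y, g y • K' x y = (2 * g x) • K x y := by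
    intro x y
    simp only [K, K', OperatorData.supermatrix, Matrix.of_apply, Finset.smul_sum, ← mul_smul_comm,
      g]
    exact Finset.sum_congr rfl fun a _ => congrArg _ (srcBlock_rescale _ _ _ _ _ _)
  have h2 : ∀ m x y, g y • (K' ^ m) x y = (2 ^ m * g x) • (K ^ m) x y := by
    intro m
    induction m with
    | zero =>
      intro x y
      rw [pow_zero, pow_zero, pow_zero, one_mul, Matrix.one_apply]
      split_ifs with h
      · rw [h]
      · simp
    | succ m ih =>
      intro x y
      rw [pow_succ K', pow_succ K, Matrix.mul_apply, Matrix.mul_apply, Finset.smul_sum,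
        Finset.smul_sum]
      refine Finset.sum_congr rfl fun z _ => ?_
      rw [← mul_smul_comm, h1, mul_smul_comm, mul_smul, ← smul_mul_assoc (g z), ih, smul_mul_assoc,
        smul_smul]
      congr 1
      ring
  rw [superTrace_eq, superTrace_eq, Finset.smul_sum]
  refine Finset.sum_congr rfl fun x _ => ?_
  have h3 : g x • (K' ^ m) x x = g x • ((2 : ℂ) ^ m • (K ^ m) x x) :=
    (h2 m x x).trans (by rw [smul_smul, mul_comm])
  rw [smul_right_injective R (hg x) h3, smul_comm]

end Naturality

section Homogeneity
variable {P I A T : Type*} {N : ℕ} [Fintype I] [DecidableEq I] [Fintype A] [DecidableEq A] [Fintype T]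
  {D : OperatorData P I A T} {st : Statistics} {Δ : Matrix (I × A) (I × A) (Gr P)}

lemma scaleSources_srcS (a b c : ℂ) (l : Lab N T I) :
    scaleSources P N T I a b c (D.srcS st l) = b • D.srcS st l := by
  rw [OperatorData.srcS, OperatorData.oddSource]
  split_ifs
  · exact scaleSources_oddVar a b c _
  · rw [map_zero, smul_zero]

lemma scaleSources_srcSbar (a b c : ℂ) (l : Lab N T I) :
    scaleSources P N T I a b c (D.srcSbar st l) = c • D.srcSbar st l := by
  rw [OperatorData.srcSbar, OperatorData.oddSource]
  split_ifs
  · exact scaleSources_oddVar a b c _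
  · rw [map_zero, smul_zero]

lemma map_scaleSources_supermatrix (a b c : ℂ) :
    (D.supermatrix st Δ (srcParam P I T N) (srcO P) (D.srcS st) (D.srcSbar st)).map
        (scaleSources P N T I a b c) =
      D.supermatrix st Δ (srcParam P I T N) (fun l => a • srcO P l) (fun l => b • D.srcS st l)
        fun l => c • D.srcSbar st l := by
  rw [map_supermatrix]
  have h : (scaleSources P N T I a b c).comp (srcParam P I T N) = srcParam P I T N :=
    AlgHom.ext (scaleSources_srcParam a b c)
  rw [h]
  congr 1
  · exact funext (scaleSources_evenVar a b c)
  · exact funext (scaleSources_srcS a b c)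
  · exact funext (scaleSources_srcSbar a b c)

lemma list_prod_scaleSources (a b c r : ℂ) (L : List (Module.End ℂ (SrcAlg P N T I)))
    (hL : ∀ d ∈ L, ∀ x, d (scaleSources P N T I a b c x) = r • scaleSources P N T I a b c (d x))
    (x : SrcAlg P N T I) :
    L.prod (scaleSources P N T I a b c x) = r ^ L.length • scaleSources P N T I a b c (L.prod x) := by
  induction L with
  | nil => simp only [List.prod_nil, List.length_nil, pow_zero, one_smul, Module.End.one_apply]
  | cons d L ih =>
    rw [List.prod_cons, Module.End.mul_apply, ih fun d' h => hL d' (List.mem_cons_of_mem _ h),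
      map_smul, hL d List.mem_cons_self, smul_smul, List.length_cons, pow_succ, Module.End.mul_apply]

lemma derivS_scaleSources (a b c : ℂ) (l : Lab N T I) (x : SrcAlg P N T I) :
    derivS P l (scaleSources P N T I a b c x) = b • scaleSources P N T I a b c (derivS P l x) := by
  rw [derivS, LinearMap.neg_apply, LinearMap.neg_apply, derivOdd_scaleSources, map_neg]
  exact (smul_neg _ _).symm

lemma derivSbar_scaleSources (a b c : ℂ) (l : Lab N T I) (x : SrcAlg P N T I) :
    derivSbar P l (scaleSources P N T I a b c x) =
      c • scaleSources P N T I a b c (derivSbar P l x) := by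
  rw [derivSbar, LinearMap.neg_apply, LinearMap.neg_apply, derivOdd_scaleSources, map_neg]
  exact (smul_neg _ _).symm

/-- The correlators of homogeneous differential operators. -/
lemma atZero_deriv_superTrace {d : Module.End ℂ (SrcAlg P N T I)} {a b c r : ℂ}
    (hd : ∀ x, d (scaleSources P N T I a b c x) = r • scaleSources P N T I a b c (d x)) (m : ℕ) :
    r • atZero P N T I (d (superTrace
      (D.supermatrix st Δ (srcParam P I T N) (srcO P) (D.srcS st) (D.srcSbar st) ^ m))) =
    atZero P N T I (d (superTrace (D.supermatrix st Δ (srcParam P I T N) (fun l => a • srcO P l)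
      (fun l => b • D.srcS st l) (fun l => c • D.srcSbar st l) ^ m))) := by
  rw [← map_scaleSources_supermatrix, ← map_superTrace_pow, hd, map_smul, atZero_scaleSources]

/-- Doubling all sources multiplies the supertrace by 2^m, whereas a differential operator of degree
p requires the factor 2^p. Only m = p survives at vanishing sources. -/
lemma atZero_deriv_superTrace_eq_zero {d : Module.End ℂ (SrcAlg P N T I)} {p m : ℕ} (hm : m ≠ p)
    (hd : ∀ x, d (scaleSources P N T I 2 2 2 x) =
      (2 : ℂ) ^ p • scaleSources P N T I 2 2 2 (d x)) :
    atZero P N T I (d (superTrace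
      (D.supermatrix st Δ (srcParam P I T N) (srcO P) (D.srcS st) (D.srcSbar st) ^ m))) = 0 := by
  have h := atZero_deriv_superTrace (D := D) (st := st) (Δ := Δ) hd m
  rw [supermatrix_smul, smul_pow, superTrace_smul, map_smul, map_smul] at h
  rw [← sub_eq_zero, ← sub_smul] at h
  refine (smul_eq_zero.1 h).resolve_left (sub_ne_zero.2 fun h => hm ?_)
  exact (Nat.pow_right_injective le_rfl (by exact_mod_cast h)).symm

end Homogeneity

/-! ### Path expansion of the supertraces -/

section Blocks
variable {R : Type*} [Ring R] [Algebra ℂ R] {N : ℕ} {I A : Type*} [Fintype I] [Fintype A]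
  [DecidableEq I] [DecidableEq A]

/-- The blocks of a supermatrix. -/
def superBlock (K : Matrix (SIndex N I A) (SIndex N I A) R) (d d' : Fin 2) :
    Matrix (NK N × I) (NK N × I) (Matrix A A R) :=
  Matrix.of fun v w => Matrix.of fun a b => K ((v.1, v.2, a), d) ((w.1, w.2, b), d')

lemma superBlock_mul (K L : Matrix (SIndex N I A) (SIndex N I A) R) (d d' : Fin 2) :
    superBlock (K * L) d d' = superBlock K d 0 * superBlock L 0 d' +
      superBlock K d 1 * superBlock L 1 d' := by
  ext v w a b
  simp only [superBlock, Matrix.of_apply, Matrix.mul_apply, Matrix.add_apply, Matrix.sum_apply,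
    Fintype.sum_prod_type (α₁ := NK N × I × A), Fintype.sum_prod_type (α₁ := NK N),
    Fintype.sum_prod_type (α₁ := I), Fin.sum_univ_two, Finset.sum_add_distrib]

lemma superBlock_one (d d' : Fin 2) :
    superBlock (1 : Matrix (SIndex N I A) (SIndex N I A) R) d d' = if d = d' then 1 else 0 := by
  ext v w a b
  split_ifs with h
  · subst h
    simp only [superBlock, Matrix.of_apply, Matrix.one_apply, Prod.mk.injEq, and_true]
    by_cases hv : v = w
    · subst hv
      simp [Matrix.one_apply]
    · have : ¬ (v.1 = w.1 ∧ v.2 = w.2 ∧ a = b) := fun h => hv (Prod.ext h.1 h.2.1)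
      simp [hv, this]
  · simp [superBlock, Matrix.one_apply, h]

lemma superTrace_eq_superBlock (K : Matrix (SIndex N I A) (SIndex N I A) R) :
    superTrace K = ∑ d, ∑ v : NK N × I,
      (-1 : ℂ) ^ ((v.1.1 : ℕ) - (v.1.2 : ℕ)) • (superBlock K d d v v).trace := by
  rw [superTrace_eq]
  simp only [Fintype.sum_prod_type (α₁ := NK N × I × A), Fintype.sum_prod_type (α₁ := NK N),
    Fintype.sum_prod_type (α₁ := I), Matrix.trace, Matrix.diag, superBlock, Matrix.of_apply,
    SIndex.parity, Fin.sum_univ_two, Finset.smul_sum, Finset.sum_add_distrib]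

lemma superBlock_pow (K : Matrix (SIndex N I A) (SIndex N I A) R) (h01 : superBlock K 0 1 = 0)
    (h10 : superBlock K 1 0 = 0) (d : Fin 2) (m : ℕ) :
    superBlock (K ^ m) d d = superBlock K d d ^ m := by
  induction m with
  | zero => rw [pow_zero, pow_zero, superBlock_one, if_pos rfl]
  | succ m ih =>
    rw [pow_succ', pow_succ', superBlock_mul]
    fin_cases d
    · simp only [Fin.zero_eta, Fin.isValue] at ih ⊢
      rw [h01, zero_mul, add_zero, ih]
    · simp only [Fin.mk_one, Fin.isValue] at ih ⊢
      rw [h10, zero_mul, zero_add, ih]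

lemma list_prod_smul_mul {S : Type*} [Ring S] [Algebra ℂ S] {r : ℕ} (w : Fin r → ℂ)
    (a b : Fin r → S) (h : ∀ i x, b i * x = x * b i) :
    (List.ofFn fun j => w j • (a j * b j)).prod =
      (∏ j, w j) • ((List.ofFn a).prod * (List.ofFn b).prod) := by
  induction r with
  | zero => simp
  | succ r ih =>
    rw [List.ofFn_succ, List.prod_cons, ih _ _ _ fun i => h i.succ, List.ofFn_succ (f := a),
      List.prod_cons, List.ofFn_succ (f := b), List.prod_cons, Fin.prod_univ_succ, smul_mul_smul_comm]
    congr 1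
    rw [mul_assoc, ← mul_assoc (b 0), h]
    simp only [mul_assoc]

lemma trace_map_mul_scalar {P : Type*} (c : Gr P →ₐ[ℂ] R) (g : Matrix A A (Gr P)) (θ : R) :
    (g.map c * Matrix.scalar A θ).trace = c g.trace * θ := by
  simp [Matrix.trace, Finset.sum_mul, Matrix.mul_diagonal]

end Blocks

/-! ### Columns labelled by sources, and the edges leading to them. -/

section Vertices
variable {P I A T R : Type*} {N : ℕ} [Ring R] [Algebra ℂ R]
  [Fintype I] [DecidableEq I] [Fintype A] [DecidableEq A] [Fintype T]

/-- The columns of the supermatrix of parity `p`, together with the label of a source. -/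
abbrev Vertex (N : ℕ) (T I : Type*) (p : ℕ) := Σ l : Lab N T I, Fin (2 * (l.1 : ℕ) + p + 1)

/-- The column of a vertex. -/
def Vertex.proj {p : ℕ} (hp : p < 2) (y : Vertex N T I p) : NK N × I :=
  (⟨⟨2 * (y.1.1 : ℕ) + p, by omega⟩, y.2⟩, y.1.2.2)

lemma sum_vertex {M : Type*} [AddCommMonoid M] [DecidableEq T] {p : ℕ} (hp : p < 2) (m : Fin N)
    (k : Fin (2 * (m : ℕ) + p + 1)) (j : I) (f : Vertex N T I p → M) :
    (∑ y, if y.proj hp = (⟨⟨2 * (m : ℕ) + p, by omega⟩, k⟩, j) then f y else 0) =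
      ∑ α, f ⟨(m, α, j), k⟩ := by
  rw [← Finset.sum_filter]
  symm
  refine Finset.sum_bij (fun α _ => ⟨(m, α, j), k⟩) ?_ ?_ ?_ ?_
  · intro α _
    exact Finset.mem_filter.2 ⟨Finset.mem_univ _, rfl⟩
  · intro α _ β _ h
    simp only [Sigma.mk.injEq, Prod.mk.injEq, true_and] at h
    exact h.1.1
  · rintro ⟨⟨m', α, j'⟩, k'⟩ hy
    replace hy := (Finset.mem_filter.1 hy).2
    simp only [Vertex.proj, Prod.mk.injEq, Sigma.mk.injEq, Fin.mk.injEq] at hy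
    obtain ⟨⟨h1, h2⟩, rfl⟩ := hy
    obtain rfl : m' = m := Fin.ext (by omega)
    exact ⟨α, Finset.mem_univ _, by rw [eq_of_heq h2]⟩
  · intro α _
    rfl

variable (D : OperatorData P I A T) (Δ : Matrix (I × A) (I × A) (Gr P)) (c : Gr P →ₐ[ℂ] R)

/-- The matrix `Δ⁻¹ t` of an edge. -/
def OperatorData.edge {p : ℕ} (v : NK N × I) (y : Vertex N T I p) : Matrix A A (Gr P) :=
  D.kernel Δ v.1.1 v.1.2 v.2 (2 * (y.1.1 : ℕ) + p) y.2 y.1.2.2 *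
    (D.t y.1.2.1).map (algebraMap ℂ (Gr P))

variable {D Δ c}

/-- Several source labels share a column, because the column does not record α. Summing over all
labelled vertices above a column gives the block entries the shape needed for the path expansion. -/
lemma sum_kernel_mul_eq_sum_edge {p : ℕ} (hp : p < 2) (β : NK N × I → A → A → R)
    (w : Vertex N T I p → ℂ) (J : Lab N T I → R)
    (hβ : ∀ (m : Fin N) (k : Fin (2 * (m : ℕ) + p + 1)) j a b,
      β (⟨⟨2 * (m : ℕ) + p, by omega⟩, k⟩, j) a b =
        ∑ α, (w ⟨(m, α, j), k⟩ * D.t α a b) • J (m, α, j))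
    (hβ' : ∀ v a b, (v.1.1 : ℕ) % 2 ≠ p → β v a b = 0) (v v' : NK N × I) :
    (Matrix.of fun a b => ∑ a', c (D.kernel Δ v.1.1 v.1.2 v.2 v'.1.1 v'.1.2 v'.2 a a') * β v' a' b) =
      ∑ y : Vertex N T I p, if y.proj hp = v' then
        w y • ((D.edge Δ v y).map c * Matrix.scalar A (J y.1)) else 0 := by
  classical
  by_cases hv : (v'.1.1 : ℕ) % 2 = p
  · obtain ⟨⟨⟨n, hn⟩, k⟩, j⟩ := v'
    obtain ⟨m, rfl⟩ : ∃ m, n = 2 * m + p := ⟨n / 2, by simp only at hv; omega⟩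
    rw [sum_vertex hp ⟨m, by omega⟩ k j]
    ext a b
    have hβ1 := fun a' => hβ ⟨m, by omega⟩ k j a' b
    simp only [Matrix.of_apply, Matrix.sum_apply, Matrix.smul_apply]
    simp only [hβ1, Finset.mul_sum]
    rw [Finset.sum_comm]
    refine Finset.sum_congr rfl fun α _ => ?_
    simp only [Matrix.scalar_apply, Matrix.mul_diagonal, Matrix.map_apply, OperatorData.edge]
    simp only [Matrix.mul_apply, Matrix.map_apply, map_sum, map_mul, Finset.sum_mul,
      Finset.smul_sum]
    refine Finset.sum_congr rfl fun a' _ => ?_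
    rw [AlgHom.commutes, mul_smul_comm, mul_smul, ← Algebra.commutes, ← Algebra.smul_def,
      smul_mul_assoc]
  · rw [Finset.sum_eq_zero]
    · ext a b
      simp [hβ' v' _ _ hv]
    · intro y _
      refine if_neg fun h => hv ?_
      rw [← h]
      simp only [Vertex.proj]
      omega

end Vertices

/-! ### Correlators of the even operators -/

section PathSum
variable {P I A T R : Type*} {N : ℕ} [Ring R] [Algebra ℂ R]
  [Fintype I] [DecidableEq I] [Fintype A] [DecidableEq A] [Fintype T]
  {D : OperatorData P I A T} {st : Statistics} {Δ : Matrix (I × A) (I × A) (Gr P)}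
  {c : Gr P →ₐ[ℂ] R}

lemma trace_prod_smul_map_mul_scalar {r : ℕ} (w : Fin r → ℂ) (g : Fin r → Matrix A A (Gr P))
    (J : Fin r → R) (hJ : ∀ i x, J i * x = x * J i) :
    (List.ofFn fun j => w j • ((g j).map c * Matrix.scalar A (J j))).prod.trace =
      (∏ j, w j) • (c (List.ofFn g).prod.trace * (List.ofFn J).prod) := by
  have h1 : (List.ofFn fun j => (g j).map c).prod = (List.ofFn g).prod.map c := by
    have := map_list_prod (c.toRingHom.mapMatrix (m := A)) (List.ofFn g)
    rw [List.map_ofFn] at this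
    exact this.symm
  have h2 : (List.ofFn fun j => Matrix.scalar A (J j)).prod = Matrix.scalar A (List.ofFn J).prod := by
    have := map_list_prod (Matrix.scalar A : R →+* Matrix A A R) (List.ofFn J)
    rw [List.map_ofFn] at this
    exact this.symm
  rw [list_prod_smul_mul w (fun j => (g j).map c) (fun j => Matrix.scalar A (J j)), h1, h2,
    Matrix.trace_smul, trace_map_mul_scalar]
  intro i x
  exact (Matrix.scalar_commute (J i) (hJ i) x).eq

lemma superBlock_supermatrix (JO JS JSbar : Lab N T I → R) (d d' : Fin 2) (v v' : NK N × I) :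
    superBlock (D.supermatrix st Δ c JO JS JSbar) d d' v v' =
      Matrix.of fun a b => ∑ a', c (D.kernel Δ v.1.1 v.1.2 v.2 v'.1.1 v'.1.2 v'.2 a a') *
        D.srcBlock st JO JS JSbar v'.1 v'.2 a' b d d' := rfl

lemma superBlock_supermatrix_even (JO : Lab N T I → R) (d : Fin 2) (v v' : NK N × I) :
    superBlock (D.supermatrix st Δ c JO (fun _ => 0) fun _ => 0) d d v v' =
      ∑ y : Vertex N T I 0, if y.proj two_pos = v' then
        (st.sign ^ (y.2 : ℕ) * (if d = 0 then 1 else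
          st.sign * (-1) ^ ((y.1.1 : ℕ) + D.τ y.1.2.1))) •
          ((D.edge Δ v y).map c * Matrix.scalar A (JO y.1)) else 0 := by
  rw [superBlock_supermatrix]
  refine sum_kernel_mul_eq_sum_edge two_pos
    (fun v' a' b => D.srcBlock st JO (fun _ => 0) (fun _ => 0) v'.1 v'.2 a' b d d) _ JO ?_ ?_ v v'
  · intro m k j a b
    refine (congrFun (congrFun (D.srcBlock_even st JO _ _ m k j a b) d) d).trans ?_
    fin_cases d
    · simp
    · simp [pow_succ, mul_assoc]
  · intro v a b hv
    simp only [OperatorData.srcBlock, if_neg fun h => hv (Nat.even_iff.1 h)]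
    fin_cases d <;> simp

lemma superBlock_supermatrix_even_of_ne (JO : Lab N T I → R) {d d' : Fin 2} (h : d ≠ d') :
    superBlock (D.supermatrix st Δ c JO (fun _ => 0) fun _ => 0) d d' = 0 := by
  ext v v' a b
  rw [superBlock_supermatrix, Matrix.of_apply]
  refine Finset.sum_eq_zero fun a' _ => ?_
  have : D.srcBlock st JO (fun _ => 0) (fun _ => 0) v'.1 v'.2 a' b d d' = 0 := by
    rw [OperatorData.srcBlock]
    split_ifs <;> fin_cases d <;> fin_cases d' <;> simp_all
  rw [this, mul_zero]

/-- The supertraces for vanishing odd sources. -/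
lemma superTrace_supermatrix_even (JO : Lab N T I → R) (hJ : ∀ l x, JO l * x = x * JO l) (M : ℕ) :
    superTrace (D.supermatrix st Δ c JO (fun _ => 0) (fun _ => 0) ^ (M + 1)) =
      ∑ x : Fin (M + 1) → Vertex N T I 0,
        ((-1) ^ ((x 0).2 : ℕ) * (∏ m, st.sign ^ ((x m).2 : ℕ)) *
          (1 + st.sign ^ (M + 1) * (-1) ^ ∑ m, (((x m).1.1 : ℕ) + D.τ (x m).1.2.1))) •
          (c (List.ofFn fun j => D.edge Δ ((x j).proj two_pos) (x (j + 1))).prod.trace *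
            (List.ofFn fun j => JO (x (j + 1)).1).prod) := by
  classical
  set K := D.supermatrix st Δ c JO (fun _ => 0) fun _ => 0
  let e : NK N × I → ℂ := fun v => (-1) ^ ((v.1.1 : ℕ) - (v.1.2 : ℕ))
  let w : Fin 2 → Vertex N T I 0 → ℂ := fun d y => st.sign ^ (y.2 : ℕ) * (if d = 0 then 1 else
    st.sign * (-1) ^ ((y.1.1 : ℕ) + D.τ y.1.2.1))
  -- Without odd sources the off-diagonal blocks vanish, and each diagonal block is expanded into
  -- closed paths on its own. The two expansions differ only by the product of the signs in `w 1`.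
  have h1 : ∀ d, ∑ v, e v • (superBlock (K ^ (M + 1)) d d v v).trace =
      ∑ x : Fin (M + 1) → Vertex N T I 0, (e ((x 0).proj two_pos) * ∏ j, w d (x (j + 1))) •
        (c (List.ofFn fun j => D.edge Δ ((x j).proj two_pos) (x (j + 1))).prod.trace *
            (List.ofFn fun j => JO (x (j + 1)).1).prod) := by
    intro d
    rw [superBlock_pow K (superBlock_supermatrix_even_of_ne JO (by decide))
      (superBlock_supermatrix_even_of_ne JO (by decide))]
    simp only [← Matrix.trace_smul]
    rw [← Matrix.trace_sum, sum_smul_pow_apply_eq_sum_paths (Vertex.proj two_pos)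
      (fun v y => w d y • ((D.edge Δ v y).map c * Matrix.scalar A (JO y.1))) (superBlock K d d)
      (superBlock_supermatrix_even JO d), Matrix.trace_sum]
    refine Finset.sum_congr rfl fun x _ => ?_
    rw [Matrix.trace_smul, trace_prod_smul_map_mul_scalar _ _ _ fun i => hJ _, smul_smul]
  rw [superTrace_eq_superBlock]
  refine (Finset.sum_congr rfl fun d _ => h1 d).trans ?_
  rw [Finset.sum_comm]
  refine Finset.sum_congr rfl fun x _ => ?_
  rw [← Finset.sum_smul, Fin.sum_univ_two]
  congr 1
  -- The columns of these vertices have even n, so the parity n - k is that of k.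
  have h2 : e ((x 0).proj two_pos) = (-1) ^ ((x 0).2 : ℕ) := by
    have hk : ((x 0).2 : ℕ) ≤ 2 * ((x 0).1.1 : ℕ) := Nat.lt_succ_iff.1 (x 0).2.2
    simp only [e, Vertex.proj, add_zero]
    refine SPoly.neg_one_pow_congr ?_
    rw [Nat.cast_sub hk, ← sub_eq_zero, sub_sub, ← two_mul, Nat.cast_mul]
    have : ((2 : ℕ) : ZMod 2) = 0 := rfl
    rw [this, zero_mul]
    have h3 : (2 : ZMod 2) = 0 := rfl
    rw [h3, zero_mul, sub_zero]
  have h3 : ∀ d, ∏ j, w d (x (j + 1)) = ∏ j, w d (x j) := fun d =>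
    Equiv.prod_comp (Equiv.addRight (1 : Fin (M + 1))) fun j => w d (x j)
  rw [h3, h3, h2]
  simp only [w, if_true, if_neg (one_ne_zero : (1 : Fin 2) ≠ 0), mul_one, Finset.prod_mul_distrib,
    Finset.prod_const, Finset.card_univ, Fintype.card_fin, Finset.prod_pow_eq_pow_sum]
  ring

end PathSum

section CorrO
variable {P I A T : Type*} {N : ℕ} [Fintype I] [DecidableEq I] [Fintype A] [DecidableEq A] [Fintype T]
  {D : OperatorData P I A T} {st : Statistics} {Δ : Matrix (I × A) (I × A) (Gr P)}

lemma coeff_complex_smul {R : Type*} [Ring R] [Algebra ℂ R] (r : ℂ) (f : PowerSeries R) (m : ℕ) :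
    PowerSeries.coeff m (r • f) = r • PowerSeries.coeff m f := rfl

lemma coeff_correlator (d : Module.End ℂ (SrcAlg P N T I)) (r : ℂ)
    (K : Matrix (SIndex N I A) (SIndex N I A) (SrcAlg P N T I)) (m : ℕ) :
    PowerSeries.coeff m (correlator d ((-(r / 2)) • superTraceLog K)) =
      (r / 2 * (m : ℂ)⁻¹) • atZero P N T I (d (superTrace (K ^ m))) := by
  rw [correlator, PowerSeries.coeff_mk]
  have h : PowerSeries.coeff m ((-(r / 2)) • superTraceLog K) =
      (r / 2 * (m : ℂ)⁻¹) • superTrace (K ^ m) := by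
    rw [coeff_complex_smul, coeff_superTraceLog, smul_smul, neg_mul_neg]
  rw [h, map_smul, map_smul]

lemma prod_derivO_tmul (L : List (Lab N T I)) (f : MvPolynomial (Lab N T I) ℂ)
    (g : Gr (OddGen P N T I)) : (L.map (derivO P)).prod (f ⊗ₜ g) =
      (L.map fun l => ((MvPolynomial.pderiv (R := ℂ) l).toLinearMap :
        Module.End ℂ (MvPolynomial (Lab N T I) ℂ))).prod f ⊗ₜ g := by
  induction L with
  | nil => rfl
  | cons l L ih =>
    rw [List.map_cons, List.prod_cons, Module.End.mul_apply, ih, List.map_cons, List.prod_cons,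
      Module.End.mul_apply]
    rfl

lemma prod_srcO (L : List (Lab N T I)) : (L.map (srcO P)).prod =
    ((L.map (MvPolynomial.X (R := ℂ))).prod ⊗ₜ 1 : SrcAlg P N T I) := by
  induction L with
  | nil => rfl
  | cons l L ih =>
    rw [List.map_cons, List.prod_cons, ih, List.map_cons, List.prod_cons]
    exact (Algebra.TensorProduct.tmul_mul_tmul _ _ _ _).trans (by rw [one_mul])

lemma atZero_prod_derivO [DecidableEq T] {r : ℕ} (l x : Fin r → Lab N T I) (g : Gr P) :
    atZero P N T I ((List.ofFn fun m => derivO P (l m)).prod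
      (srcParam P I T N g * (List.ofFn fun j => srcO P (x j)).prod)) =
      (∑ σ : Equiv.Perm (Fin r), if ∀ i, l (σ i) = x i then (1 : ℂ) else 0) • g := by
  have h1 : srcParam P I T N g * (List.ofFn fun j => srcO P (x j)).prod =
      (∏ j, MvPolynomial.X (x j)) ⊗ₜ Gr.inl P _ g := by
    have h2 := prod_srcO (P := P) (List.ofFn x)
    rw [List.map_ofFn, List.map_ofFn, List.prod_ofFn] at h2
    refine (congrArg (srcParam P I T N g * ·) h2).trans ?_
    refine (Algebra.TensorProduct.tmul_mul_tmul _ _ _ _).trans ?_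
    rw [one_mul, mul_one]
    rfl
  have h3 := prod_derivO_tmul (P := P) (List.ofFn l) (∏ j, MvPolynomial.X (x j)) (Gr.inl P _ g)
  rw [List.map_ofFn, List.map_ofFn] at h3
  refine (congrArg (fun z => atZero P N T I ((List.ofFn fun m => derivO P (l m)).prod z)) h1).trans ?_
  refine (congrArg (atZero P N T I) h3).trans ?_
  refine (atZero_tmul _ _).trans ?_
  rw [Gr.restrict_inl]
  congr 1
  refine (congrArg _ (prod_pderiv_prod_X l x)).trans ?_
  rw [map_sum]
  refine Finset.sum_congr rfl fun σ _ => ?_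
  split_ifs <;> simp

/-- In the path sum the source of an edge belongs to its endpoint j + 1. Composing the permutations
with the inverse rotation moves it back to position j. -/
lemma sum_perm_rotate {L M : Type*} [DecidableEq L] [AddCommMonoid M] {r : ℕ}
    (l x : Fin (r + 1) → L) (a : M) :
    (∑ σ : Equiv.Perm (Fin (r + 1)), if ∀ i, l (σ i) = x (i + 1) then a else 0) =
      ∑ σ : Equiv.Perm (Fin (r + 1)), if ∀ i, l (σ i) = x i then a else 0 := by
  refine Fintype.sum_equiv (Equiv.mulRight (Equiv.addRight (1 : Fin (r + 1)))⁻¹) _ _ fun σ => ?_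
  refine if_congr ?_ rfl rfl
  rw [← (Equiv.addRight (1 : Fin (r + 1))).forall_congr_right (q := fun i =>
    l ((Equiv.mulRight (Equiv.addRight (1 : Fin (r + 1)))⁻¹ σ) i) = x i)]
  simp

/-- The connected correlators of the even operators. -/
theorem correlator_derivO (M : ℕ) (l : Fin (M + 1) → Lab N T I) :
    correlator (List.ofFn fun m => derivO P (l m)).prod ((-(st.sign / 2)) • superTraceLog
        (D.supermatrix st Δ (srcParam P I T N) (srcO P) (D.srcS st) (D.srcSbar st))) =
      PowerSeries.monomial (M + 1) (corrO D st Δ l) := by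
  classical
  ext m
  rw [coeff_correlator, PowerSeries.coeff_monomial]
  have hd : ∀ a b c x, (List.ofFn fun m => derivO P (l m)).prod (scaleSources P N T I a b c x) =
      a ^ (M + 1) • scaleSources P N T I a b c ((List.ofFn fun m => derivO P (l m)).prod x) := by
    intro a b c x
    have := list_prod_scaleSources a b c a (List.ofFn fun m => derivO P (l m)) (fun d hd x => by
      obtain ⟨i, rfl⟩ := (List.mem_ofFn' _ _).1 hd
      exact derivO_scaleSources a b c _ x) x
    rwa [List.length_ofFn] at this
  split_ifs with hm
  · subst hm
    -- The factors 1, 0, 0 remove the odd sources. The operator contains derivatives with respect to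
    -- J_O only, so its value is unchanged.
    have h1 := atZero_deriv_superTrace (D := D) (st := st) (Δ := Δ) (hd 1 0 0) (M + 1)
    rw [one_pow, one_smul] at h1
    have h2 : (fun l : Lab N T I => (1 : ℂ) • srcO P l) = srcO P := funext fun l => one_smul ℂ _
    have h3 : (fun l : Lab N T I => (0 : ℂ) • D.srcS st l) = fun _ => 0 :=
      funext fun l => zero_smul ℂ _
    have h4 : (fun l : Lab N T I => (0 : ℂ) • D.srcSbar st l) = fun _ => 0 :=
      funext fun l => zero_smul ℂ _
    rw [h2, h3, h4, superTrace_supermatrix_even (srcO P) (fun l x =>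
      (SPoly.commute_even (srcO_mem l) x).eq) M, map_sum, map_sum] at h1
    rw [h1]
    have h5 : ∀ (w : ℂ) (g : Gr P) (x : Fin (M + 1) → Vertex N T I 0),
        atZero P N T I ((List.ofFn fun m => derivO P (l m)).prod
          (w • (srcParam P I T N g * (List.ofFn fun j => srcO P (x (j + 1)).1).prod))) =
        ∑ σ : Equiv.Perm (Fin (M + 1)), if ∀ i, l (σ i) = (x i).1 then w • g else 0 := by
      intro w g x
      rw [map_smul, map_smul, atZero_prod_derivO l (fun j => (x (j + 1)).1),
        sum_perm_rotate l (fun j => (x j).1), Finset.sum_smul, Finset.smul_sum]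
      refine Finset.sum_congr rfl fun σ _ => ?_
      split_ifs
      · rw [one_smul]
      · rw [zero_smul, smul_zero]
    simp only [h5]
    rw [Finset.sum_comm]
    simp only [sum_prescribed_labels]
    rw [Finset.sum_comm, corrO]
    simp only [Finset.smul_sum, smul_smul]
    refine Finset.sum_congr rfl fun k _ => Finset.sum_congr rfl fun σ _ => ?_
    congr 1
    have h6 : ∑ m, (((l (σ m)).1 : ℕ) + D.τ (l (σ m)).2.1) = ∑ m, (((l m).1 : ℕ) + D.τ (l m).2.1) :=
      Equiv.sum_comp σ fun m => ((l m).1 : ℕ) + D.τ (l m).2.1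
    rw [h6]
    push_cast
    ring
  · rw [atZero_deriv_superTrace_eq_zero hm (hd 2 2 2), smul_zero]

end CorrO

/-! ### Supertraces for vanishing even sources -/

section Cyclic
variable {R : Type*} [Ring R] [Algebra ℂ R] {part : ZMod 2 → Submodule ℂ R} {N : ℕ} {I A : Type*}
  [Fintype I] [Fintype A] [DecidableEq I] [DecidableEq A]

/-- The supertrace of a block. -/
def blockTrace (X : Matrix (NK N × I) (NK N × I) (Matrix A A R)) : R :=
  ∑ v : NK N × I, (-1 : ℂ) ^ ((v.1.1 : ℕ) - (v.1.2 : ℕ)) • (X v v).trace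

/-- Blocks of even supermatrices. -/
def IsEvenBlock (part : ZMod 2 → Submodule ℂ R)
    (X : Matrix (NK N × I) (NK N × I) (Matrix A A R)) : Prop :=
  ∀ v w a b, X v w a b ∈ part (((v.1.1 : ℕ) - (v.1.2 : ℕ) : ℕ) + ((w.1.1 : ℕ) - (w.1.2 : ℕ) : ℕ))

lemma IsEvenBlock.mul (h : IsSupercommutative part)
    {X Y : Matrix (NK N × I) (NK N × I) (Matrix A A R)} (hX : IsEvenBlock part X)
    (hY : IsEvenBlock part Y) : IsEvenBlock part (X * Y) := by
  intro v w a b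
  rw [Matrix.mul_apply, Matrix.sum_apply]
  refine sum_mem fun u _ => ?_
  rw [Matrix.mul_apply]
  refine sum_mem fun a' _ => ?_
  have h1 := h.mul_mem (hX v u a a') (hY u w a' b)
  have h2 : ∀ p q r : ZMod 2, p + q + (q + r) = p + r := by decide
  rwa [h2] at h1

lemma sum_comm_pairs {α β γ δ M : Type*} [AddCommMonoid M] [Fintype α] [Fintype β] [Fintype γ]
    [Fintype δ] (f : α → β → γ → δ → M) :
    ∑ a, ∑ b, ∑ c, ∑ d, f a b c d = ∑ c, ∑ d, ∑ a, ∑ b, f a b c d := by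
  have := Finset.sum_comm (s := (Finset.univ : Finset (α × β)))
    (t := (Finset.univ : Finset (γ × δ))) (f := fun p q => f p.1 p.2 q.1 q.2)
  simpa only [Fintype.sum_prod_type] using this

/-- Entries of even blocks have parity p + q in terms of the row and column parities. Exchanging two
of them costs (-1)^((p+q)²), and p + (p + q)² ≡ q mod 2 turns one supertrace weight into the other.
-/
lemma blockTrace_mul (h : IsSupercommutative part)
    {X Y : Matrix (NK N × I) (NK N × I) (Matrix A A R)} (hX : IsEvenBlock part X)
    (hY : IsEvenBlock part Y) : blockTrace (X * Y) = blockTrace (Y * X) := by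
  simp only [blockTrace, Matrix.mul_apply, Matrix.trace, Matrix.diag, Matrix.sum_apply,
    Finset.smul_sum]
  rw [sum_comm_pairs]
  refine Finset.sum_congr rfl fun w _ => Finset.sum_congr rfl fun b _ =>
    Finset.sum_congr rfl fun v _ => Finset.sum_congr rfl fun a _ => ?_
  have h1 := hX v w a b
  have h2 := hY w v b a
  rw [← Nat.cast_add] at h1 h2
  rw [h.mul_comm h1 h2, smul_smul, ← pow_add]
  congr 1
  refine SPoly.neg_one_pow_congr ?_
  push_cast
  have h3 : ∀ p q : ZMod 2, p + (p + q) * (q + p) = q := by decide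
  exact h3 _ _

end Cyclic

section OddPaths
variable {P I A T R : Type*} {N : ℕ} [Ring R] [Algebra ℂ R] {part : ZMod 2 → Submodule ℂ R}
  [Fintype I] [DecidableEq I] [Fintype A] [DecidableEq A] [Fintype T]
  {D : OperatorData P I A T} {st : Statistics} {Δ : Matrix (I × A) (I × A) (Gr P)}
  {c : Gr P →ₐ[ℂ] R}

lemma kernel_mem (hD : D.IsGraded st) (hΔ : ∀ x y, Ring.inverse Δ x y ∈ Gr.part P 0)
    {n k n' k' : ℕ} (hk : k ≤ n) (hk' : k' ≤ n') (i j : I) (a b : A) :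
    D.kernel Δ n k i n' k' j a b ∈ Gr.part P (((n - k : ℕ) : ZMod 2) + k') := by
  rw [OperatorData.kernel, Matrix.of_apply]
  refine sum_mem fun i' _ => sum_mem fun j' _ => ?_
  have := Gr.mul_mem (Gr.mul_mem (hD.v_mem n k hk i i') (hD.u_mem n' k' hk' j j'))
    (hΔ (i', a) (j', b))
  rwa [add_zero] at this

lemma isEvenBlock_supermatrix (h : IsSupercommutative part) (hD : D.IsGraded st)
    (hΔ : ∀ x y, Ring.inverse Δ x y ∈ Gr.part P 0)
    (hc : ∀ i g, g ∈ Gr.part P i → c g ∈ part i) {JO JS JSbar : Lab N T I → R}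
    (hO : ∀ l, JO l ∈ part 0) (hS : ∀ l, JS l ∈ part 1) (hSbar : ∀ l, JSbar l ∈ part 1)
    (d d' : Fin 2) : IsEvenBlock part (superBlock (D.supermatrix st Δ c JO JS JSbar) d d') := by
  intro v w a b
  rw [superBlock_supermatrix, Matrix.of_apply]
  refine sum_mem fun a' _ => ?_
  have hk : (w.1.2 : ℕ) ≤ w.1.1 := Nat.lt_succ_iff.1 w.1.2.2
  have h1 := h.mul_mem (hc _ _ (kernel_mem hD hΔ (Nat.lt_succ_iff.1 v.1.2.2) hk v.2 w.2 a a'))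
    (srcBlock_mem (D := D) (st := st) hO hS hSbar w.1 w.2 a' b d d')
  have h2 : ∀ p q r : ZMod 2, p + q + r = p + (r - q) := by decide
  rwa [h2, ← Nat.cast_sub hk] at h1

lemma superBlock_supermatrix_odd_self (JS JSbar : Lab N T I → R) (d : Fin 2) :
    superBlock (D.supermatrix st Δ c (fun _ => 0) JS JSbar) d d = 0 := by
  ext v v' a b
  rw [superBlock_supermatrix, Matrix.of_apply]
  refine Finset.sum_eq_zero fun a' _ => ?_
  have : D.srcBlock st (fun _ => 0) JS JSbar v'.1 v'.2 a' b d d = 0 := by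
    rw [OperatorData.srcBlock]
    split_ifs <;> fin_cases d <;> simp_all
  rw [this, mul_zero]

lemma superBlock_supermatrix_odd (JS JSbar : Lab N T I → R) {d d' : Fin 2} (hd : d ≠ d')
    (v v' : NK N × I) :
    superBlock (D.supermatrix st Δ c (fun _ => 0) JS JSbar) d d' v v' =
      ∑ y : Vertex N T I 1, if y.proj one_lt_two = v' then
        (2 * (-st.sign) ^ ((y.2 : ℕ) + 1)) •
          ((D.edge Δ v y).map c * Matrix.scalar A ((if d = 0 then JSbar else JS) y.1)) else 0 := by
  rw [superBlock_supermatrix]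
  refine sum_kernel_mul_eq_sum_edge one_lt_two
    (fun v' a' b => D.srcBlock st (fun _ => 0) JS JSbar v'.1 v'.2 a' b d d')
    (fun y => 2 * (-st.sign) ^ ((y.2 : ℕ) + 1)) (if d = 0 then JSbar else JS) ?_ ?_ v v'
  · intro m k j a b
    refine (congrFun (congrFun (D.srcBlock_odd st _ JS JSbar m k j a b) d) d').trans ?_
    fin_cases d <;> fin_cases d' <;> simp_all
  · intro v a b hv
    have hv' : Even (v.1.1 : ℕ) := by
      rw [Nat.even_iff]; omega
    simp only [OperatorData.srcBlock, if_pos hv']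
    fin_cases d <;> fin_cases d' <;> simp_all

lemma edge_mem (hD : D.IsGraded st) (hΔ : ∀ x y, Ring.inverse Δ x y ∈ Gr.part P 0) {p : ℕ}
    (v : NK N × I) (y : Vertex N T I p) (a b : A) :
    D.edge Δ v y a b ∈ Gr.part P ((((v.1.1 : ℕ) - (v.1.2 : ℕ) : ℕ) : ZMod 2) + (y.2 : ℕ)) := by
  rw [OperatorData.edge, Matrix.mul_apply]
  refine sum_mem fun a' _ => ?_
  have := Gr.mul_mem (kernel_mem hD hΔ (Nat.lt_succ_iff.1 v.1.2.2) (Nat.lt_succ_iff.1 y.2.2)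
    v.2 y.1.2.2 a a') (Gr.algebraMap_mem (σ := P) (D.t y.1.2.1 a' b))
  rwa [add_zero] at this

/-- Two consecutive edges with odd sources. -/
lemma edge_mul_edge (h : IsSupercommutative part) (hD : D.IsGraded st)
    (hΔ : ∀ x y, Ring.inverse Δ x y ∈ Gr.part P 0)
    (hc : ∀ i g, g ∈ Gr.part P i → c g ∈ part i) {J J' : R} (hJ' : J' ∈ part 1)
    (v : NK N × I) (y x : Vertex N T I 1) :
    (2 * (-st.sign) ^ ((y.2 : ℕ) + 1)) • ((D.edge Δ v y).map c * Matrix.scalar A J') *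
      (2 * (-st.sign) ^ ((x.2 : ℕ) + 1)) •
        ((D.edge Δ (y.proj one_lt_two) x).map c * Matrix.scalar A J) =
    (-4 * st.sign ^ ((x.2 : ℕ) + (y.2 : ℕ))) •
      ((D.edge Δ v y * D.edge Δ (y.proj one_lt_two) x).map c * Matrix.scalar A (J' * J)) := by
  have hk : (y.2 : ℕ) ≤ 2 * (y.1.1 : ℕ) + 1 := Nat.lt_succ_iff.1 y.2.2
  -- The source of the first edge has to pass the second edge, whose parity is 1 + k_y + k_x. This
  -- sign combines with the weights 2 (∓1)^(k+1) of the two edges to -4 (±1)^(k_x + k_y).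
  have h1 : Matrix.scalar A J' * (D.edge Δ (y.proj one_lt_two) x).map c =
      (-1 : ℂ) ^ (1 + (y.2 : ℕ) + x.2) •
        ((D.edge Δ (y.proj one_lt_two) x).map c * Matrix.scalar A J') := by
    ext a b
    simp only [Matrix.scalar_apply, Matrix.diagonal_mul, Matrix.smul_apply, Matrix.mul_diagonal,
      Matrix.map_apply]
    have h2 := hc _ _ (edge_mem hD hΔ (y.proj one_lt_two) x a b)
    have h3 : ((((y.proj one_lt_two).1.1 : ℕ) - ((y.proj one_lt_two).1.2 : ℕ) : ℕ) : ZMod 2) +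
        (x.2 : ℕ) = ((1 + (y.2 : ℕ) + x.2 : ℕ) : ZMod 2) := by
      simp only [Vertex.proj]
      rw [Nat.cast_sub hk]
      push_cast
      have h5 : (2 : ZMod 2) = 0 := rfl
      rw [h5, zero_mul, zero_add, sub_eq_add_neg, ZMod.neg_eq_self_mod_two]
    rw [h3] at h2
    have h4 := h.mul_comm (m := 1) (by simpa using hJ') h2
    rwa [one_mul] at h4
  have hmap : (D.edge Δ v y * D.edge Δ (y.proj one_lt_two) x).map c =
      (D.edge Δ v y).map c * (D.edge Δ (y.proj one_lt_two) x).map c :=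
    map_mul (c.toRingHom.mapMatrix (m := A)) _ _
  rw [smul_mul_smul_comm, mul_assoc ((D.edge Δ v y).map c), ← mul_assoc (Matrix.scalar A J'), h1,
    smul_mul_assoc, mul_smul_comm, smul_smul, hmap, map_mul]
  simp only [mul_assoc]
  congr 1
  have h6 : (-1 : ℂ) ^ (1 + (y.2 : ℕ) + x.2) * (-1) ^ (1 + (y.2 : ℕ) + x.2) = 1 := by
    rw [← mul_pow, neg_one_mul, neg_neg, one_pow]
  have h7 := st.sign_mul_self
  have h8 : (-1 : ℂ) ^ ((y.2 : ℕ) + 1) * (-1) ^ ((x.2 : ℕ) + 1) = -(-1) ^ (1 + (y.2 : ℕ) + x.2) := by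
    ring
  rw [neg_pow st.sign, neg_pow st.sign, pow_succ st.sign, pow_succ st.sign, pow_add st.sign]
  generalize (-1 : ℂ) ^ (1 + (y.2 : ℕ) + x.2) = E at *
  generalize (-1 : ℂ) ^ ((y.2 : ℕ) + 1) = E₁ at *
  generalize (-1 : ℂ) ^ ((x.2 : ℕ) + 1) = E₂ at *
  linear_combination (4 * st.sign ^ (y.2 : ℕ) * st.sign ^ (x.2 : ℕ) * st.sign * st.sign * E) * h8 -
    (4 * st.sign ^ (y.2 : ℕ) * st.sign ^ (x.2 : ℕ) * st.sign * st.sign) * h6 -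
    (4 * st.sign ^ (y.2 : ℕ) * st.sign ^ (x.2 : ℕ)) * h7

/-- The supertraces for vanishing even sources. -/
lemma superTrace_supermatrix_odd (h : IsSupercommutative part) (hD : D.IsGraded st)
    (hΔ : ∀ x y, Ring.inverse Δ x y ∈ Gr.part P 0)
    (hc : ∀ i g, g ∈ Gr.part P i → c g ∈ part i) {JS JSbar : Lab N T I → R}
    (hS : ∀ l, JS l ∈ part 1) (hSbar : ∀ l, JSbar l ∈ part 1)
    (hcomm : ∀ l l' x, JSbar l * JS l' * x = x * (JSbar l * JS l')) (M : ℕ) :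
    superTrace (D.supermatrix st Δ c (fun _ => 0) JS JSbar ^ (2 * (M + 1))) =
      ∑ x : Fin (M + 1) → Vertex N T I 1, ∑ y : Fin (M + 1) → Vertex N T I 1,
        (2 * ((-1) ^ (((x 0).2 : ℕ) + 1) * (-4) ^ (M + 1) *
          ∏ m, st.sign ^ (((x m).2 : ℕ) + (y m).2))) •
          (c (List.ofFn fun j => D.edge Δ ((x j).proj one_lt_two) (y j) *
              D.edge Δ ((y j).proj one_lt_two) (x (j + 1))).prod.trace *
            (List.ofFn fun j => JSbar (y j).1 * JS (x (j + 1)).1).prod) := by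
  classical
  set K := D.supermatrix st Δ c (fun _ => 0) JS JSbar with hK
  set U := superBlock K 0 1 with hU
  set W := superBlock K 1 0 with hW
  have hK0 : ∀ d, superBlock K d d = 0 := superBlock_supermatrix_odd_self JS JSbar
  have hUe : IsEvenBlock part U :=
    isEvenBlock_supermatrix h hD hΔ hc (fun _ => zero_mem _) hS hSbar 0 1
  have hWe : IsEvenBlock part W :=
    isEvenBlock_supermatrix h hD hΔ hc (fun _ => zero_mem _) hS hSbar 1 0
  -- K is off-diagonal, so K² is block diagonal with the blocks U W and W U. Only even powers are
  -- needed.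
  have h00 : superBlock (K ^ 2) 0 0 = U * W := by
    rw [pow_two, superBlock_mul, hK0, zero_mul, zero_add]
  have h11 : superBlock (K ^ 2) 1 1 = W * U := by
    rw [pow_two, superBlock_mul, hK0, zero_mul, add_zero]
  have h01 : superBlock (K ^ 2) 0 1 = 0 := by
    rw [pow_two, superBlock_mul, hK0, hK0, zero_mul, mul_zero, zero_add]
  have h10 : superBlock (K ^ 2) 1 0 = 0 := by
    rw [pow_two, superBlock_mul, hK0, hK0, zero_mul, mul_zero, zero_add]
  have hpow : ∀ m, (W * U) ^ (m + 1) = W * ((U * W) ^ m * U) := by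
    intro m
    induction m with
    | zero => simp
    | succ m ih => rw [pow_succ, ih, pow_succ]; simp only [mul_assoc]
  have heven : ∀ m, IsEvenBlock part ((U * W) ^ m * U) := by
    intro m
    induction m with
    | zero => rwa [pow_zero, one_mul]
    | succ m ih =>
      rw [pow_succ', mul_assoc]
      exact (hUe.mul h hWe).mul h ih
  have h1 : superTrace (K ^ (2 * (M + 1))) = (2 : ℂ) • blockTrace ((U * W) ^ (M + 1)) := by
    -- By cyclicity both diagonal blocks contribute equally, whence the factor 2.
    have h2 : blockTrace ((W * U) ^ (M + 1)) = blockTrace ((U * W) ^ (M + 1)) := by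
      rw [hpow, blockTrace_mul h hWe (heven M), mul_assoc, ← pow_succ]
    rw [pow_mul, superTrace_eq_superBlock, Fin.sum_univ_two, superBlock_pow _ h01 h10,
      superBlock_pow _ h01 h10, h00, h11]
    exact (congrArg₂ (· + ·) rfl h2).trans (two_smul ℂ _).symm
  let wt : Vertex N T I 1 × Vertex N T I 1 → ℂ := fun z =>
    -4 * st.sign ^ ((z.2.2 : ℕ) + (z.1.2 : ℕ))
  have hB : ∀ v v', (U * W) v v' = ∑ z : Vertex N T I 1 × Vertex N T I 1,
      if z.2.proj one_lt_two = v' then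
        wt z • ((D.edge Δ v z.1 * D.edge Δ (z.1.proj one_lt_two) z.2).map c *
          Matrix.scalar A (JSbar z.1.1 * JS z.2.1)) else 0 := by
    intro v v'
    rw [Matrix.mul_apply]
    have hU' := superBlock_supermatrix_odd (D := D) (st := st) (Δ := Δ) (c := c) JS JSbar
      (zero_ne_one : (0 : Fin 2) ≠ 1) v
    have hW' := fun u => superBlock_supermatrix_odd (D := D) (st := st) (Δ := Δ) (c := c) JS JSbar
      (one_ne_zero : (1 : Fin 2) ≠ 0) u v'
    simp only [hU, hW, hK, hU', Finset.sum_mul, ite_mul, zero_mul]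
    rw [Finset.sum_comm, Fintype.sum_prod_type]
    refine Finset.sum_congr rfl fun y _ => ?_
    rw [Finset.sum_ite_eq]
    simp only [Finset.mem_univ, if_true]
    rw [hW', Finset.mul_sum]
    refine Finset.sum_congr rfl fun x _ => ?_
    rw [mul_ite, mul_zero]
    refine if_congr Iff.rfl ?_ rfl
    exact edge_mul_edge h hD hΔ hc (hSbar _) v y x
  let e : NK N × I → ℂ := fun v => (-1) ^ ((v.1.1 : ℕ) - (v.1.2 : ℕ))
  have h2 : blockTrace ((U * W) ^ (M + 1)) =
      ∑ z : Fin (M + 1) → Vertex N T I 1 × Vertex N T I 1,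
        (e ((z 0).2.proj one_lt_two) * ∏ j, wt (z (j + 1))) •
        (c (List.ofFn fun j => D.edge Δ ((z j).2.proj one_lt_two) (z (j + 1)).1 *
          D.edge Δ ((z (j + 1)).1.proj one_lt_two) (z (j + 1)).2).prod.trace *
            (List.ofFn fun j => JSbar (z (j + 1)).1.1 * JS (z (j + 1)).2.1).prod) := by
    rw [blockTrace]
    simp only [← Matrix.trace_smul]
    rw [← Matrix.trace_sum, sum_smul_pow_apply_eq_sum_paths
      (fun z : Vertex N T I 1 × Vertex N T I 1 => z.2.proj one_lt_two)
      (fun v z => wt z • ((D.edge Δ v z.1 * D.edge Δ (z.1.proj one_lt_two) z.2).map c *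
          Matrix.scalar A (JSbar z.1.1 * JS z.2.1))) (U * W) hB M e, Matrix.trace_sum]
    refine Finset.sum_congr rfl fun x _ => ?_
    rw [Matrix.trace_smul, trace_prod_smul_map_mul_scalar _ _ _ fun i => hcomm _ _, smul_smul]
  -- A path through pairs of vertices is separated into its two families. The vertices of J̄_S are
  -- shifted by one position, so that y_j lies between x_j and x_{j+1}.
  let rot : (Fin (M + 1) → Vertex N T I 1) ≃ (Fin (M + 1) → Vertex N T I 1) :=
    Equiv.arrowCongr (Equiv.addRight (1 : Fin (M + 1))) (Equiv.refl _)
  let E : (Fin (M + 1) → Vertex N T I 1) × (Fin (M + 1) → Vertex N T I 1) ≃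
      (Fin (M + 1) → Vertex N T I 1 × Vertex N T I 1) :=
    (Equiv.prodComm _ _).trans ((Equiv.prodCongr rot (Equiv.refl _)).trans
      (Equiv.arrowProdEquivProdArrow _ _ _).symm)
  have hE1 : ∀ x y j, (E (x, y) (j + 1)).1 = y j := by
    intro x y j
    simp [E, rot, Equiv.arrowCongr, Equiv.arrowProdEquivProdArrow]
  have hE2 : ∀ x y j, (E (x, y) j).2 = x j := fun x y j => rfl
  rw [h1, h2, ← E.sum_comp, Fintype.sum_prod_type, Finset.smul_sum]
  refine Finset.sum_congr rfl fun x _ => ?_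
  rw [Finset.smul_sum]
  refine Finset.sum_congr rfl fun y _ => ?_
  have hwt : ∀ j, wt (E (x, y) (j + 1)) =
      -4 * (st.sign ^ ((x (j + 1)).2 : ℕ) * st.sign ^ ((y j).2 : ℕ)) := by
    intro j
    rw [(Prod.ext (hE1 x y j) (hE2 x y (j + 1)) : E (x, y) (j + 1) = (y j, x (j + 1))), ← pow_add]
  simp only [hE1, hE2, hwt]
  rw [smul_smul]
  congr 1
  have h3 : e ((x 0).proj one_lt_two) = (-1) ^ (((x 0).2 : ℕ) + 1) := by
    have hk : ((x 0).2 : ℕ) ≤ 2 * ((x 0).1.1 : ℕ) + 1 := Nat.lt_succ_iff.1 (x 0).2.2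
    simp only [e, Vertex.proj]
    refine SPoly.neg_one_pow_congr ?_
    rw [Nat.cast_sub hk]
    push_cast
    have h5 : (2 : ZMod 2) = 0 := rfl
    rw [h5, zero_mul, zero_add, sub_eq_add_neg, ZMod.neg_eq_self_mod_two, add_comm]
  have h4 : ∏ j, st.sign ^ ((x (j + 1)).2 : ℕ) = ∏ j, st.sign ^ ((x j).2 : ℕ) :=
    Equiv.prod_comp (Equiv.addRight (1 : Fin (M + 1))) fun j => st.sign ^ ((x j).2 : ℕ)
  rw [h3]
  simp only [Finset.prod_mul_distrib, pow_add st.sign, h4, Finset.prod_const, Finset.card_univ,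
    Fintype.card_fin]
  ring

end OddPaths

/-! ### Correlators of the odd operators -/

section PairDerivatives
variable {R : Type*} [Ring R] [Algebra ℂ R]

lemma deriv_prod_mul_of_anticommute {r : ℕ} (d : Module.End ℂ R) (θ : Fin r → R)
    (hd : ∀ j x, d (θ j * x) = -(θ j * d x)) (x : R) (hx : d x = 0) :
    d ((List.ofFn θ).prod * x) = 0 := by
  induction r with
  | zero => simpa using hx
  | succ r ih =>
    rw [List.ofFn_succ, List.prod_cons, mul_assoc, hd, ih _ fun j => hd j.succ, mul_zero, neg_zero]

/-- Derivatives with respect to two families of anticommuting generators. -/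
lemma prod_deriv_mul_deriv_prod_mul {r : ℕ} (d d' : Fin r → Module.End ℂ R) (θ θ' : Fin r → R)
    (δ δ' : Matrix (Fin r) (Fin r) ℂ) (hd : ∀ i j x, d i (θ j * x) = δ i j • x - θ j * d i x)
    (hd' : ∀ i j x, d' i (θ' j * x) = δ' i j • x - θ' j * d' i x)
    (hdθ : ∀ i j x, d' i (θ j * x) = -(θ j * d' i x)) (hdd : ∀ i j, d' i * d j = -(d j * d' i))
    (hθ : ∀ i j, θ i * θ' j = -(θ' j * θ i)) (x : R) (hx : ∀ i, d i x = 0) (hx' : ∀ i, d' i x = 0) :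
    (List.ofFn fun i => d i * d' i).prod ((List.ofFn fun i => θ' i * θ i).prod * x) =
      (δ.det * δ'.det) • x := by
  have hs : ∀ (n : ℕ), (-1 : ℂ) ^ n * (-1) ^ n = 1 := fun n => by
    rw [← mul_pow, neg_one_mul, neg_neg, one_pow]
  have hs' : (((Equiv.Perm.sign (Fin.revPerm : Equiv.Perm (Fin r)) : ℤ) : ℂ)) *
      ((Equiv.Perm.sign (Fin.revPerm : Equiv.Perm (Fin r)) : ℤ) : ℂ) = 1 := by
    rw [← Int.cast_mul, ← Units.val_mul, Int.units_mul_self, Units.val_one, Int.cast_one]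
  -- Sorting the two families costs the same sign for the derivatives as for the generators, and
  -- these cancel. The operators `d'` then act on `θ'` first, treating the product of the `θ` as a
  -- constant; the two reversal signs cancel as well.
  rw [prod_mul_eq_of_anticommute d d' hdd, prod_mul_eq_of_anticommute θ' θ fun i j => hθ i j,
    neg_one_pow_mul_eq_smul, neg_one_pow_mul_eq_smul, smul_mul_assoc, map_smul, LinearMap.smul_apply,
    smul_smul, hs, one_smul, mul_assoc, Module.End.mul_apply,
    prod_deriv_prod_gen d' θ' δ' hd' _ fun i =>
      deriv_prod_mul_of_anticommute (d' i) θ (hdθ i) x (hx' i),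
    map_smul, prod_deriv_prod_gen d θ δ hd x hx, smul_smul]
  congr 1
  linear_combination (δ.det * δ'.det) * hs'

lemma det_incidence {L : Type*} [DecidableEq L] {r : ℕ} (l x : Fin r → L) :
    (Matrix.of fun i j => if l i = x j then (1 : ℂ) else 0).det =
      ∑ σ : Equiv.Perm (Fin r),
        if ∀ i, l (σ i) = x i then ((Equiv.Perm.sign σ : ℤ) : ℂ) else 0 := by
  rw [Matrix.det_apply']
  refine Finset.sum_congr rfl fun σ _ => ?_
  simp only [Matrix.of_apply]
  split_ifs with h
  · rw [Finset.prod_eq_one fun i _ => if_pos (h i), mul_one]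
  · obtain ⟨i, hi⟩ := not_forall.1 h
    rw [Finset.prod_eq_zero (Finset.mem_univ i) (if_neg hi), mul_zero]

/-- As for even sources, but the rotation of r + 1 positions is a cycle of sign (-1)^r, which enters
through the sign of the permutation. -/
lemma sum_sign_rotate {L : Type*} [DecidableEq L] {r : ℕ} (l x : Fin (r + 1) → L) :
    (∑ σ : Equiv.Perm (Fin (r + 1)),
      if ∀ i, l (σ i) = x (i + 1) then ((Equiv.Perm.sign σ : ℤ) : ℂ) else 0) =
      (-1) ^ r * ∑ σ : Equiv.Perm (Fin (r + 1)),
        if ∀ i, l (σ i) = x i then ((Equiv.Perm.sign σ : ℤ) : ℂ) else 0 := by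
  rw [Finset.mul_sum]
  refine Fintype.sum_equiv (Equiv.mulRight (Equiv.addRight (1 : Fin (r + 1)))⁻¹) _ _ fun σ => ?_
  rw [mul_ite, mul_zero]
  refine if_congr ?_ ?_ rfl
  · rw [← (Equiv.addRight (1 : Fin (r + 1))).forall_congr_right (q := fun i =>
      l ((Equiv.mulRight (Equiv.addRight (1 : Fin (r + 1)))⁻¹ σ) i) = x i)]
    simp
  · have h1 : Equiv.addRight (1 : Fin (r + 1)) = finRotate (r + 1) := by
      ext i
      rw [finRotate_succ_apply]
      rfl
    rw [Equiv.coe_mulRight, Equiv.Perm.sign_mul, Equiv.Perm.sign_inv, h1, sign_finRotate]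
    push_cast
    rw [mul_left_comm, ← mul_pow, neg_one_mul, neg_neg, one_pow, mul_one]

end PairDerivatives

section CorrS
variable {P I A T : Type*} {N : ℕ} [Fintype I] [DecidableEq I] [Fintype A] [DecidableEq A] [Fintype T]
  {D : OperatorData P I A T} {st : Statistics} {Δ : Matrix (I × A) (I × A) (Gr P)}

/-- Scaling the sources by 0 fixes the parameters, and the chain rule then produces the factor 0. -/
lemma derivOdd_srcParam (o : Lab N T I ⊕ Lab N T I) (g : Gr P) :
    derivOdd (.inr o) (srcParam P I T N g) = 0 := by
  have h := derivOdd_scaleSources (P := P) 0 0 0 (.inr o) (srcParam P I T N g)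
  rw [scaleSources_srcParam] at h
  have h0 : oddScale P (0 : ℂ) 0 (.inr o : OddGen P N T I) = 0 := by
    rcases o with o | o <;> rfl
  rw [h, h0]
  exact zero_smul ℂ _

lemma derivOdd_mul_derivOdd (o o' : OddGen P N T I) :
    derivOdd o * derivOdd o' = -(derivOdd o' * derivOdd o) := by
  refine TensorProduct.ext' fun f g => ?_
  have h1 := congrArg (f ⊗ₜ[ℂ] ·) (Gr.deriv_comm o o' g)
  exact h1.trans (TensorProduct.tmul_neg _ _)

lemma derivS_mul_derivSbar (l l' : Lab N T I) :
    derivS P l * derivSbar P l' = derivOdd (.inr (.inl l)) * derivOdd (.inr (.inr l')) := by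
  refine LinearMap.ext fun x => ?_
  rw [Module.End.mul_apply, derivS, derivSbar, LinearMap.neg_apply, LinearMap.neg_apply, map_neg]
  exact neg_neg _

lemma derivOdd_oddVar_mul [DecidableEq (OddGen P N T I)] (o o' : OddGen P N T I)
    (x : SrcAlg P N T I) :
    derivOdd o (oddVar o' * x) = (if o' = o then (1 : ℂ) else 0) • x - oddVar o' * derivOdd o x := by
  refine (SPoly.lTensor_deriv_oddVar_mul o o' x).trans ?_
  congr 1
  split_ifs
  · exact (one_smul ℂ _).symm
  · exact (zero_smul ℂ _).symm

lemma derivOdd_srcS_mul [DecidableEq T] {l : Lab N T I} (hl : D.Admissible st l.1 l.2.1)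
    (l' : Lab N T I) (x : SrcAlg P N T I) : derivOdd (.inr (.inl l)) (D.srcS st l' * x) =
      (if l = l' then (1 : ℂ) else 0) • x - D.srcS st l' * derivOdd (.inr (.inl l)) x := by
  classical
  rw [OperatorData.srcS, OperatorData.oddSource]
  split_ifs with h1 h2 h2
  · subst h2
    exact (derivOdd_oddVar_mul _ _ x).trans (by rw [if_pos rfl])
  · refine (derivOdd_oddVar_mul _ _ x).trans ?_
    rw [if_neg fun h => h2 (Sum.inl_injective (Sum.inr_injective h)).symm]
  · exact absurd (h2 ▸ hl) h1
  · rw [zero_mul, map_zero, zero_mul]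
    exact ((congrArg (· - 0) (zero_smul ℂ x)).trans (sub_zero 0)).symm

lemma derivOdd_srcSbar_mul [DecidableEq T] {l : Lab N T I} (hl : D.Admissible st l.1 l.2.1)
    (l' : Lab N T I) (x : SrcAlg P N T I) : derivOdd (.inr (.inr l)) (D.srcSbar st l' * x) =
      (if l = l' then (1 : ℂ) else 0) • x - D.srcSbar st l' * derivOdd (.inr (.inr l)) x := by
  classical
  rw [OperatorData.srcSbar, OperatorData.oddSource]
  split_ifs with h1 h2 h2
  · subst h2
    exact (derivOdd_oddVar_mul _ _ x).trans (by rw [if_pos rfl])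
  · refine (derivOdd_oddVar_mul _ _ x).trans ?_
    rw [if_neg fun h => h2 (Sum.inr_injective (Sum.inr_injective h)).symm]
  · exact absurd (h2 ▸ hl) h1
  · rw [zero_mul, map_zero, zero_mul]
    exact ((congrArg (· - 0) (zero_smul ℂ x)).trans (sub_zero 0)).symm

lemma derivOdd_inr_srcS_mul (l l' : Lab N T I) (x : SrcAlg P N T I) :
    derivOdd (.inr (.inr l)) (D.srcS st l' * x) =
      -(D.srcS st l' * derivOdd (.inr (.inr l)) x) := by
  classical
  rw [OperatorData.srcS, OperatorData.oddSource]
  split_ifs with h1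
  · refine (derivOdd_oddVar_mul _ _ x).trans ?_
    rw [if_neg fun h => Sum.inl_ne_inr (Sum.inr_injective h)]
    exact (congrArg (· - _) (zero_smul ℂ x)).trans (zero_sub _)
  · rw [zero_mul, map_zero, zero_mul]
    exact neg_zero.symm

lemma srcSbar_mul_srcS_mem (l l' : Lab N T I) : D.srcSbar st l * D.srcS st l' ∈
    SPoly.part (Lab N T I) (OddGen P N T I) 0 := by
  have h := SPoly.mul_mem (srcSbar_mem (D := D) (st := st) l) (srcS_mem (D := D) (st := st) l')
  have h0 : (1 + 1 : ZMod 2) = 0 := rfl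
  rwa [h0] at h

lemma atZero_prod_derivS [DecidableEq T] {r : ℕ} {l l' : Fin r → Lab N T I}
    (hl : ∀ m, D.Admissible st (l m).1 (l m).2.1) (hl' : ∀ m, D.Admissible st (l' m).1 (l' m).2.1)
    (a b : Fin r → Lab N T I) (g : Gr P) :
    atZero P N T I ((List.ofFn fun m => derivS P (l m) * derivSbar P (l' m)).prod
      (srcParam P I T N g * (List.ofFn fun j => D.srcSbar st (b j) * D.srcS st (a j)).prod)) =
      ((∑ σ : Equiv.Perm (Fin r), if ∀ i, l (σ i) = a i then ((Equiv.Perm.sign σ : ℤ) : ℂ) else 0) *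
        ∑ ρ : Equiv.Perm (Fin r),
          if ∀ i, l' (ρ i) = b i then ((Equiv.Perm.sign ρ : ℤ) : ℂ) else 0) • g := by
  -- The product of pairs of sources is even and may be moved in front of the parameters, where the
  -- derivatives expect it.
  have h1 : (List.ofFn fun j => D.srcSbar st (b j) * D.srcS st (a j)).prod ∈
      SPoly.part (Lab N T I) (OddGen P N T I) 0 := by
    refine list_prod_mem (S := SPoly.evenSubalgebra (Lab N T I) (OddGen P N T I)) fun x hx => ?_
    obtain ⟨j, rfl⟩ := (List.mem_ofFn' _ _).1 hx
    exact srcSbar_mul_srcS_mem _ _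
  rw [← (SPoly.commute_even h1 _).eq]
  simp only [derivS_mul_derivSbar]
  have h2 := prod_deriv_mul_deriv_prod_mul (fun i => derivOdd (P := P) (.inr (.inl (l i))))
    (fun i => derivOdd (P := P) (.inr (.inr (l' i)))) (fun j => D.srcS st (a j))
    (fun j => D.srcSbar st (b j)) _ _ (fun i j x => derivOdd_srcS_mul (hl i) (a j) x)
    (fun i j x => derivOdd_srcSbar_mul (hl' i) (b j) x)
    (fun i j x => derivOdd_inr_srcS_mul (l' i) (a j) x)
    (fun i j => derivOdd_mul_derivOdd _ _) (fun i j => SPoly.odd_mul_odd (srcS_mem _) (srcSbar_mem _))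
    (srcParam P I T N g) (fun i => derivOdd_srcParam _ g) (fun i => derivOdd_srcParam _ g)
  refine (congrArg (atZero P N T I) h2).trans ?_
  rw [map_smul, atZero_srcParam]
  congr 1
  exact congrArg₂ (· * ·) (det_incidence l a) (det_incidence l' b)

/-- The connected correlators of the odd operators. -/
theorem correlator_derivS (hD : D.IsGraded st) (hΔ : ∀ x y, Ring.inverse Δ x y ∈ Gr.part P 0)
    (M : ℕ) (l l' : Fin (M + 1) → Lab N T I)
    (hl : ∀ m, D.Admissible st (l m).1 (l m).2.1) (hl' : ∀ m, D.Admissible st (l' m).1 (l' m).2.1) :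
    correlator (List.ofFn fun m => derivS P (l m) * derivSbar P (l' m)).prod
        ((-(st.sign / 2)) • superTraceLog
          (D.supermatrix st Δ (srcParam P I T N) (srcO P) (D.srcS st) (D.srcSbar st))) =
      PowerSeries.monomial (2 * (M + 1)) (corrS D st Δ l l') := by
  classical
  ext m
  rw [coeff_correlator, PowerSeries.coeff_monomial]
  have hd : ∀ a b c x, (List.ofFn fun m => derivS P (l m) * derivSbar P (l' m)).prod
      (scaleSources P N T I a b c x) = (b * c) ^ (M + 1) • scaleSources P N T I a b c
        ((List.ofFn fun m => derivS P (l m) * derivSbar P (l' m)).prod x) := by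
    intro a b c x
    have := list_prod_scaleSources a b c (b * c)
      (List.ofFn fun m => derivS P (l m) * derivSbar P (l' m)) (fun d hd x => by
        obtain ⟨i, rfl⟩ := (List.mem_ofFn' _ _).1 hd
        rw [Module.End.mul_apply, derivSbar_scaleSources, map_smul, derivS_scaleSources, smul_smul,
          mul_comm c, Module.End.mul_apply]) x
    rwa [List.length_ofFn] at this
  split_ifs with hm
  · subst hm
    -- The factors 0, 1, 1 remove the even sources and leave the value unchanged.
    have h1 := atZero_deriv_superTrace (D := D) (st := st) (Δ := Δ) (hd 0 1 1) (2 * (M + 1))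
    rw [one_mul, one_pow, one_smul] at h1
    have h2 : (fun l : Lab N T I => (0 : ℂ) • srcO P l) = fun _ => 0 :=
      funext fun l => zero_smul ℂ _
    have h3 : (fun l : Lab N T I => (1 : ℂ) • D.srcS st l) = D.srcS st :=
      funext fun l => one_smul ℂ _
    have h4 : (fun l : Lab N T I => (1 : ℂ) • D.srcSbar st l) = D.srcSbar st :=
      funext fun l => one_smul ℂ _
    rw [h2, h3, h4, superTrace_supermatrix_odd (SPoly.isSupercommutative _ _) hD hΔ
      (fun i g hg => srcParam_mem hg) srcS_mem srcSbar_mem (fun l l' x =>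
        (SPoly.commute_even (srcSbar_mul_srcS_mem l l') x).eq) M, map_sum, map_sum] at h1
    rw [h1]
    have h5 : ∀ (w : ℂ) (g : Gr P) (x y : Fin (M + 1) → Vertex N T I 1),
        atZero P N T I ((List.ofFn fun m => derivS P (l m) * derivSbar P (l' m)).prod
          (w • (srcParam P I T N g *
            (List.ofFn fun j => D.srcSbar st (y j).1 * D.srcS st (x (j + 1)).1).prod))) =
        ∑ ρ : Equiv.Perm (Fin (M + 1)), ∑ σ : Equiv.Perm (Fin (M + 1)),
          if ∀ i, l' (ρ i) = (y i).1 then if ∀ i, l (σ i) = (x i).1 then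
            (w * (-1) ^ M * (((Equiv.Perm.sign σ : ℤ) : ℂ) * ((Equiv.Perm.sign ρ : ℤ) : ℂ))) • g
          else 0 else 0 := by
      intro w g x y
      rw [map_smul, map_smul, atZero_prod_derivS hl hl' (fun j => (x (j + 1)).1) (fun j => (y j).1),
        sum_sign_rotate l (fun j => (x j).1), smul_smul, mul_comm (_ * _) (∑ _, _), Finset.sum_mul,
        Finset.mul_sum, Finset.sum_smul]
      refine Finset.sum_congr rfl fun ρ _ => ?_
      split_ifs with hρ
      · rw [Finset.mul_sum, Finset.mul_sum, Finset.mul_sum, Finset.sum_smul]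
        refine Finset.sum_congr rfl fun σ _ => ?_
        split_ifs with hσ
        · congr 1
          ring
        · rw [mul_zero, mul_zero, mul_zero, zero_smul]
      · rw [zero_mul, mul_zero, zero_smul, Finset.sum_const_zero]
    have h6 : ∀ (ρ σ : Equiv.Perm (Fin (M + 1)))
        (F : (Fin (M + 1) → Vertex N T I 1) → (Fin (M + 1) → Vertex N T I 1) → Gr P),
        (∑ x : Fin (M + 1) → Vertex N T I 1, ∑ y : Fin (M + 1) → Vertex N T I 1,
          if ∀ i, l' (ρ i) = (y i).1 then if ∀ i, l (σ i) = (x i).1 then F x y else 0 else 0) =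
        ∑ k : (m : Fin (M + 1)) → Fin (2 * ((l m).1 : ℕ) + 1 + 1),
          ∑ k' : (m : Fin (M + 1)) → Fin (2 * ((l' m).1 : ℕ) + 1 + 1),
            F (fun m => ⟨l (σ m), k (σ m)⟩) fun m => ⟨l' (ρ m), k' (ρ m)⟩ := by
      intro ρ σ F
      simp only [sum_prescribed_labels l' ρ]
      rw [Finset.sum_comm]
      simp only [sum_prescribed_labels l σ]
      exact Finset.sum_comm
    simp only [map_sum, h5]
    rw [sum_comm_pairs]
    simp only [h6]
    rw [sum_comm_pairs, corrS]
    simp only [Finset.smul_sum, smul_smul]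
    refine Finset.sum_congr rfl fun k _ => Finset.sum_congr rfl fun k' _ =>
      Finset.sum_congr rfl fun ρ _ => Finset.sum_congr rfl fun σ _ => ?_
    simp only [OperatorData.edge, Vertex.proj, Matrix.mul_assoc]
    congr 1
    have h7 : (2 : ℂ) ^ (2 * (M + 1) - 1) = 2 * 4 ^ M := by
      have : 2 * (M + 1) - 1 = 2 * M + 1 := by omega
      rw [this, pow_succ, pow_mul, mul_comm]
      norm_num
    -- The factor -4 comes from each pair of edges, (-1)^M from the rotation of the odd sources. One
    -- minus sign remains, and it cancels the one in (-1)^(k+1).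
    have h8 : (-4 : ℂ) ^ (M + 1) * (-1) ^ M = -(4 * 4 ^ M) := by
      rw [pow_succ, mul_right_comm, ← mul_pow]
      norm_num
      ring
    have h9 : ((2 * (M + 1) : ℕ) : ℂ)⁻¹ = (M + 1 : ℂ)⁻¹ / 2 := by
      push_cast
      rw [mul_inv]
      ring
    rw [h7, h9, div_eq_mul_inv _ (M + 1 : ℂ), pow_succ (-1 : ℂ) (k (σ 0) : ℕ)]
    generalize (-4 : ℂ) ^ (M + 1) = a at h8 ⊢
    generalize (4 : ℂ) ^ M = b at h8 ⊢
    generalize (-1 : ℂ) ^ M = e at h8 ⊢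
    generalize (M + 1 : ℂ)⁻¹ = r
    generalize ∏ m, st.sign ^ ((k (σ m) : ℕ) + (k' (ρ m) : ℕ)) = p
    linear_combination (-(st.sign / 2) * r * (-1) ^ (k (σ 0) : ℕ) * p *
      ((Equiv.Perm.sign σ : ℤ) : ℂ) * ((Equiv.Perm.sign ρ : ℤ) : ℂ)) * h8
  · rw [atZero_deriv_superTrace_eq_zero hm fun x => by
      rw [hd 2 2 2, ← pow_two, ← pow_mul], smul_zero]

/-- Correlators with different numbers of the two kinds of odd operators vanish. -/
theorem correlator_derivS_eq_zero (l l' : List (Lab N T I)) (h : l.length ≠ l'.length) :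
    correlator ((l.map (derivS P)).prod * (l'.map (derivSbar P)).prod)
        ((-(st.sign / 2)) • superTraceLog
          (D.supermatrix st Δ (srcParam P I T N) (srcO P) (D.srcS st) (D.srcSbar st))) = 0 := by
  ext m
  rw [coeff_correlator, map_zero]
  have hd : ∀ a b c x, ((l.map (derivS P)).prod * (l'.map (derivSbar P)).prod)
      (scaleSources P N T I a b c x) = (b ^ l.length * c ^ l'.length) • scaleSources P N T I a b c
        (((l.map (derivS P)).prod * (l'.map (derivSbar P)).prod) x) := by
    intro a b c x
    have h1 := list_prod_scaleSources a b c b (l.map (derivS P)) (fun d hd x => by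
      obtain ⟨i, _, rfl⟩ := List.mem_map.1 hd
      exact derivS_scaleSources a b c i x)
    have h2 := list_prod_scaleSources a b c c (l'.map (derivSbar P)) (fun d hd x => by
      obtain ⟨i, _, rfl⟩ := List.mem_map.1 hd
      exact derivSbar_scaleSources a b c i x)
    rw [Module.End.mul_apply, h2, map_smul, h1, smul_smul, List.length_map, List.length_map,
      mul_comm, Module.End.mul_apply]
  by_cases hm : m = l.length + l'.length
  -- Quadrupling J_S multiplies this supertrace by 2^m, while the derivatives require 4 to the
  -- number of S operators. As m is the total number of operators, a nonzero value would force equal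
  -- numbers of S and S̄.
  · have h1 := atZero_deriv_superTrace (D := D) (st := st) (Δ := Δ) (hd 0 4 1) m
    have h0 := atZero_deriv_superTrace (D := D) (st := st) (Δ := Δ) (hd 0 1 1) m
    have h2 : (fun l : Lab N T I => (0 : ℂ) • srcO P l) = fun _ => 0 :=
      funext fun l => zero_smul ℂ _
    have h3 : (fun l : Lab N T I => (1 : ℂ) • D.srcS st l) = D.srcS st :=
      funext fun l => one_smul ℂ _
    have h4 : (fun l : Lab N T I => (1 : ℂ) • D.srcSbar st l) = D.srcSbar st :=
      funext fun l => one_smul ℂ _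
    rw [h2, superTrace_supermatrix_rescale, map_smul, map_smul, one_pow, mul_one] at h1
    rw [h2, h3, h4, one_pow, one_pow, mul_one, one_smul] at h0
    rw [← h0, ← sub_eq_zero, ← sub_smul] at h1
    rw [(smul_eq_zero.1 h1).resolve_left (sub_ne_zero.2 fun hp => h ?_), smul_zero]
    have h5 : (2 : ℕ) ^ (2 * l.length) = 2 ^ m := by
      rw [pow_mul]
      exact_mod_cast hp
    have := Nat.pow_right_injective le_rfl h5
    omega
  · rw [atZero_deriv_superTrace_eq_zero hm fun x => by rw [hd 2 2 2, ← pow_add], smul_zero]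

end CorrS
end SuperGauss

end

open SuperGauss
theorem mainTheorem3 {P I A T : Type*} [Fintype I] [DecidableEq I] [Fintype A] [DecidableEq A]
    [Fintype T] (N : ℕ) (st : Statistics) (D : OperatorData P I A T) (hD : D.IsGraded st)
    (Δ : Matrix (I × A) (I × A) (Gr P)) (hΔ : IsKernel st Δ) :
    -- the Gaussian theory: `Z[0]` is invertible and `Δ⁻¹` is the propagator
    (IsUnit Δ ∧ IsUnit (vacuum T N st Δ) ∧
      ∀ x y, twoPoint T N st Δ x y = vacuum T N st Δ * srcParam P I T N (Ring.inverse Δ x y)) ∧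
    -- the generating functional, in compact and in explicit form
    connectedFunctional N D st Δ =
      (-(st.sign / 2)) • superTraceLog ((2 : ℂ) • superKernel N D st Δ) ∧
    connectedFunctional N D st Δ =
      (-(st.sign / 2)) • superTraceLog (explicitKernel N D st Δ) ∧
    -- connected correlators of the `O_n`
    (∀ (M : ℕ) (l : Fin (M + 1) → Lab N T I),
      correlator (List.ofFn fun m => derivO P (l m)).prod (connectedFunctional N D st Δ) =
        PowerSeries.monomial (M + 1) (corrO D st Δ l)) ∧
    -- connected correlators of the `S_n`, `S̄_n`
    (∀ (M : ℕ) (l l' : Fin (M + 1) → Lab N T I),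
      (∀ m, D.Admissible st (l m).1 (l m).2.1) → (∀ m, D.Admissible st (l' m).1 (l' m).2.1) →
      correlator (List.ofFn fun m => derivS P (l m) * derivSbar P (l' m)).prod
          (connectedFunctional N D st Δ) =
        PowerSeries.monomial (2 * (M + 1)) (corrS D st Δ l l')) ∧
    -- different numbers of `S_n` and `S̄_n`
    (∀ l l' : List (Lab N T I), l.length ≠ l'.length →
      correlator ((l.map (derivS P)).prod * (l'.map (derivSbar P)).prod)
        (connectedFunctional N D st Δ) = 0) := by
  have hW := connectedFunctional_eq (N := N) hD hΔ
  refine ⟨⟨hΔ.isUnit, hΔ.isUnit_vacuum, hΔ.twoPoint_eq⟩, ?_, ?_, ?_, ?_, ?_⟩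
  · rw [two_smul_superKernel_eq, hW]
  · rw [explicitKernel_eq, hW]
  · intro M l
    rw [hW]
    exact correlator_derivO M l
  · intro M l l' hl hl'
    rw [hW]
    exact correlator_derivS hD hΔ.inverse_mem M l l' hl hl'
  · intro l l' h
    rw [hW]
    exact correlator_derivS_eq_zero l l' h
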